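/- Let $D\subsetneq\mathbb C$ be a simply connected domain, $z\in D$ and $0<\gamma<\sqrt2$. Let $\mathcal H^1$ be the closure of $C_c^\infty(D)$ for the inner product $\langle f,g\rangle_\nabla=\frac1{2\pi}\int_D\nabla f\cdot\nabla g$, let $(e_n)$ be an orthonormal basis of $\mathcal H^1$ and $(a_n)$ independent standard Gaussian variables, so that $h=\sum_n a_ne_n$ is a Gaussian free field in $D$ with zero boundary conditions; for $f=\sum_n\alpha_ne_n\in\mathcal H^1$ put $\langle h,f\rangle_\nabla=\sum_n a_n\alpha_n$. Let $G^x(y)=\log\frac1{|x-y|}+\tilde G^x(y)$ be the Green's function of $D$, i.e. $G^x$ is harmonic on $D\setminus\{x\}$, tends to $0$ at $\partial D$ (including $\infty$ if $D$ is unbounded), and $G^x(y)\sim\log\frac1{|x-y|}$ as $y\to x$. Put $G^x_\epsilon(y)=\log\frac1{\epsilon\vee|x-y|}+\tilde G^x(y)$, and, for $x$ at distance more than $\epsilon$ from $\partial D$, put $$h_\epsilon(x)=\langle h,G^x_\epsilon\rangle_\nabla ,\qquad h^z_\epsilon(x)=h_\epsilon(x)+\gamma\,G^z_\epsilon(x).$$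 Let $\mu^z_\gamma=e^{\gamma h^z}$ be the Liouville measure of the rooted field $h^z=h+\gamma G^z$, i.e. the almost sure weak limit inside $D$ (against continuous functions with compact support in $D$), as $\epsilon\to0$ along powers of two, of the measures $\epsilon^{\gamma^2/2}e^{\gamma h^z_\epsilon(x)}\,dx$ on $\{x: d(x,\partial D)>\epsilon\}$. Let $Q=\frac2\gamma+\frac\gamma2$, let $c=c_\gamma=\frac{2\pi}{2-\gamma^2}$, and let $C(z,D)=|\phi'(z)|^{-1}$ be the conformal radius of $D$ seen from $z$, where $\phi$ is a conformal map from $D$ onto the unit disc with $\phi(z)=0$. Then the limit defining $\mu^z_\gamma$ exists almost surely, $\mu^z_\gamma(B_r(z))$ is a random variable for every $r$, and, as $r\to0$, $$\mathbb E\big[\mu^z_\gamma(B_r(z))\big]\sim c\,r^{\gamma Q}\,\mathbb E\big[e^{\gamma h^z_r(z)}\big],$$ and both sides are $\sim c\,C(z,D)^{3\gamma^2/2}\,r^{2-\gamma^2}$. (Here $f\sim g$ means that $f/g\to1$.) -/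

import Mathlib

open MeasureTheory ProbabilityTheory Filter Topology Set

noncomputable section

namespace LiouvilleGFF

/-! ### The Sobolev space `H¹₀(D)` and the Dirichlet inner product -/

/-- The set `C_D` of smooth real functions with compact support in `D`. -/
def testFunctions (D : Set ℂ) : Set (ℂ → ℝ) :=
  {f | ContDiff ℝ (⊤ : ℕ∞) f ∧ HasCompactSupport f ∧ tsupport f ⊆ D}

/-- Lebesgue measure on `D` divided by `2π`, so that
`⟪f, g⟫_∇ = (1 / 2π) ∫_D ∇f ⬝ ∇g` is the `L²` inner product of the gradients
for this measure. Gradients are `ℂ`-valued, with `ℂ` the Euclidean plane. -/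
def dirichletMeasure (D : Set ℂ) : Measure ℂ :=
  ENNReal.ofReal (1 / (2 * Real.pi)) • (volume.restrict D)

/-- The Hilbert space `H¹ = H¹₀(D)`: the completion of `C_D` for the norm
`‖f‖_∇² = (1 / 2π) ∫_D ‖∇f‖²`. Since `f ↦ ∇f` is an isometric embedding of `(C_D, ‖·‖_∇)` into
the `L²` space of vector fields on `D`, it is realised as the closure of the gradients of test
functions in that space: an element of `H¹` is represented by its gradient. -/
def H1 (D : Set ℂ) : Submodule ℝ (Lp ℂ 2 (dirichletMeasure D)) :=
  (Submodule.span ℝ {v : Lp ℂ 2 (dirichletMeasure D) |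
    ∃ f ∈ testFunctions D, (v : ℂ → ℂ) =ᵐ[dirichletMeasure D] gradient f}).topologicalClosure

/-- `⟪v, u⟫_∇` for `v ∈ H¹` and a function `u` (in `H¹`) whose classical gradient exists almost
everywhere and is its weak gradient, for instance a locally Lipschitz function. -/
def dirichletInner (D : Set ℂ) (v : H1 D) (u : ℂ → ℝ) : ℝ :=
  ∫ y, inner ℝ ((v : Lp ℂ 2 (dirichletMeasure D)) y) (gradient u y) ∂(dirichletMeasure D)

/-! ### Green's function and conformal radius -/

/-- `g` is the Green's function of `D` with pole `x`: it is harmonic on `D \ {x}`, it tends to `0`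
at the boundary of `D` (the point at infinity being a boundary point of an unbounded domain), and
`g y ∼ log (1 / |x - y|)` as `y → x`. -/
structure IsGreenFunction (D : Set ℂ) (x : ℂ) (g : ℂ → ℝ) : Prop where
  harmonic : InnerProductSpace.HarmonicOnNhd g (D \ {x})
  boundary : ∀ δ > 0, ∃ K ⊆ D, IsCompact K ∧ ∀ y ∈ D \ K, |g y| < δ
  pole : Asymptotics.IsEquivalent (𝓝[≠] x) g (fun y => Real.log (1 / ‖x - y‖))

open Classical in
/-- The Green's function `G_D(x, y) = Gˣ(y)`, for `x, y ∈ D`, `x ≠ y`. -/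
def greenFunction (D : Set ℂ) (x y : ℂ) : ℝ :=
  if h : ∃ g, IsGreenFunction D x g then h.choose y else 0

open Classical in
/-- The harmonic correction `G̃ˣ(y) = Gˣ(y) - log (1 / |x - y|)`, extended by continuity
to `y = x`. -/
def greenCorrection (D : Set ℂ) (x y : ℂ) : ℝ :=
  if y = x then limUnder (𝓝[≠] x) (fun w => greenFunction D x w - Real.log (1 / ‖x - w‖))
  else greenFunction D x y - Real.log (1 / ‖x - y‖)

/-- The regularised Green's function `Gˣ_ε(y) = log (1 / (ε ∨ |x - y|)) + G̃ˣ(y)`. -/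
def greenReg (D : Set ℂ) (ε : ℝ) (x y : ℂ) : ℝ :=
  Real.log (1 / max ε ‖x - y‖) + greenCorrection D x y

/-- `φ` is a conformal map from `D` onto the unit disc with `φ x = 0`. -/
def IsConformalToDisc (D : Set ℂ) (x : ℂ) (φ : ℂ → ℂ) : Prop :=
  DifferentiableOn ℂ φ D ∧ BijOn φ D (Metric.ball 0 1) ∧ φ x = 0

open Classical in
/-- The conformal radius `C(x, D) = |φ'(x)|⁻¹`, for a conformal map `φ` from `D` onto the unit disc
with `φ x = 0`. -/
def conformalRadius (D : Set ℂ) (x : ℂ) : ℝ :=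
  if h : ∃ φ, IsConformalToDisc D x φ then ‖deriv h.choose x‖⁻¹ else 0

/-! ### The Gaussian free field and its regularisation

A Gaussian free field with zero boundary conditions in `D` is `h = ∑ₙ aₙ eₙ`, where `(eₙ)` is an
orthonormal basis of `H¹₀(D)` and `(aₙ)` are independent standard Gaussian variables. -/

section Field

variable {Ω : Type*} (D : Set ℂ) (e : HilbertBasis ℕ ℝ (H1 D)) (a : ℕ → Ω → ℝ)

/-- `⟪h, u⟫_∇ = ∑ₙ aₙ αₙ` for `u = ∑ₙ αₙ eₙ` in `H¹`, as the limit of the partial sums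
(which exists almost surely). -/
def gffPairing (u : ℂ → ℝ) (ω : Ω) : ℝ :=
  limUnder atTop (fun N : ℕ => ∑ n ∈ Finset.range N, a n ω * dirichletInner D (e n) u)

/-- The `ε`-regularisation `h_ε(x) = ⟪h, Gˣ_ε⟫_∇` (the mean of `h` on the circle of radius `ε`
around `x`), for `x` at distance more than `ε` from the boundary. -/
def gffReg (ε : ℝ) (x : ℂ) (ω : Ω) : ℝ :=
  gffPairing D e a (greenReg D ε x) ω

/-- The regularisation `hᶻ_ε(x) = h_ε(x) + γ Gᶻ_ε(x)` of the field `hᶻ = h + γ Gᶻ` rooted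
at `z`. -/
def rootedReg (γ : ℝ) (z : ℂ) (ε : ℝ) (x : ℂ) (ω : Ω) : ℝ :=
  gffReg D e a ε x ω + γ * greenReg D ε z x

/-- The measure `ε ^ (γ² / 2) * exp (γ hᶻ_ε(x)) dx` on the set of points at distance more than `ε`
from the boundary of `D`. -/
def rootedApprox (γ : ℝ) (z : ℂ) (ε : ℝ) (ω : Ω) : Measure ℂ :=
  (volume.restrict {x : ℂ | Metric.closedBall x ε ⊆ D}).withDensity
    (fun x => ENNReal.ofReal (ε ^ (γ ^ 2 / 2) * Real.exp (γ * rootedReg D e a γ z ε x ω)))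

end Field

/-- The measures `m k` converge weakly inside `D` to the measure `μ` on `D`: `μ` is carried by `D`
and finite on compact subsets of `D`, and the integrals of continuous functions with compact support
in `D` converge. These conditions determine `μ`. -/
structure IsVagueLimit (D : Set ℂ) (m : ℕ → Measure ℂ) (μ : Measure ℂ) : Prop where
  carried : μ Dᶜ = 0
  finite_on_compacts : ∀ K ⊆ D, IsCompact K → μ K < ⊤
  tendsto : ∀ f : ℂ → ℝ, Continuous f → HasCompactSupport f → tsupport f ⊆ D →
    Tendsto (fun k => ∫ x, f x ∂(m k)) atTop (𝓝 (∫ x, f x ∂μ))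

open Classical in
/-- The Liouville measure `μᶻ_γ = exp (γ hᶻ)` rooted at `z`: the weak limit inside `D` of the
measures `rootedApprox` as `ε → 0` along powers of two (the zero measure where there is no
limit). -/
def rootedLiouville {Ω : Type*} (D : Set ℂ) (e : HilbertBasis ℕ ℝ (H1 D)) (a : ℕ → Ω → ℝ)
    (γ : ℝ) (z : ℂ) (ω : Ω) : Measure ℂ :=
  if h : ∃ μ, IsVagueLimit D (fun k : ℕ => rootedApprox D e a γ z ((2 : ℝ)⁻¹ ^ k) ω) μ
  then h.choose else 0

/-- The constant `Q = 2 / γ + γ / 2`. -/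
def liouvilleQ (γ : ℝ) : ℝ := 2 / γ + γ / 2

end LiouvilleGFF

end

/-! The Riemann map makes everything explicit. If `φ` maps `D` conformally onto the unit disc with
`φ x = 0`, then Gˣ = -log |φ| and G̃ˣ(y) = -log |φ(y) / (y - x)|, so that G̃ˣ(x) = log C(x, D). Such
a `φ` exists by the Riemann mapping theorem, `RiemannMap.exists_bijOn_ball`. The Green's function
and the conformal radius are defined by choice; a maximum principle and Schwarz's lemma show that
the choice is immaterial (`greenFunction_eq`, `conformalRadius_eq`).

The function Gˣ_ε belongs to H¹ and has energy log (1 / ε) + log C(x, D) (`inner_greenVec_self`).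
Hence h_ε(x) is a centred Gaussian with this variance, and the density ε^(γ²/2) exp (γ h_ε(x)) has
mean C(x, D)^(γ²/2) for every ε. The covariance of the field at two points does not depend on the
radii as long as the discs are disjoint (`greenCov_eq_of_le`). So the increments of the density
between radii δ ≤ ε, at two points more than 2ε apart, have a product of mean zero.

Let f be continuous with compact support in D. Rooting at z multiplies the density by exp (γ²
Gᶻ_ε(x)), which is at most a constant times |x - z|^(-γ²) on the support of f; this is integrable as
γ² < 2. The increment of the integral of f is split at distance d from z. Near z a first moment
bound gives d^(2 - γ²). Away from z a second moment is used: the squared density has mean of order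
δ^(-γ²), and only pairs of points within 2ε contribute, a set of area O(ε²), so the L² norm is of
order d^(-γ²) δ^(-γ²/2) ε (`exists_increment_bound`). With δ = ε/2 and d a small power of ε the
bounds are summable along powers of two, again because γ² < 2 (`summable_increment_rate`). The
integrals therefore converge almost surely and in mean. Countably many f suffice to build the limit
measure by the Riesz theorem (`exists_isVagueLimit`), and monotone convergence gives, for open O ⊆
D, that E μ(O) is the integral over O of |x - z|^(-γ²) exp (γ² G̃ᶻ(x)) C(x, D)^(γ²/2)
(`mean_rootedLiouville`).

The factor that multiplies |x - z|^(-γ²) is continuous, with value C(z, D)^(3γ²/2) at z, and |x -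
z|^(-γ²) integrates over the ball of radius r to 2π r^(2 - γ²) / (2 - γ²). On the other side the
Gaussian formula gives E exp (γ hᶻ_r(z)) = C(z, D)^(3γ²/2) r^(-3γ²/2), and γQ = 2 + γ²/2, so the
right-hand side of the claim equals the explicit power of r exactly once r is small. -/

/-! ### Disc automorphisms -/

namespace DiscAut

open ComplexConjugate

/-- The automorphism of the unit disc that sends `a` to `0`. -/
noncomputable def moebius (a w : ℂ) : ℂ := (w - a) / (1 - conj a * w)

theorem one_sub_conj_mul_ne_zero {a w : ℂ} (ha : ‖a‖ < 1) (hw : ‖w‖ < 1) :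
    1 - conj a * w ≠ 0 := by
  intro h
  have h1 : ‖conj a * w‖ = 1 := by rw [← sub_eq_zero.mp h, norm_one]
  rw [norm_mul, Complex.norm_conj] at h1
  nlinarith [norm_nonneg a, norm_nonneg w]

/-- The sign of the right-hand side decides whether the Möbius quotient has modulus below one. -/
theorem sq_norm_one_sub_conj_mul_sub (a w : ℂ) :
    ‖1 - conj a * w‖ ^ 2 - ‖w - a‖ ^ 2 = (1 - ‖a‖ ^ 2) * (1 - ‖w‖ ^ 2) := by
  simp only [Complex.sq_norm, Complex.normSq_apply, Complex.sub_re, Complex.sub_im, Complex.mul_re,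
    Complex.mul_im, Complex.conj_re, Complex.conj_im, Complex.one_re, Complex.one_im]
  ring

theorem norm_moebius_lt_one {a w : ℂ} (ha : ‖a‖ < 1) (hw : ‖w‖ < 1) : ‖moebius a w‖ < 1 := by
  have h0 := norm_pos_iff.mpr (one_sub_conj_mul_ne_zero ha hw)
  rw [moebius, norm_div, div_lt_one h0]
  have h1 : 0 < (1 - ‖a‖ ^ 2) * (1 - ‖w‖ ^ 2) := by
    apply mul_pos <;> nlinarith [norm_nonneg a, norm_nonneg w]
  rw [← sq_norm_one_sub_conj_mul_sub] at h1
  exact lt_of_pow_lt_pow_left₀ 2 h0.le (by linarith)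

@[simp] theorem moebius_self (a : ℂ) : moebius a a = 0 := by simp [moebius]

theorem conj_mul_self (a : ℂ) : conj a * a = (‖a‖ ^ 2 : ℝ) := by
  rw [mul_comm, Complex.mul_conj, Complex.sq_norm]

theorem one_sub_sq_ne_zero {a : ℂ} (ha : ‖a‖ < 1) : (1 - (‖a‖ ^ 2 : ℝ) : ℂ) ≠ 0 := by
  rw [← conj_mul_self]
  exact one_sub_conj_mul_ne_zero ha ha

theorem moebius_neg_moebius {a w : ℂ} (ha : ‖a‖ < 1) (hw : ‖w‖ < 1) :
    moebius (-a) (moebius a w) = w := by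
  have h0 := one_sub_conj_mul_ne_zero ha hw
  have h1 := one_sub_conj_mul_ne_zero ha ha
  have h2 : 1 - conj (-a) * ((w - a) / (1 - conj a * w))
      = (1 - conj a * a) / (1 - conj a * w) := by
    rw [eq_div_iff h0, sub_mul, mul_assoc, div_mul_cancel₀ _ h0, map_neg]; ring
  have h3 : (w - a) / (1 - conj a * w) - -a = w * (1 - conj a * a) / (1 - conj a * w) := by
    rw [eq_div_iff h0, sub_mul, div_mul_cancel₀ _ h0]; ring
  rw [moebius, moebius, h2, h3, div_div_div_cancel_right₀ h0, mul_div_assoc, div_self h1, mul_one]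

theorem moebius_injOn {a : ℂ} (ha : ‖a‖ < 1) : InjOn (moebius a) (Metric.ball 0 1) := by
  intro w hw v hv h
  rw [mem_ball_zero_iff] at hw hv
  rw [← moebius_neg_moebius ha hw, h, moebius_neg_moebius ha hv]

theorem hasDerivAt_moebius {a w : ℂ} (ha : ‖a‖ < 1) (hw : ‖w‖ < 1) :
    HasDerivAt (moebius a) ((1 - (‖a‖ ^ 2 : ℝ)) / (1 - conj a * w) ^ 2) w := by
  have h0 := one_sub_conj_mul_ne_zero ha hw
  have h := ((hasDerivAt_id w).sub_const a).div
    (((hasDerivAt_id w).const_mul (conj a)).const_sub 1) h0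
  refine h.congr_deriv ?_
  rw [← conj_mul_self]
  simp only [id]
  ring

end DiscAut

/-! ### The Riemann mapping theorem -/

namespace RiemannMap

open Complex Metric DiscAut
open scoped Pointwise

/-- After a translation `0 ∉ U`, so a continuous square root `f` exists on `U`. The sets `f '' U`
and `-(f '' U)` are disjoint, hence `f '' U` misses a neighbourhood of `-f x`. -/
theorem exists_injective_not_dense_image {U : Set ℂ} (hUo : IsOpen U)
    (hUc : IsSimplyConnected U) (hU : U ≠ univ) :
    ∃ f : ℂ → ℂ, Function.Injective f ∧ ¬Dense (f '' U) ∧ ∀ z ∈ U, deriv f z ≠ 0 := by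
  wlog hU₀ : 0 ∉ U
  · rw [ne_univ_iff_exists_notMem] at hU
    rcases hU with ⟨a, ha⟩
    specialize this (hUo.vadd (-a)) (by simpa) (by simp [ne_univ_iff_exists_notMem]; exact ⟨a, ha⟩)
      (by simpa [mem_vadd_set_iff_neg_vadd_mem])
    rcases this with ⟨f, hf_inj, hf_dense, hdf⟩
    refine ⟨f ∘ (-a + ·), hf_inj.comp (add_right_injective (-a)), ?_, fun z hz ↦ ?_⟩
    · simpa only [← image_vadd, Set.image_image] using! hf_dense
    · simpa [Function.comp_def, deriv_comp_const_add] using hdf (-a + z) (mapsTo_image _ _ hz)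
  rcases exists_continuousOn_pow_eq hUc hUo continuousOn_id (by rwa [image_id]) two_ne_zero
    with ⟨f, hfc, hf_inv⟩
  replace hf_inv : Function.LeftInverse (· ^ 2) f := hf_inv
  have hf₀ : ∀ z ∈ U, f z ≠ 0 := by
    intro z hz hfz
    simpa [hfz, (ne_of_mem_of_not_mem hz hU₀).symm] using hf_inv z
  have hdf : ∀ z ∈ U, HasStrictDerivAt f (2 * f z)⁻¹ z := by
    intro z hz
    apply HasStrictDerivAt.of_local_left_inverse
    · exact hfc.continuousAt <| hUo.mem_nhds hz
    · simpa using hasStrictDerivAt_pow 2 (f z)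
    · simpa using hf₀ z hz
    · exact .of_forall hf_inv
  refine ⟨f, hf_inv.injective, ?_, fun z hz ↦ ?_⟩
  · simp only [Dense, not_forall, mem_closure_iff_frequently, not_frequently]
    rcases hUc.nonempty with ⟨x, hx⟩
    use -f x
    have : f '' U ∈ 𝓝 (f x) := by
      rw [← (hdf x hx).map_nhds_eq (by simpa using hf₀ x hx)]
      exact Filter.image_mem_map <| hUo.mem_nhds hx
    rw [nhds_neg, eventually_neg]
    filter_upwards [this]
    rintro _ ⟨a, ha, rfl⟩ ⟨b, hb, hab⟩
    -- `f b = -f a` has the same square as `f a`, and squaring inverts `f`; then `f a = -f a` would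
    -- vanish.
    obtain rfl : a = b := by
      rw [← hf_inv b, hab]
      simp [hf_inv a]
    refine hf₀ a ha ?_
    linear_combination hab / 2
  · simpa [(hdf z hz).hasDerivAt.deriv] using hf₀ z hz

/-- An inversion centred at a point `x` whose `ε`-disc is omitted by the image carries the image
into the unit disc. -/
theorem exists_mapsTo_ball_injOn {U : Set ℂ} (hUo : IsOpen U)
    (hUc : IsSimplyConnected U) (hU : U ≠ univ) :
    ∃ f : ℂ → ℂ, MapsTo f U (ball 0 1) ∧ InjOn f U ∧ ∀ z ∈ U, deriv f z ≠ 0 := by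
  rcases exists_injective_not_dense_image hUo hUc hU with ⟨f, hf_inj, hfd, hdf⟩
  obtain ⟨x, ε, hε₀, hε⟩ : ∃ (x : ℂ) (ε : ℝ), 0 < ε ∧ ∀ a ∈ U, ε < dist (f a) x := by
    simpa [Dense, mem_closure_iff_nhds_basis Metric.nhds_basis_closedBall] using hfd
  have hfx : ∀ z ∈ U, f z ≠ x := fun z hz ↦ by simpa using hε₀.trans (hε z hz)
  use fun z ↦ ε / (f z - x)
  refine ⟨fun z hz ↦ ?_, fun z hz w hw heq ↦ ?_, fun z hz ↦ ?_⟩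
  · rw [mem_ball_zero_iff, norm_div, norm_real, Real.norm_of_nonneg hε₀.le, div_lt_one₀]
    · simpa [dist_eq_norm] using hε z hz
    · simpa [sub_eq_zero] using hfx z hz
  · simpa [div_eq_mul_inv, hε₀.ne', hf_inj.eq_iff] using heq
  · have hdz : DifferentiableAt ℂ f z := differentiableAt_of_deriv_ne_zero (hdf z hz)
    rw [(hasDerivAt_const _ _).fun_div (hdz.hasDerivAt.sub_const _) _ |>.deriv] <;>
      simp [*, ne_of_gt, sub_eq_zero]

/-- Holomorphic maps into the unit disc form an equicontinuous family, so that pointwise limits are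
locally uniform. -/
theorem tendstoLocallyUniformlyOn_of_pointwise {U : Set ℂ} (hU : IsOpen U) {ι : Type*}
    {l : Filter ι} {F : ι → ℂ → ℂ} {f : ℂ → ℂ} (hd : ∀ n, DifferentiableOn ℂ (F n) U)
    (hb : ∀ n, MapsTo (F n) U (closedBall 0 1))
    (hp : ∀ z ∈ U, Tendsto (fun n ↦ F n z) l (𝓝 (f z))) :
    TendstoLocallyUniformlyOn F f l U := by
  rw [tendstoLocallyUniformlyOn_iff_forall_isCompact hU]
  intro K hKU hK
  have heq : EquicontinuousOn F K := by
    intro c hc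
    apply EquicontinuousAt.equicontinuousWithinAt
    obtain ⟨R, hR, hRU⟩ := Metric.isOpen_iff.mp hU c (hKU hc)
    rw [Metric.equicontinuousAt_iff]
    intro ε hε
    -- Two values in the unit disc are at most `2` apart, so Schwarz's lemma on `ball c R` gives the
    -- Lipschitz constant `2 / R` at `c`, the same for every `n`.
    refine ⟨min R (ε * R / 2), by positivity, fun w hw n ↦ ?_⟩
    have hwR : w ∈ ball c R := lt_of_lt_of_le hw (min_le_left _ _)
    have h2 : MapsTo (F n) (ball c R) (closedBall (F n c) 2) := by
      intro v hv
      have h3 := hb n (hRU hv)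
      have h4 := hb n (hKU hc)
      rw [mem_closedBall_zero_iff] at h3 h4
      rw [mem_closedBall, dist_eq_norm]
      exact (norm_sub_le _ _).trans (by linarith)
    have h5 := Complex.dist_le_div_mul_dist_of_mapsTo_ball ((hd n).mono hRU) h2 hwR
    rw [dist_comm]
    refine h5.trans_lt ?_
    have h6 : dist w c < ε * R / 2 := lt_of_lt_of_le hw (min_le_right _ _)
    calc 2 / R * dist w c < 2 / R * (ε * R / 2) := by gcongr
      _ = ε := by field_simp
  -- On a compact set, pointwise convergence of an equicontinuous family is uniform.
  have h := (EquicontinuousOn.tendsto_uniformOnFun_iff_pi' (𝔖 := {K}) (by simpa using hK)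
    (by simpa using heq) l f).mpr (by
      rw [tendsto_pi_nhds]
      rintro ⟨x, hx⟩
      exact hp x (hKU (by simpa using hx)))
  exact UniformOnFun.tendsto_iff_tendstoUniformlyOn.mp h K rfl

/-- A nonconstant locally uniform limit of injective holomorphic functions is injective. -/
theorem injOn_of_tendstoLocallyUniformlyOn {U : Set ℂ} (hU : IsOpen U) (hUc : IsPreconnected U)
    {ι : Type*} {l : Filter ι} [l.NeBot] {F : ι → ℂ → ℂ} {f : ℂ → ℂ}
    (hd : ∀ n, DifferentiableOn ℂ (F n) U) (hi : ∀ n, InjOn (F n) U)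
    (hF : TendstoLocallyUniformlyOn F f l U) {z₀ : ℂ} (hz₀ : z₀ ∈ U) (hne : deriv f z₀ ≠ 0) :
    InjOn f U := by
  have hfd : DifferentiableOn ℂ f U := hF.differentiableOn (.of_forall hd) hU
  have hfa : AnalyticOnNhd ℂ f U := hfd.analyticOnNhd hU
  intro a ha b hb hab
  -- Hurwitz's theorem by a quantitative open mapping argument: on a small circle around `a` that
  -- excludes `b`, `f - f a` stays away from `0`. For `F n` close to `f`, the image of the enclosed
  -- disc then contains a whole ball around `F n a`, and `F n b` lies in that ball.
  by_contra hne'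
  have hnc : ∀ᶠ z in 𝓝[≠] a, f z ≠ f a := by
    rcases (hfa a ha).eventually_eq_or_eventually_ne (analyticAt_const (v := f a)) with h | h
    · exfalso
      have h2 := hfa.eqOn_of_preconnected_of_eventuallyEq (analyticOnNhd_const (v := f a)) hUc ha h
      apply hne
      have h3 : f =ᶠ[𝓝 z₀] fun _ ↦ f a := by
        filter_upwards [hU.mem_nhds hz₀] with z hz using h2 hz
      rw [h3.deriv_eq, deriv_const]
    · exact h
  obtain ⟨R, hR, hRU⟩ := Metric.isOpen_iff.mp hU a ha
  obtain ⟨R', hR', hRne⟩ := Metric.eventually_nhds_iff.mp (eventually_nhdsWithin_iff.mp hnc)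
  obtain ⟨r, hr, hrR⟩ : ∃ r, 0 < r ∧ r < min (min R R') (dist a b) :=
    exists_between (by simp [hR, hR', hne'])
  simp only [lt_min_iff] at hrR
  have hcb : closedBall a r ⊆ U := (closedBall_subset_ball hrR.1.1).trans hRU
  obtain ⟨ε, hε, hεr⟩ : ∃ ε > 0, ∀ z ∈ sphere a r, ε ≤ ‖f z - f a‖ := by
    have hc : ContinuousOn (fun z ↦ ‖f z - f a‖) (sphere a r) :=
      ((hfd.continuousOn.mono (sphere_subset_closedBall.trans hcb)).sub continuousOn_const).norm
    obtain ⟨x, hx, hxm⟩ := (isCompact_sphere a r).exists_isMinOn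
      (NormedSpace.sphere_nonempty.mpr hr.le) hc
    refine ⟨‖f x - f a‖, norm_pos_iff.mpr (sub_ne_zero.mpr (hRne ?_ ?_)), fun z hz ↦ hxm hz⟩
    · rw [mem_sphere.mp hx]; exact hrR.1.2
    · rintro rfl; simp at hx; exact hr.ne hx
  have hunif := (tendstoLocallyUniformlyOn_iff_forall_isCompact hU).mp hF (insert b (closedBall a r))
    (insert_subset hb hcb) ((isCompact_closedBall a r).insert b)
  obtain ⟨n, hn⟩ := (Metric.tendstoUniformlyOn_iff.mp hunif (ε / 8) (by positivity)).exists
  have hfn (z) (hz : z ∈ insert b (closedBall a r)) : ‖F n z - f z‖ < ε / 8 := by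
    rw [← dist_eq_norm, dist_comm]; exact hn z hz
  have haK : a ∈ insert b (closedBall a r) := by simp [hr.le]
  have h8 : ∀ z ∈ sphere a r, ε / 2 ≤ ‖F n z - F n a‖ := by
    intro z hz
    have h1 := hεr z hz
    have h2 := hfn z (mem_insert_of_mem _ (sphere_subset_closedBall hz))
    have h3 := hfn a haK
    have h4 : f z - f a = (F n z - F n a) - (F n z - f z) + (F n a - f a) := by ring
    have h5 := (norm_add_le ((F n z - F n a) - (F n z - f z)) (F n a - f a))
    have h6 := norm_sub_le (F n z - F n a) (F n z - f z)
    rw [h4] at h1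
    linarith
  have hdc : DiffContOnCl ℂ (F n) (ball a r) :=
    ((hd n).mono (closure_ball_subset_closedBall.trans hcb)).diffContOnCl
  have hfreq : ∃ᶠ z in 𝓝 a, F n z ≠ F n a := by
    have h9 : ∀ᶠ z in 𝓝[≠] a, F n z ≠ F n a := by
      filter_upwards [self_mem_nhdsWithin, nhdsWithin_le_nhds (hU.mem_nhds ha)] with z hz hzU h
      exact hz (hi n hzU ha h)
    exact h9.frequently.filter_mono nhdsWithin_le_nhds
  have hball := hdc.ball_subset_image_closedBall hr h8 hfreq
  have hmem : F n b ∈ ball (F n a) (ε / 2 / 2) := by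
    rw [mem_ball, dist_eq_norm]
    have h2 := hfn b (mem_insert _ _)
    have h3 := hfn a haK
    have h4 : F n b - F n a = (F n b - f b) - (F n a - f a) := by rw [hab]; ring
    rw [h4]
    exact (norm_sub_le _ _).trans_lt (by linarith)
  obtain ⟨c, hc, hcb'⟩ := hball hmem
  have := hi n (hcb hc) hb hcb'
  subst this
  rw [mem_closedBall, dist_comm] at hc
  linarith [hrR.2]

/-- An injective holomorphic map into the disc that omits a value of the disc can be replaced by
another one with a larger derivative. -/
theorem exists_norm_deriv_lt {U : Set ℂ} (hUo : IsOpen U) (hUc : IsSimplyConnected U) {z₀ : ℂ}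
    (hz₀ : z₀ ∈ U) {f : ℂ → ℂ} (hd : DifferentiableOn ℂ f U) (hm : MapsTo f U (ball 0 1))
    (hi : InjOn f U) (hf0 : f z₀ = 0) (hne : deriv f z₀ ≠ 0) {w : ℂ} (hw : ‖w‖ < 1)
    (hwf : w ∉ f '' U) :
    ∃ g : ℂ → ℂ, DifferentiableOn ℂ g U ∧ MapsTo g U (ball 0 1) ∧ InjOn g U ∧ g z₀ = 0 ∧
      ‖deriv f z₀‖ < ‖deriv g z₀‖ := by
  have hm' : ∀ z ∈ U, ‖f z‖ < 1 := fun z hz ↦ mem_ball_zero_iff.mp (hm hz)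
  have hTd : ∀ z ∈ U, HasDerivAt (fun z ↦ moebius w (f z))
      ((1 - (‖w‖ ^ 2 : ℝ)) / (1 - (starRingEnd ℂ) w * f z) ^ 2 * deriv f z) z := fun z hz ↦
    (hasDerivAt_moebius hw (hm' z hz)).comp z
      ((hd z hz).differentiableAt (hUo.mem_nhds hz)).hasDerivAt
  have hT0 : ∀ z ∈ U, moebius w (f z) ≠ 0 := by
    intro z hz h
    rw [moebius, div_eq_zero_iff, or_iff_left (one_sub_conj_mul_ne_zero hw (hm' z hz)),
      sub_eq_zero] at h
    exact hwf ⟨z, hz, h⟩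
  -- Koebe's square root trick: moving the omitted value `w` to `0` makes the map zero-free, so it
  -- has a square root `h`; recentring `h` at its value `b` in `z₀` gives the new map.
  obtain ⟨h, hhc, hh⟩ := exists_continuousOn_pow_eq hUc hUo
    (g := fun z ↦ moebius w (f z)) (fun z hz ↦ (hTd z hz).continuousAt.continuousWithinAt)
    (by rintro ⟨z, hz, h⟩; exact hT0 z hz h) two_ne_zero
  have hh0 : ∀ z ∈ U, h z ≠ 0 := by
    intro z hz h0
    apply hT0 z hz
    rw [← hh z, h0]; simp
  have hh1 : ∀ z ∈ U, ‖h z‖ < 1 := by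
    intro z hz
    have := norm_moebius_lt_one hw (hm' z hz)
    rw [← hh z, norm_pow] at this
    exact (pow_lt_one_iff_of_nonneg (norm_nonneg _) two_ne_zero).mp this
  have hhd : ∀ z ∈ U, HasDerivAt h ((2 * h z)⁻¹ *
      ((1 - (‖w‖ ^ 2 : ℝ)) / (1 - (starRingEnd ℂ) w * f z) ^ 2 * deriv f z)) z := by
    intro z hz
    have hsq : HasStrictDerivAt (fun v : ℂ ↦ v ^ 2) (2 * h z) (h z) := by
      simpa using hasStrictDerivAt_pow 2 (h z)
    have h2 : 2 * h z ≠ 0 := mul_ne_zero two_ne_zero (hh0 z hz)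
    have hcont : ContinuousAt h z := hhc.continuousAt (hUo.mem_nhds hz)
    have hinv := hsq.to_localInverse h2
    have hcomp := (hinv.hasDerivAt.comp_of_eq z (hTd z hz) (hh z))
    refine hcomp.congr_of_eventuallyEq ?_
    have hev := hcont.eventually (hsq.hasStrictFDerivAt_equiv h2).eventually_left_inverse
    filter_upwards [hev] with y hy
    rw [Function.comp, ← hh y]
    exact hy.symm
  set b := h z₀ with hb
  have hb1 : ‖b‖ < 1 := hh1 z₀ hz₀
  have hgd : ∀ z ∈ U, HasDerivAt (fun z ↦ moebius b (h z)) _ z := fun z hz ↦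
    (hasDerivAt_moebius hb1 (hh1 z hz)).comp z (hhd z hz)
  refine ⟨fun z ↦ moebius b (h z),
    fun z hz ↦ (hgd z hz).differentiableAt.differentiableWithinAt,
    fun z hz ↦ mem_ball_zero_iff.mpr (norm_moebius_lt_one hb1 (hh1 z hz)), ?_, by simp [hb], ?_⟩
  · intro x hx y hy hxy
    have h1 := moebius_injOn hb1 (mem_ball_zero_iff.mpr (hh1 x hx))
      (mem_ball_zero_iff.mpr (hh1 y hy)) hxy
    have h2 : moebius w (f x) = moebius w (f y) := by rw [← hh x, ← hh y, h1]
    exact hi hx hy (moebius_injOn hw (hm hx) (hm hy) h2)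
  · rw [(hgd z₀ hz₀).deriv, hf0, ← hb]
    have hbpos : 0 < ‖b‖ := norm_pos_iff.mpr (hh0 z₀ hz₀)
    have hbw : ‖b‖ ^ 2 = ‖w‖ := by
      rw [← norm_pow, hb, hh z₀, hf0]; simp [moebius]
    have hdpos : 0 < ‖deriv f z₀‖ := norm_pos_iff.mpr hne
    rw [conj_mul_self]
    -- Since `‖w‖ = ‖b‖ ^ 2`, the factor `1 - ‖w‖ ^ 2` is `(1 - ‖b‖ ^ 2) * (1 + ‖b‖ ^ 2)`. The
    -- remaining ratio exceeds `1` because `(1 - ‖b‖) ^ 2 > 0`.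
    have e1 : ‖(1 - ((‖b‖ ^ 2 : ℝ) : ℂ)) / (1 - ((‖b‖ ^ 2 : ℝ) : ℂ)) ^ 2 * ((2 * b)⁻¹ *
        ((1 - ((‖w‖ ^ 2 : ℝ) : ℂ)) / (1 - (starRingEnd ℂ) w * 0) ^ 2 * deriv f z₀))‖
        = (1 + ‖b‖ ^ 2) / (2 * ‖b‖) * ‖deriv f z₀‖ := by
      have hpos : 0 < 1 - ‖b‖ ^ 2 := by nlinarith
      have e2 : (1 - ((‖b‖ ^ 2 : ℝ) : ℂ)) = ((1 - ‖b‖ ^ 2 : ℝ) : ℂ) := by push_cast; ring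
      have e3 : (1 - ((‖w‖ ^ 2 : ℝ) : ℂ)) = (((1 - ‖b‖ ^ 2) * (1 + ‖b‖ ^ 2) : ℝ) : ℂ) := by
        rw [← hbw]; push_cast; ring
      rw [e2, e3]
      simp only [mul_zero, sub_zero, one_pow, div_one, norm_mul, norm_div, norm_pow, norm_inv,
        Complex.norm_real, Real.norm_of_nonneg hpos.le, Real.norm_of_nonneg
          (show (0 : ℝ) ≤ (1 - ‖b‖ ^ 2) * (1 + ‖b‖ ^ 2) by positivity), Complex.norm_ofNat]
      field_simp
    rw [e1]
    have : 1 < (1 + ‖b‖ ^ 2) / (2 * ‖b‖) := by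
      rw [lt_div_iff₀ (by positivity)]
      nlinarith [sq_pos_of_pos (sub_pos.mpr hb1)]
    nlinarith

/-- The Riemann mapping theorem as an extremal problem: maximise `‖deriv f z₀‖` over injective
holomorphic maps into the disc that vanish at `z₀`. A limit of a maximising sequence is injective by
Hurwitz's theorem, and onto because an omitted value would allow a larger derivative. -/
theorem exists_bijOn_ball {U : Set ℂ} (hUo : IsOpen U) (hUc : IsSimplyConnected U)
    (hU : U ≠ univ) {z₀ : ℂ} (hz₀ : z₀ ∈ U) :
    ∃ f : ℂ → ℂ, DifferentiableOn ℂ f U ∧ BijOn f U (ball 0 1) ∧ f z₀ = 0 := by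
  have hconn : IsPreconnected U := hUc.isPathConnected.isConnected.isPreconnected
  let S : Set ℝ := {t | ∃ f : ℂ → ℂ, (DifferentiableOn ℂ f U ∧ MapsTo f U (ball 0 1) ∧ InjOn f U ∧
    f z₀ = 0) ∧ ‖deriv f z₀‖ = t}
  obtain ⟨R, hR, hRU⟩ := Metric.isOpen_iff.mp hUo z₀ hz₀
  have hbdd : BddAbove S := by
    refine ⟨1 / R, ?_⟩
    rintro _ ⟨f, ⟨hd, hm, -, hf0⟩, rfl⟩
    refine Complex.norm_deriv_le_div_of_mapsTo_ball (hd.mono hRU) ?_ hR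
    rw [hf0]
    exact (hm.mono_left hRU).mono_right ball_subset_closedBall
  obtain ⟨t₀, ht₀, ht₀S⟩ : ∃ t > 0, t ∈ S := by
    obtain ⟨f, hm, hi, hd⟩ := exists_mapsTo_ball_injOn hUo hUc hU
    have ha : ‖f z₀‖ < 1 := mem_ball_zero_iff.mp (hm hz₀)
    have hD : ∀ z ∈ U, HasDerivAt (fun z ↦ moebius (f z₀) (f z)) _ z := fun z hz ↦
      (hasDerivAt_moebius ha (mem_ball_zero_iff.mp (hm hz))).comp z
        (differentiableAt_of_deriv_ne_zero (hd z hz)).hasDerivAt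
    refine ⟨‖deriv (fun z ↦ moebius (f z₀) (f z)) z₀‖, ?_, _,
      ⟨fun z hz ↦ (hD z hz).differentiableAt.differentiableWithinAt, fun z hz ↦
        mem_ball_zero_iff.mpr (norm_moebius_lt_one ha (mem_ball_zero_iff.mp (hm hz))),
        fun x hx y hy h ↦ hi hx hy (moebius_injOn ha (hm hx) (hm hy) h), by simp⟩, rfl⟩
    rw [gt_iff_lt, norm_pos_iff, (hD z₀ hz₀).deriv]
    exact mul_ne_zero (div_ne_zero (one_sub_sq_ne_zero ha)
      (pow_ne_zero 2 (one_sub_conj_mul_ne_zero ha ha))) (hd z₀ hz₀)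
  obtain ⟨u, -, hu, huS⟩ := exists_seq_tendsto_sSup ⟨t₀, ht₀S⟩ hbdd
  choose F hF hFu using huS
  -- Convergence along an ultrafilter replaces the extraction of a subsequence: the values lie in a
  -- compact disc, so pointwise limits exist, and equicontinuity makes them locally uniform.
  let l : Filter ℕ := hyperfilter ℕ
  have hl : l ≤ atTop := Nat.hyperfilter_le_atTop
  have hlim : ∀ z ∈ U, ∃ y, Tendsto (fun n ↦ F n z) l (𝓝 y) := by
    intro z hz
    obtain ⟨y, -, hy⟩ := (isCompact_closedBall (0 : ℂ) 1).ultrafilter_le_nhds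
      ((hyperfilter ℕ).map (fun n ↦ F n z)) (by
        rw [Ultrafilter.coe_map, le_principal_iff]
        exact Filter.mem_map.mpr (univ_mem' fun n ↦ ball_subset_closedBall ((hF n).2.1 hz)))
    exact ⟨y, hy⟩
  choose! f hf using hlim
  have hunif : TendstoLocallyUniformlyOn F f l U :=
    tendstoLocallyUniformlyOn_of_pointwise hUo (fun n ↦ (hF n).1)
      (fun n ↦ (hF n).2.1.mono_right ball_subset_closedBall) hf
  have hfd : DifferentiableOn ℂ f U :=
    hunif.differentiableOn (.of_forall fun n ↦ (hF n).1) hUo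
  have hder : ‖deriv f z₀‖ = sSup S := by
    have h1 := ((hunif.deriv (.of_forall fun n ↦ (hF n).1) hUo).tendsto_at hz₀).norm
    refine tendsto_nhds_unique h1 ?_
    have h2 := hu.mono_left hl
    refine h2.congr fun n ↦ ?_
    rw [← hFu n]; rfl
  have hne : deriv f z₀ ≠ 0 := by
    rw [← norm_pos_iff, hder]
    exact ht₀.trans_le (le_csSup hbdd ht₀S)
  have hfi : InjOn f U := injOn_of_tendstoLocallyUniformlyOn hUo hconn (fun n ↦ (hF n).1)
    (fun n ↦ (hF n).2.2.1) hunif hz₀ hne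
  have hf0 : f z₀ = 0 := by
    refine tendsto_nhds_unique (hf z₀ hz₀) ?_
    simp only [(hF _).2.2.2]
    exact tendsto_const_nhds
  have hle : ∀ z ∈ U, ‖f z‖ ≤ 1 := fun z hz ↦ by
    refine le_of_tendsto (hf z hz).norm (.of_forall fun n ↦ ?_)
    exact (mem_ball_zero_iff.mp ((hF n).2.1 hz)).le
  have hopen : IsOpen (f '' U) := by
    rcases (hfd.analyticOnNhd hUo).is_constant_or_isOpen hconn with ⟨w, hw⟩ | h
    · exfalso
      apply hne
      have h3 : f =ᶠ[𝓝 z₀] fun _ ↦ w := by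
        filter_upwards [hUo.mem_nhds hz₀] with z hz using hw z hz
      rw [h3.deriv_eq, deriv_const]
    · exact h U subset_rfl hUo
  -- The limit only satisfies `‖f z‖ ≤ 1`; openness of the image makes the inequality strict.
  have hm : MapsTo f U (ball 0 1) := by
    have h1 : f '' U ⊆ interior (closedBall 0 1) := hopen.subset_interior_iff.mpr (by
      rintro _ ⟨z, hz, rfl⟩; simpa using hle z hz)
    rw [interior_closedBall _ one_ne_zero] at h1
    exact fun z hz ↦ h1 ⟨z, hz, rfl⟩
  refine ⟨f, hfd, ⟨hm, hfi, fun w hw ↦ ?_⟩, hf0⟩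
  by_contra hwf
  obtain ⟨g, hgd, hgm, hgi, hg0, hlt⟩ := exists_norm_deriv_lt hUo hUc hz₀ hfd hm hfi hf0 hne
    (mem_ball_zero_iff.mp hw) hwf
  rw [hder] at hlt
  exact absurd (le_csSup hbdd ⟨g, ⟨hgd, hgm, hgi, hg0⟩, rfl⟩) (not_le.mpr hlt)

end RiemannMap

/-! ### Injective holomorphic functions -/

/-- Near `z` one has `f - f z = k ^ n` with `k` locally invertible. If `n ≥ 2`, multiplying `k` by
an `n`-th root of unity produces two different points with the same value of `f`. -/
theorem deriv_ne_zero_of_injOn {U : Set ℂ} (hU : IsOpen U) {f : ℂ → ℂ}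
    (hd : DifferentiableOn ℂ f U) (hi : InjOn f U) {z : ℂ} (hz : z ∈ U) : deriv f z ≠ 0 := by
  have ha : AnalyticAt ℂ (fun w ↦ f w - f z) z :=
    (hd.analyticAt (hU.mem_nhds hz)).sub analyticAt_const
  have hnc : ¬ ∀ᶠ w in 𝓝 z, f w - f z = 0 := by
    intro h
    have h1 : ∀ᶠ w in 𝓝[≠] z, False := by
      filter_upwards [self_mem_nhdsWithin, nhdsWithin_le_nhds (hU.mem_nhds hz),
        nhdsWithin_le_nhds h] with w hw hwU hwz
      exact hw (hi hwU hz (sub_eq_zero.mp hwz))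
    exact (NeBot.ne (f := 𝓝[≠] z) inferInstance) (by simpa using h1)
  obtain ⟨n, g, hga, hg0, hfg⟩ := ha.exists_eventuallyEq_pow_smul_nonzero_iff.mpr hnc
  have hn0 : n ≠ 0 := by
    rintro rfl
    have := hfg.self_of_nhds
    simp at this
    exact hg0 this.symm
  have hgd : ∀ᶠ w in 𝓝 z, g w ≠ 0 := hga.continuousAt.eventually_ne hg0
  obtain ⟨c, hc⟩ := IsAlgClosed.exists_pow_nat_eq (g z) (Nat.pos_of_ne_zero hn0)
  have hc0 : c ≠ 0 := by
    rintro rfl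
    rw [zero_pow hn0] at hc
    exact hg0 hc.symm
  -- An `n`-th root of `g` near `z`; the logarithm is taken of a quotient close to `1`, inside the
  -- slit plane.
  set h : ℂ → ℂ := fun w ↦ c * Complex.exp (Complex.log (g w / g z) / n) with hh
  have hha : AnalyticAt ℂ h z := by
    refine analyticAt_const.mul (AnalyticAt.cexp' (AnalyticAt.div_const ?_))
    refine (hga.div_const).clog ?_
    rw [div_self hg0]; exact Complex.one_mem_slitPlane
  have hhz : h z = c := by simp [hh, div_self hg0]
  have hhn : ∀ᶠ w in 𝓝 z, h w ^ n = g w := by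
    filter_upwards [hgd] with w hw
    have hnC : (n : ℂ) ≠ 0 := Nat.cast_ne_zero.mpr hn0
    rw [hh]
    simp only
    rw [mul_pow, hc, ← Complex.exp_nat_mul, mul_div_cancel₀ _ hnC,
      Complex.exp_log (div_ne_zero hw hg0), mul_div_cancel₀ _ hg0]
  set k : ℂ → ℂ := fun w ↦ (w - z) * h w with hk
  have hkn : ∀ᶠ w in 𝓝 z, f w - f z = k w ^ n := by
    filter_upwards [hfg, hhn] with w h1 h2
    rw [h1, smul_eq_mul, hk, mul_pow, h2]
  have hka : AnalyticAt ℂ k z := (analyticAt_id.sub analyticAt_const).mul hha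
  have hkd : HasDerivAt k c z := by
    have := ((hasDerivAt_id z).sub_const z).mul hha.differentiableAt.hasDerivAt
    refine this.congr_deriv ?_
    simp [hhz]
  have hks : HasStrictDerivAt k c z := by
    have := hka.hasStrictDerivAt
    rwa [hkd.deriv] at this
  have hkz : k z = 0 := by simp [hk]
  have hmap := hks.map_nhds_eq hc0
  rw [hkz] at hmap
  rcases eq_or_ne n 1 with rfl | hn1
  · have h1 : f =ᶠ[𝓝 z] fun w ↦ k w + f z := by
      filter_upwards [hkn] with w hw
      rw [pow_one] at hw
      rw [← hw]; ring
    rw [h1.deriv_eq, (hkd.add_const (f z)).deriv]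
    exact hc0
  exfalso
  set ζ : ℂ := Complex.exp (2 * Real.pi * Complex.I / n) with hζ
  have hprim : IsPrimitiveRoot ζ n := Complex.isPrimitiveRoot_exp n hn0
  have hζ1 : ζ ≠ 1 := hprim.ne_one (by omega)
  have hζn : ζ ^ n = 1 := hprim.pow_eq_one
  have hV : ∀ᶠ w in 𝓝 z, w ∈ U ∧ f w - f z = k w ^ n := by
    filter_upwards [hU.mem_nhds hz, hkn] with w h1 h2 using ⟨h1, h2⟩
  have hI : k '' {w | w ∈ U ∧ f w - f z = k w ^ n} ∈ 𝓝 (0 : ℂ) := by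
    rw [← hmap]; exact image_mem_map hV
  have hT : Tendsto (fun w ↦ ζ * k w) (𝓝 z) (𝓝 0) := by
    have : ContinuousAt (fun w ↦ ζ * k w) z := hka.continuousAt.const_mul ζ
    have h2 := this.tendsto
    simpa [hkz] using h2
  -- As `k` is open at `z`, the rotated value `ζ * k w` is again some `k v`, and `f v = f w` because
  -- `ζ ^ n = 1`.
  have hI' : ∀ᶠ w in 𝓝 z, ζ * k w ∈ k '' {w | w ∈ U ∧ f w - f z = k w ^ n} := hT hI
  have hz' : ∀ᶠ w in 𝓝[≠] z, w ≠ z := self_mem_nhdsWithin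
  obtain ⟨w, ⟨⟨hwI, hwU, hwk⟩, hwz⟩⟩ :=
    (((hI'.and hV).filter_mono nhdsWithin_le_nhds).and hz').exists
  obtain ⟨v, ⟨hvU, hvk⟩, hv⟩ := hwI
  have h3 : f v = f w := by
    have : f v - f z = f w - f z := by rw [hvk, hwk, hv, mul_pow, hζn, one_mul]
    exact sub_left_injective this
  have h4 := hi hvU hwU h3
  rw [h4] at hv
  have h5 : k w ≠ 0 := by
    intro h0
    rw [h0, zero_pow hn0, sub_eq_zero] at hwk
    exact hwz (hi hwU hz hwk)
  exact hζ1 (mul_right_cancel₀ h5 (by rw [← hv, one_mul]))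

namespace LiouvilleGFF

open Metric DiscAut InnerProductSpace

/-! ### Conformal maps onto the disc -/

section Conformal

variable {D : Set ℂ} {x : ℂ} {φ : ℂ → ℂ}

theorem IsConformalToDisc.norm_lt_one (hφ : IsConformalToDisc D x φ) {y : ℂ} (hy : y ∈ D) :
    ‖φ y‖ < 1 := mem_ball_zero_iff.mp (hφ.2.1.mapsTo hy)

theorem IsConformalToDisc.ne_zero (hφ : IsConformalToDisc D x φ) (hx : x ∈ D) {y : ℂ} (hy : y ∈ D)
    (hyx : y ≠ x) : φ y ≠ 0 := fun h ↦ hyx (hφ.2.1.injOn hy hx (by rw [h, hφ.2.2]))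

theorem IsConformalToDisc.deriv_ne_zero (hφ : IsConformalToDisc D x φ) (hD : IsOpen D) {y : ℂ}
    (hy : y ∈ D) : deriv φ y ≠ 0 := deriv_ne_zero_of_injOn hD hφ.1 hφ.2.1.injOn hy

theorem IsConformalToDisc.analyticAt (hφ : IsConformalToDisc D x φ) (hD : IsOpen D) {y : ℂ}
    (hy : y ∈ D) : AnalyticAt ℂ φ y := hφ.1.analyticAt (hD.mem_nhds hy)

theorem IsConformalToDisc.hasDerivAt (hφ : IsConformalToDisc D x φ) (hD : IsOpen D) {y : ℂ}
    (hy : y ∈ D) : HasDerivAt φ (deriv φ y) y :=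
  (hφ.analyticAt hD hy).differentiableAt.hasDerivAt

theorem IsConformalToDisc.exists_inverse (hφ : IsConformalToDisc D x φ) (hD : IsOpen D) :
    ∃ ψ : ℂ → ℂ, MapsTo ψ (ball 0 1) D ∧ (∀ y ∈ D, ψ (φ y) = y) ∧
      (∀ w ∈ ball (0 : ℂ) 1, φ (ψ w) = w) ∧
      ∀ y ∈ D, HasDerivAt ψ (deriv φ y)⁻¹ (φ y) := by
  have hleft : ∀ y ∈ D, Function.invFunOn φ D (φ y) = y := fun y hy ↦
    hφ.2.1.injOn.leftInvOn_invFunOn hy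
  refine ⟨Function.invFunOn φ D, hφ.2.1.surjOn.mapsTo_invFunOn, hleft, fun w hw ↦
    hφ.2.1.surjOn.rightInvOn_invFunOn hw, fun y hy ↦ ?_⟩
  have h1 := (hφ.analyticAt hD hy).hasStrictDerivAt
  refine (h1.to_local_left_inverse (hφ.deriv_ne_zero hD hy) ?_).hasDerivAt
  filter_upwards [hD.mem_nhds hy] with v hv using hleft v hv

/-- Schwarz's lemma for `φ` composed with the inverse of `φ'`. Used in both directions, it shows
that the conformal radius does not depend on the map chosen. -/
theorem norm_deriv_le_of_isConformalToDisc {φ' : ℂ → ℂ} (hD : IsOpen D) (hx : x ∈ D)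
    (hφ : IsConformalToDisc D x φ) (hφ' : IsConformalToDisc D x φ') :
    ‖deriv φ x‖ ≤ ‖deriv φ' x‖ := by
  obtain ⟨ψ, hm, -, hr, hd⟩ := hφ'.exists_inverse hD
  have hψ0 : ψ 0 = x := by
    have := hφ'.2.1.injOn (hm (mem_ball_self one_pos)) hx
    exact this (by rw [hr 0 (mem_ball_self one_pos), hφ'.2.2])
  have hcomp : DifferentiableOn ℂ (φ ∘ ψ) (ball 0 1) := by
    intro w hw
    have h1 := hd (ψ w) (hm hw)
    rw [hr w hw] at h1
    exact ((hφ.hasDerivAt hD (hm hw)).comp w h1).differentiableAt.differentiableWithinAt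
  have h00 : (φ ∘ ψ) 0 = 0 := by rw [Function.comp, hψ0, hφ.2.2]
  have h1 := Complex.norm_deriv_le_div_of_mapsTo_ball (R₂ := 1) hcomp (by
    rw [h00]
    exact fun w hw ↦ ball_subset_closedBall (hφ.2.1.mapsTo (hm hw))) one_pos
  have h2 : HasDerivAt (φ ∘ ψ) (deriv φ x * (deriv φ' x)⁻¹) 0 := by
    have h3 := hd x hx
    rw [hφ'.2.2] at h3
    exact (show HasDerivAt φ (deriv φ x) (ψ 0) by
      rw [hψ0]; exact hφ.hasDerivAt hD hx).comp 0 h3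
  rw [h2.deriv, norm_mul, norm_inv, div_one, ← div_eq_mul_inv,
    div_le_one (norm_pos_iff.mpr (hφ'.deriv_ne_zero hD hx))] at h1
  exact h1

theorem conformalRadius_eq (hD : IsOpen D) (hx : x ∈ D) (hφ : IsConformalToDisc D x φ) :
    conformalRadius D x = ‖deriv φ x‖⁻¹ := by
  have h : ∃ φ, IsConformalToDisc D x φ := ⟨φ, hφ⟩
  rw [conformalRadius, dif_pos h]
  congr 1
  exact le_antisymm (norm_deriv_le_of_isConformalToDisc hD hx h.choose_spec hφ)
    (norm_deriv_le_of_isConformalToDisc hD hx hφ h.choose_spec)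

/-- Moving the base point of a conformal map by a disc automorphism. -/
theorem IsConformalToDisc.moebius_comp {z : ℂ} (hφ : IsConformalToDisc D z φ) (hx : x ∈ D) :
    IsConformalToDisc D x (fun y ↦ moebius (φ x) (φ y)) := by
  have ha := hφ.norm_lt_one hx
  refine ⟨fun y hy ↦ ?_, ⟨fun y hy ↦ mem_ball_zero_iff.mpr
    (norm_moebius_lt_one ha (hφ.norm_lt_one hy)), fun y hy v hv h ↦ hφ.2.1.injOn hy hv
      (moebius_injOn ha (hφ.2.1.mapsTo hy) (hφ.2.1.mapsTo hv) h), fun w hw ↦ ?_⟩, by simp⟩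
  · exact (hasDerivAt_moebius ha (hφ.norm_lt_one hy)).differentiableAt.comp_differentiableWithinAt
      y (hφ.1 y hy)
  · have hw' := mem_ball_zero_iff.mp hw
    have ha' : ‖-φ x‖ < 1 := by rwa [norm_neg]
    obtain ⟨y, hy, hyw⟩ := hφ.2.1.surjOn (mem_ball_zero_iff.mpr (norm_moebius_lt_one ha' hw'))
    refine ⟨y, hy, ?_⟩
    have := moebius_neg_moebius ha' hw'
    rw [neg_neg] at this
    simp only [hyw, this]

/-- One map `φ`, based at `z`, serves all points `x` at once, which makes continuity in `x` visible.
-/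
theorem IsConformalToDisc.conformalRadius_eq_of_moebius {z : ℂ} (hφ : IsConformalToDisc D z φ)
    (hD : IsOpen D) (hx : x ∈ D) :
    conformalRadius D x = (1 - ‖φ x‖ ^ 2) / ‖deriv φ x‖ := by
  have ha := hφ.norm_lt_one hx
  have hpos : 0 < 1 - ‖φ x‖ ^ 2 := by nlinarith [norm_nonneg (φ x)]
  rw [conformalRadius_eq hD hx (hφ.moebius_comp hx)]
  have h1 := (hasDerivAt_moebius ha ha).comp x (hφ.hasDerivAt hD hx)
  have h2 : deriv (fun y ↦ moebius (φ x) (φ y)) x = _ := h1.deriv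
  have h3 : (1 - ((‖φ x‖ ^ 2 : ℝ) : ℂ)) = ((1 - ‖φ x‖ ^ 2 : ℝ) : ℂ) := by push_cast; ring
  rw [h2, conj_mul_self, h3, norm_mul, norm_div, norm_pow, Complex.norm_real,
    Real.norm_of_nonneg hpos.le]
  field_simp

theorem IsConformalToDisc.continuousOn_conformalRadius {z : ℂ} (hφ : IsConformalToDisc D z φ)
    (hD : IsOpen D) : ContinuousOn (conformalRadius D) D := by
  have h1 : ContinuousOn (fun x ↦ (1 - ‖φ x‖ ^ 2) / ‖deriv φ x‖) D := by
    refine ContinuousOn.div ?_ ?_ fun x hx ↦ (norm_pos_iff.mpr (hφ.deriv_ne_zero hD hx)).ne'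
    · exact continuousOn_const.sub (hφ.1.continuousOn.norm.pow 2)
    · exact (hφ.1.deriv hD).continuousOn.norm
  exact h1.congr fun x hx ↦ hφ.conformalRadius_eq_of_moebius hD hx

end Conformal

/-! ### The Green's function -/

section Green

variable {D : Set ℂ} {x : ℂ} {φ : ℂ → ℂ}

/-- The function `dslope φ x` is `φ(y) / (y - x)`, completed by `deriv φ x` at `x`. It is
holomorphic and zero-free, so minus the logarithm of its modulus is the harmonic correction on all
of `D`. -/
theorem IsConformalToDisc.dslope_ne_zero (hφ : IsConformalToDisc D x φ) (hD : IsOpen D)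
    (hx : x ∈ D) {y : ℂ} (hy : y ∈ D) : dslope φ x y ≠ 0 := by
  rcases eq_or_ne y x with rfl | h
  · rw [dslope_same]; exact hφ.deriv_ne_zero hD hy
  · rw [dslope_of_ne _ h, slope_def_field, hφ.2.2, sub_zero]
    exact div_ne_zero (hφ.ne_zero hx hy h) (sub_ne_zero.mpr h)

theorem IsConformalToDisc.differentiableOn_dslope (hφ : IsConformalToDisc D x φ) (hD : IsOpen D)
    (hx : x ∈ D) : DifferentiableOn ℂ (dslope φ x) D :=
  (Complex.differentiableOn_dslope (hD.mem_nhds hx)).mpr hφ.1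

theorem IsConformalToDisc.eq_mul_dslope (hφ : IsConformalToDisc D x φ) (y : ℂ) :
    φ y = (y - x) * dslope φ x y := by
  have := sub_smul_dslope φ x y
  rw [hφ.2.2, sub_zero, smul_eq_mul] at this
  exact this.symm

theorem IsConformalToDisc.log_norm_eq (hφ : IsConformalToDisc D x φ) (hD : IsOpen D)
    (hx : x ∈ D) {y : ℂ} (hy : y ∈ D) (hyx : y ≠ x) :
    Real.log ‖φ y‖ = Real.log ‖x - y‖ + Real.log ‖dslope φ x y‖ := by
  conv_lhs => rw [hφ.eq_mul_dslope y, norm_mul, ← norm_sub_rev x y]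
  exact Real.log_mul (norm_ne_zero_iff.mpr (sub_ne_zero.mpr hyx.symm))
    (norm_ne_zero_iff.mpr (hφ.dslope_ne_zero hD hx hy))

theorem IsConformalToDisc.continuousOn_log_dslope (hφ : IsConformalToDisc D x φ) (hD : IsOpen D)
    (hx : x ∈ D) : ContinuousOn (fun y ↦ Real.log ‖dslope φ x y‖) D :=
  (hφ.differentiableOn_dslope hD hx).continuousOn.norm.log fun _ hy ↦
    norm_ne_zero_iff.mpr (hφ.dslope_ne_zero hD hx hy)

theorem IsConformalToDisc.isCompact_preimage (hφ : IsConformalToDisc D x φ) (hD : IsOpen D)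
    {ρ : ℝ} (hρ : ρ < 1) : IsCompact {y ∈ D | ‖φ y‖ ≤ ρ} := by
  obtain ⟨ψ, hm, hl, hr, hd⟩ := hφ.exists_inverse hD
  have hsub : closedBall (0 : ℂ) ρ ⊆ ball 0 1 := closedBall_subset_ball hρ
  have hc : ContinuousOn ψ (closedBall 0 ρ) := by
    intro w hw
    have h1 := (hd (ψ w) (hm (hsub hw))).continuousAt
    rw [hr w (hsub hw)] at h1
    exact h1.continuousWithinAt
  convert (isCompact_closedBall (0 : ℂ) ρ).image_of_continuousOn hc using 1
  ext y
  constructor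
  · rintro ⟨hy, hyρ⟩
    exact ⟨φ y, by simpa using hyρ, hl y hy⟩
  · rintro ⟨w, hw, rfl⟩
    refine ⟨hm (hsub hw), ?_⟩
    rw [hr w (hsub hw)]
    simpa using hw

theorem IsConformalToDisc.isGreenFunction (hφ : IsConformalToDisc D x φ) (hD : IsOpen D)
    (hx : x ∈ D) : IsGreenFunction D x (fun y ↦ -Real.log ‖φ y‖) where
  harmonic := fun y hy ↦ ((hφ.analyticAt hD hy.1).harmonicAt_log_norm
    (hφ.ne_zero hx hy.1 hy.2)).neg
  boundary := by
    intro δ hδ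
    -- Outside this compact set `-log ‖φ y‖` is below `δ / 2`, which leaves room for the strict
    -- inequality.
    refine ⟨_, sep_subset _ _, hφ.isCompact_preimage hD (ρ := Real.exp (-δ / 2))
      (by rw [Real.exp_lt_one_iff]; linarith), fun y hy ↦ ?_⟩
    obtain ⟨hyD, hyK⟩ := hy
    have h1 : Real.exp (-δ / 2) < ‖φ y‖ := by
      by_contra h
      exact hyK ⟨hyD, not_lt.mp h⟩
    have h2 : -δ / 2 < Real.log ‖φ y‖ := (Real.lt_log_iff_exp_lt ((Real.exp_pos _).trans h1)).mpr h1
    have h3 : Real.log ‖φ y‖ ≤ 0 := Real.log_nonpos (norm_nonneg _) (hφ.norm_lt_one hyD).le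
    rw [abs_of_nonneg (by linarith)]
    linarith
  pole := by
    have hlog : Tendsto (fun y ↦ Real.log (1 / ‖x - y‖)) (𝓝[≠] x) atTop := by
      have h1 : Tendsto (fun y ↦ ‖x - y‖) (𝓝[≠] x) (𝓝[>] 0) := by
        refine tendsto_nhdsWithin_iff.mpr ⟨?_, ?_⟩
        · have : Tendsto (fun y ↦ ‖x - y‖) (𝓝 x) (𝓝 ‖x - x‖) := by
            exact (continuous_const.sub continuous_id).norm.tendsto x
          rw [sub_self, norm_zero] at this
          exact this.mono_left nhdsWithin_le_nhds
        · filter_upwards [self_mem_nhdsWithin] with y hy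
          exact norm_pos_iff.mpr (sub_ne_zero.mpr (Ne.symm hy))
      simp only [one_div, Real.log_inv]
      exact tendsto_neg_atBot_atTop.comp (Real.tendsto_log_nhdsGT_zero.comp h1)
    rw [Asymptotics.IsEquivalent]
    have hc : Tendsto (fun y ↦ -Real.log ‖dslope φ x y‖) (𝓝[≠] x)
        (𝓝 (-Real.log ‖dslope φ x x‖)) :=
      ((hφ.continuousOn_log_dslope hD hx).continuousAt (hD.mem_nhds hx)).neg.tendsto.mono_left
        nhdsWithin_le_nhds
    have ho : (fun y ↦ -Real.log ‖dslope φ x y‖) =o[𝓝[≠] x] fun y ↦ Real.log (1 / ‖x - y‖) :=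
      (hc.isBigO_one ℝ).trans_isLittleO
        (Asymptotics.isLittleO_const_left.mpr (Or.inr (tendsto_norm_atTop_atTop.comp hlog)))
    refine ho.congr' ?_ EventuallyEq.rfl
    filter_upwards [self_mem_nhdsWithin, nhdsWithin_le_nhds (hD.mem_nhds hx)] with y hy hyD
    simp only [Pi.sub_apply, hφ.log_norm_eq hD hx hyD hy, one_div, Real.log_inv]
    ring

/-- A maximum principle: a harmonic function on an open set is bounded by `M` if its superlevel
sets above `M` are relatively compact. -/
theorem le_of_harmonicOnNhd_of_isCompact {U : Set ℂ} (hU : IsOpen U) {v : ℂ → ℝ}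
    (hv : HarmonicOnNhd v U) {M : ℝ} {K : Set ℂ} (hK : IsCompact K) (hKU : K ⊆ U)
    (hout : ∀ y ∈ U \ K, v y ≤ M) : ∀ y ∈ U, v y ≤ M := by
  intro y hy
  by_contra! hlt
  have hyK : y ∈ K := by
    by_contra h
    exact absurd (hout y ⟨hy, h⟩) (not_le.mpr hlt)
  obtain ⟨m, hmK, hm⟩ := hK.exists_isMaxOn ⟨y, hyK⟩ (hv.continuousOn.mono hKU)
  have hMm : M < v m := hlt.trans_le (hm hyK)
  have hmax : ∀ w ∈ U, v w ≤ v m := by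
    intro w hw
    by_cases hwK : w ∈ K
    · exact hm hwK
    · exact (hout w ⟨hw, hwK⟩).trans hMm.le
  -- The set where the maximum is attained is compact, being closed in `K`, and open by the maximum
  -- modulus principle for `exp F` with `Re F = v`. A nonempty clopen set would be the whole plane,
  -- which is not compact.
  have hset : {w ∈ K | v w = v m} = {w | w ∈ U ∧ v w = v m} := by
    ext w
    refine ⟨fun h ↦ ⟨hKU h.1, h.2⟩, fun h ↦ ⟨?_, h.2⟩⟩
    by_contra hwK
    exact absurd (hout w ⟨h.1, hwK⟩) (not_le.mpr (h.2 ▸ hMm))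
  have hcl : IsCompact {w ∈ K | v w = v m} := by
    have h1 := (hv.continuousOn.mono hKU).preimage_isClosed_of_isClosed hK.isClosed
      (isClosed_singleton (x := v m))
    exact hK.of_isClosed_subset h1 inter_subset_left
  have hop : IsOpen {w ∈ K | v w = v m} := by
    rw [hset, isOpen_iff_mem_nhds]
    rintro w ⟨hwU, hwm⟩
    have h1 : ∀ᶠ u in 𝓝 w, HarmonicAt v u := (hv w hwU).eventually
    obtain ⟨R, hR, hRU⟩ := Metric.eventually_nhds_iff_ball.mp h1
    obtain ⟨F, hF, hFv⟩ := HarmonicOnNhd.exists_analyticOnNhd_ball_re_eq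
      (f := v) (z := w) (R := R) hRU
    have hwb : w ∈ ball w R := mem_ball_self hR
    have hUn : ∀ᶠ u in 𝓝 w, u ∈ ball w R := ball_mem_nhds w hR
    have hdiff : ∀ᶠ u in 𝓝 w, DifferentiableAt ℂ (fun u ↦ Complex.exp (F u)) u := by
      filter_upwards [hUn] with u hu
      exact (hF u hu).differentiableAt.cexp
    have hvle : ∀ᶠ u in 𝓝 w, v u ≤ v m := by
      filter_upwards [hU.mem_nhds hwU] with u hu using hmax u hu
    have hloc : IsLocalMax (norm ∘ fun u ↦ Complex.exp (F u)) w := by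
      filter_upwards [hUn, hvle] with u hu hle
      simp only [Function.comp, Complex.norm_exp]
      rw [show (F u).re = v u from hFv hu, show (F w).re = v w from hFv hwb, hwm]
      exact Real.exp_le_exp.mpr hle
    have hconst := Complex.eventually_eq_of_isLocalMax_norm hdiff hloc
    filter_upwards [hUn, hconst, hU.mem_nhds hwU] with u hu hc huU
    refine ⟨huU, ?_⟩
    have h2 := congrArg norm hc
    simp only [Complex.norm_exp] at h2
    rw [← hwm, ← show (F u).re = v u from hFv hu, ← show (F w).re = v w from hFv hwb]
    exact Real.exp_injective h2
  have hne : {w ∈ K | v w = v m}.Nonempty := ⟨m, hmK, rfl⟩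
  have huniv := IsClopen.eq_univ ⟨hcl.isClosed, hop⟩ hne
  exact noncompact_univ ℂ (huniv ▸ hcl)

/-- The poles agree only to leading order, so `g₁ - g₂` is merely `o(G)` at `x`, with `G = -log
‖φ‖`. Subtracting `η * G` makes the difference small near `x`; the maximum principle applies on `D \
{x}`, and then `δ` and `η` tend to `0`. -/
theorem IsGreenFunction.le (hD : IsOpen D) (hx : x ∈ D) (hφ : IsConformalToDisc D x φ)
    {g₁ g₂ : ℂ → ℝ} (h₁ : IsGreenFunction D x g₁) (h₂ : IsGreenFunction D x g₂) {y : ℂ}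
    (hy : y ∈ D) (hyx : y ≠ x) : g₁ y ≤ g₂ y := by
  set G : ℂ → ℝ := fun y ↦ -Real.log ‖φ y‖ with hG
  have hGf := hφ.isGreenFunction hD hx
  have hG0 : ∀ y ∈ D, 0 ≤ G y := fun y hy ↦
    neg_nonneg.mpr (Real.log_nonpos (norm_nonneg _) (hφ.norm_lt_one hy).le)
  have hUo : IsOpen (D \ {x}) := hD.sdiff isClosed_singleton
  have hkey : ∀ η > 0, ∀ δ > 0, g₁ y - g₂ y - η * G y ≤ δ := by
    intro η hη δ hδ
    obtain ⟨K₁, hK₁D, hK₁, hb₁⟩ := h₁.boundary (δ / 2) (by positivity)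
    obtain ⟨K₂, hK₂D, hK₂, hb₂⟩ := h₂.boundary (δ / 2) (by positivity)
    have ho : (fun y ↦ g₁ y - g₂ y) =o[𝓝[≠] x] G := by
      have e1 := h₁.pole.trans hGf.pole.symm
      have e2 := h₂.pole.trans hGf.pole.symm
      refine (e1.isLittleO.sub e2.isLittleO).congr_left fun y ↦ ?_
      simp only [Pi.sub_apply]; ring
    have hnear : ∀ᶠ y in 𝓝[≠] x, g₁ y - g₂ y - η * G y ≤ δ := by
      filter_upwards [ho.bound hη, nhdsWithin_le_nhds (hD.mem_nhds hx)] with y h hyD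
      rw [Real.norm_eq_abs, Real.norm_of_nonneg (hG0 y hyD)] at h
      linarith [le_abs_self (g₁ y - g₂ y)]
    obtain ⟨R, hR, hRn⟩ := Metric.eventually_nhds_iff_ball.mp (eventually_nhdsWithin_iff.mp hnear)
    have hharm : HarmonicOnNhd (g₁ - g₂ - η • G) (D \ {x}) := fun y hy ↦
      ((h₁.harmonic y hy).sub (h₂.harmonic y hy)).sub ((hGf.harmonic y hy).const_smul)
    refine le_of_harmonicOnNhd_of_isCompact hUo hharm (M := δ) (K := (K₁ ∪ K₂) \ ball x R)
      ((hK₁.union hK₂).diff isOpen_ball) ?_ ?_ y ⟨hy, hyx⟩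
    · rintro w ⟨hw, hwR⟩
      refine ⟨(union_subset hK₁D hK₂D) hw, ?_⟩
      rintro rfl
      exact hwR (mem_ball_self hR)
    · rintro w ⟨⟨hwD, hwx⟩, hwK⟩
      by_cases hwR : w ∈ ball x R
      · exact hRn w hwR hwx
      · have hw' : w ∉ K₁ ∪ K₂ := fun h ↦ hwK ⟨h, hwR⟩
        have a1 := hb₁ w ⟨hwD, fun h ↦ hw' (Or.inl h)⟩
        have a2 := hb₂ w ⟨hwD, fun h ↦ hw' (Or.inr h)⟩
        have a3 : 0 ≤ η * G w := mul_nonneg hη.le (hG0 w hwD)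
        simp only [Pi.sub_apply, Pi.smul_apply, smul_eq_mul]
        linarith [le_abs_self (g₁ w), neg_abs_le (g₂ w)]
  have hkey2 : ∀ η > 0, g₁ y - g₂ y ≤ η * G y := fun η hη ↦
    le_of_forall_pos_le_add fun δ hδ ↦ by linarith [hkey η hη δ hδ]
  have : g₁ y - g₂ y ≤ 0 := by
    refine le_of_forall_pos_le_add fun δ hδ ↦ ?_
    have hpos : 0 < G y + 1 := by linarith [hG0 y hy]
    refine (hkey2 (δ / (G y + 1)) (by positivity)).trans ?_
    rw [zero_add, div_mul_eq_mul_div, div_le_iff₀ hpos]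
    nlinarith
  linarith

theorem greenFunction_eq (hD : IsOpen D) (hx : x ∈ D) (hφ : IsConformalToDisc D x φ) {y : ℂ}
    (hy : y ∈ D) (hyx : y ≠ x) : greenFunction D x y = -Real.log ‖φ y‖ := by
  have h : ∃ g, IsGreenFunction D x g := ⟨_, hφ.isGreenFunction hD hx⟩
  rw [greenFunction, dif_pos h]
  exact le_antisymm
    (h.choose_spec.le hD hx hφ (hφ.isGreenFunction hD hx) hy hyx)
    ((hφ.isGreenFunction hD hx).le hD hx hφ h.choose_spec hy hyx)

theorem greenCorrection_eq (hD : IsOpen D) (hx : x ∈ D) (hφ : IsConformalToDisc D x φ) {y : ℂ}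
    (hy : y ∈ D) : greenCorrection D x y = -Real.log ‖dslope φ x y‖ := by
  have hne : ∀ w ∈ D, w ≠ x → greenFunction D x w - Real.log (1 / ‖x - w‖)
      = -Real.log ‖dslope φ x w‖ := by
    intro w hw hwx
    rw [greenFunction_eq hD hx hφ hw hwx, hφ.log_norm_eq hD hx hw hwx, one_div, Real.log_inv]
    ring
  rcases eq_or_ne y x with rfl | h
  · rw [greenCorrection, if_pos rfl]
    apply Tendsto.limUnder_eq
    refine Tendsto.congr' (f₁ := fun w ↦ -Real.log ‖dslope φ y w‖) ?_
      (((hφ.continuousOn_log_dslope hD hx).continuousAt (hD.mem_nhds hx)).neg.tendsto.mono_left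
        nhdsWithin_le_nhds)
    filter_upwards [self_mem_nhdsWithin, nhdsWithin_le_nhds (hD.mem_nhds hx)] with w hw hwD
    exact (hne w hwD hw).symm
  · rw [greenCorrection, if_neg h, hne y hy h]

theorem continuousOn_greenCorrection (hD : IsOpen D) (hx : x ∈ D) (hφ : IsConformalToDisc D x φ) :
    ContinuousOn (greenCorrection D x) D :=
  (hφ.continuousOn_log_dslope hD hx).neg.congr fun _ hy ↦ greenCorrection_eq hD hx hφ hy

theorem greenCorrection_self (hD : IsOpen D) (hx : x ∈ D) (hφ : IsConformalToDisc D x φ) :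
    greenCorrection D x x = Real.log (conformalRadius D x) := by
  rw [greenCorrection_eq hD hx hφ hx, conformalRadius_eq hD hx hφ, dslope_same, Real.log_inv]

end Green
end LiouvilleGFF

namespace LiouvilleGFF

open Metric DiscAut InnerProductSpace ComplexConjugate

/-! ### Integrals over annuli -/

/-- The annulus `s ≤ |w - x| < ε`. -/
def annulus (x : ℂ) (s ε : ℝ) : Set ℂ := {w | s ≤ ‖w - x‖ ∧ ‖w - x‖ < ε}

theorem measurableSet_annulus (x : ℂ) (s ε : ℝ) : MeasurableSet (annulus x s ε) :=
  (measurableSet_le measurable_const (measurable_id.sub_const x).norm).inter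
    (measurableSet_lt (measurable_id.sub_const x).norm measurable_const)

theorem annulus_subset_ball (x : ℂ) (s ε : ℝ) : annulus x s ε ⊆ ball x ε := fun _ hw ↦
  mem_ball_iff_norm.mpr hw.2

theorem integral_radial (f : ℝ → ℝ) (x : ℂ) :
    ∫ w, f ‖w - x‖ = 2 * Real.pi * ∫ r in Ioi (0 : ℝ), r * f r := by
  rw [integral_sub_right_eq_self (fun w : ℂ ↦ f ‖w‖) x, integral_fun_norm_addHaar]
  simp only [Complex.finrank_real_complex, measureReal_def, Complex.volume_ball]
  simp only [ENNReal.ofReal_one, one_pow, one_mul, ENNReal.coe_toReal, NNReal.coe_real_pi,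
    smul_eq_mul, nsmul_eq_mul, Nat.cast_ofNat, Nat.reduceSub, pow_one]
  ring

theorem integrable_radial {f : ℝ → ℝ} {x : ℂ} :
    Integrable (fun w : ℂ ↦ f ‖w - x‖) ↔ IntegrableOn (fun r ↦ r * f r) (Ioi (0 : ℝ)) := by
  have h : Integrable (fun w : ℂ ↦ f ‖w - x‖) ↔ Integrable (fun w : ℂ ↦ f ‖w‖) := by
    refine ⟨fun h ↦ ?_, fun h ↦ h.comp_sub_right x⟩
    have := h.comp_add_right x
    simpa using this
  rw [h, integrable_fun_norm_addHaar]
  simp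

theorem integral_annulus_inv_sq {s ε : ℝ} (hs : 0 < s) (hsε : s ≤ ε) (x : ℂ) :
    ∫ w in annulus x s ε, (‖w - x‖ ^ 2)⁻¹ = 2 * Real.pi * Real.log (ε / s) := by
  rw [← integral_indicator (measurableSet_annulus x s ε)]
  have h1 : (annulus x s ε).indicator (fun w : ℂ ↦ (‖w - x‖ ^ 2)⁻¹)
      = fun w ↦ (Ico s ε).indicator (fun r : ℝ ↦ (r ^ 2)⁻¹) ‖w - x‖ := by
    ext w
    by_cases h : ‖w - x‖ ∈ Ico s ε
    · rw [indicator_of_mem h, indicator_of_mem (show w ∈ annulus x s ε from h)]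
    · rw [indicator_of_notMem h, indicator_of_notMem (show w ∉ annulus x s ε from h)]
  rw [h1, integral_radial]
  congr 1
  have h2 : (fun r : ℝ ↦ r * (Ico s ε).indicator (fun r : ℝ ↦ (r ^ 2)⁻¹) r)
      = (Ico s ε).indicator (fun r ↦ r⁻¹) := by
    ext r
    by_cases hr : r ∈ Ico s ε
    · have : r ≠ 0 := (hs.trans_le hr.1).ne'
      simp only [indicator_of_mem hr]
      field_simp
    · simp [indicator_of_notMem hr]
  have h3 : Ioi (0 : ℝ) ∩ Ico s ε = Ico s ε := inter_eq_right.mpr fun r hr ↦ hs.trans_le hr.1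
  rw [h2, setIntegral_indicator measurableSet_Ico, h3, integral_Ico_eq_integral_Ioc,
    ← intervalIntegral.integral_of_le hsε, integral_inv_of_pos hs (hs.trans_le hsε)]

theorem integrableOn_annulus_of_continuousOn {x : ℂ} {s ε : ℝ} {F : Type*} [NormedAddCommGroup F]
    {f : ℂ → F} (hf : ContinuousOn f {w | s ≤ ‖w - x‖ ∧ ‖w - x‖ ≤ ε}) :
    IntegrableOn f (annulus x s ε) := by
  have hK : IsCompact {w : ℂ | s ≤ ‖w - x‖ ∧ ‖w - x‖ ≤ ε} := by
    refine (isCompact_closedBall x ε).of_isClosed_subset ?_ fun w hw ↦ mem_closedBall_iff_norm.mpr hw.2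
    have hc : Continuous fun w : ℂ ↦ ‖w - x‖ := by fun_prop
    exact (isClosed_le continuous_const hc).inter (isClosed_le hc continuous_const)
  exact (hf.integrableOn_compact hK).mono_set fun w hw ↦ ⟨hw.1, hw.2.le⟩

/-- In polar coordinates the integrand over the circle of radius `r` becomes `exp (iθ) * A`, whose
integral is a multiple of the contour integral of `A`, zero by Cauchy's theorem. This orthogonality
removes the cross terms in the energies and makes covariances independent of the radius. -/
theorem integral_annulus_conj_inv_mul {x : ℂ} {s ε : ℝ} (hs : 0 < s) {U : Set ℂ}
    (hxU : closedBall x ε ⊆ U) {A : ℂ → ℂ} (hA : DifferentiableOn ℂ A U) :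
    ∫ w in annulus x s ε, conj ((w - x)⁻¹) * A w = 0 := by
  rw [← integral_indicator (measurableSet_annulus x s ε)]
  set f : ℂ → ℂ := (annulus x s ε).indicator fun w ↦ conj ((w - x)⁻¹) * A w with hf
  rw [← integral_add_right_eq_self f x, ← Complex.integral_comp_polarCoord_symm]
  have hcm : ∀ p : ℝ × ℝ, Complex.polarCoord.symm p + x = circleMap x p.1 p.2 := by
    intro p
    rw [Complex.polarCoord_symm_apply, circleMap, Complex.exp_mul_I]
    push_cast
    ring
  have hrep : ∀ p ∈ polarCoord.target, p.1 • f (Complex.polarCoord.symm p + x)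
      = (Ico s ε ×ˢ univ).indicator
        (fun p : ℝ × ℝ ↦ Complex.exp (p.2 * Complex.I) * A (circleMap x p.1 p.2)) p := by
    rintro ⟨r, θ⟩ hp
    rw [hcm]
    have hr : 0 < r := hp.1
    have hn : ‖circleMap x r θ - x‖ = r := by
      rw [circleMap_sub_center, norm_circleMap_zero, abs_of_pos hr]
    by_cases hrs : r ∈ Ico s ε
    · have h1 : circleMap x r θ ∈ annulus x s ε := by
        rw [annulus, mem_ofPred_eq, hn]; exact hrs
      rw [hf, indicator_of_mem h1, indicator_of_mem (show (r, θ) ∈ Ico s ε ×ˢ univ from ⟨hrs, trivial⟩),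
        circleMap_sub_center, circleMap, zero_add]
      have h2 : conj ((r * Complex.exp (θ * Complex.I))⁻¹) = (r : ℂ)⁻¹ * Complex.exp (θ * Complex.I) := by
        rw [mul_inv, map_mul, ← Complex.exp_neg, ← Complex.exp_conj, map_inv₀, Complex.conj_ofReal]
        simp
      rw [h2, Complex.real_smul, ← mul_assoc, ← mul_assoc, mul_inv_cancel₀
        (Complex.ofReal_ne_zero.mpr hr.ne'), one_mul]
    · rw [hf, indicator_of_notMem, indicator_of_notMem, smul_zero]
      · exact fun h ↦ hrs h.1
      · rw [annulus, mem_ofPred_eq, hn]; exact hrs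
  rw [setIntegral_congr_fun polarCoord.open_target.measurableSet hrep,
    setIntegral_indicator (measurableSet_Ico.prod MeasurableSet.univ)]
  have hset : polarCoord.target ∩ Ico s ε ×ˢ univ = Ico s ε ×ˢ Ioo (-Real.pi) Real.pi := by
    ext ⟨r, θ⟩
    simp only [polarCoord, mem_inter_iff, mem_prod, mem_Ioi, mem_univ, and_true]
    exact ⟨fun h ↦ ⟨h.2, h.1.2⟩, fun h ↦ ⟨⟨hs.trans_le h.1.1, h.2⟩, h.1⟩⟩
  have hcont : ContinuousOn (fun p : ℝ × ℝ ↦ Complex.exp (p.2 * Complex.I) * A (circleMap x p.1 p.2))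
      (Icc s ε ×ˢ Icc (-Real.pi) Real.pi) := by
    refine ContinuousOn.mul (by fun_prop) (hA.continuousOn.comp (by
      unfold circleMap; fun_prop) ?_)
    rintro ⟨r, θ⟩ ⟨hr, -⟩
    refine hxU (mem_closedBall_iff_norm.mpr ?_)
    rw [circleMap_sub_center, norm_circleMap_zero, abs_of_pos (hs.trans_le hr.1)]
    exact hr.2
  rw [hset, Measure.volume_eq_prod, setIntegral_prod _ ?_]
  · refine (setIntegral_congr_fun measurableSet_Ico fun r hr ↦ ?_).trans (integral_zero _ _)
    simp only
    have hrpos : 0 < r := hs.trans_le hr.1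
    have hc : ∮ w in C(x, r), A w = 0 := by
      refine DiffContOnCl.circleIntegral_eq_zero hrpos.le (DifferentiableOn.diffContOnCl ?_)
      exact hA.mono (closure_ball_subset_closedBall.trans
        ((closedBall_subset_closedBall hr.2.le).trans hxU))
    set F : ℝ → ℂ := fun θ ↦ Complex.exp (θ * Complex.I) * A (circleMap x r θ) with hF
    have hper : Function.Periodic F (2 * Real.pi) := by
      intro θ
      simp only [hF]
      rw [periodic_circleMap x r θ]
      congr 1
      push_cast
      rw [add_mul, Complex.exp_add, Complex.exp_two_pi_mul_I, mul_one]
    have h0 : ∫ θ in (0 : ℝ)..(0 + 2 * Real.pi), F θ = 0 := by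
      rw [circleIntegral] at hc
      have h1 : ∀ θ, deriv (circleMap x r) θ • A (circleMap x r θ) = (r * Complex.I : ℂ) * F θ := by
        intro θ
        rw [deriv_circleMap, circleMap, zero_add, smul_eq_mul, hF]
        ring
      simp only [h1] at hc
      rw [intervalIntegral.integral_const_mul, mul_eq_zero] at hc
      rw [zero_add]
      refine hc.resolve_left (mul_ne_zero (Complex.ofReal_ne_zero.mpr hrpos.ne') Complex.I_ne_zero)
    rw [hper.intervalIntegral_add_eq 0 (-Real.pi), show -Real.pi + 2 * Real.pi = Real.pi by ring,
      intervalIntegral.integral_of_le (by linarith [Real.pi_pos]),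
      integral_Ioc_eq_integral_Ioo] at h0
    exact h0
  · exact (hcont.integrableOn_compact (isCompact_Icc.prod isCompact_Icc)).mono_set
      (prod_mono Ico_subset_Icc_self Ioo_subset_Icc_self)

/-! ### The gradient of the regularised Green's function -/

/-- Locally `log ‖f‖` is the real part of `log (f / f y)` plus a constant, the division bringing the
argument close to `1`; the gradient of a real part is the conjugate of the derivative. -/
theorem hasGradientAt_log_norm {f : ℂ → ℂ} {f' y : ℂ} (hf : HasDerivAt f f' y) (h0 : f y ≠ 0) :
    HasGradientAt (fun w ↦ Real.log ‖f w‖) (conj (f' / f y)) y := by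
  have h1 : HasDerivAt (fun w ↦ Complex.log (f w / f y)) (f' / f y) y := by
    have := (hf.div_const (f y)).clog (by rw [div_self h0]; exact Complex.one_mem_slitPlane)
    simpa [div_self h0] using this
  have h2 := Complex.reCLM.hasFDerivAt.comp y (h1.hasFDerivAt.restrictScalars ℝ)
  have h3 : (fun w ↦ Real.log ‖f w‖) =ᶠ[𝓝 y]
      fun w ↦ (Complex.reCLM ∘ fun w ↦ Complex.log (f w / f y)) w + Real.log ‖f y‖ := by
    filter_upwards [hf.continuousAt.eventually_ne h0] with w hw
    simp only [Function.comp, Complex.reCLM_apply, Complex.log_re, norm_div]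
    rw [Real.log_div (norm_ne_zero_iff.mpr hw) (norm_ne_zero_iff.mpr h0)]
    ring
  rw [hasGradientAt_iff_hasFDerivAt]
  refine ((h2.add_const (Real.log ‖f y‖)).congr_of_eventuallyEq h3).congr_fderiv ?_
  ext v
  · simp [Complex.inner]

/-- The gradient at `y` of the regularised Green's function with pole `x`, in terms of a conformal
map `φ` of the domain onto the disc with `φ x = 0`. -/
noncomputable def greenGrad (φ : ℂ → ℂ) (x : ℂ) (ε : ℝ) (y : ℂ) : ℂ :=
  conj ((if ‖y - x‖ < ε then (y - x)⁻¹ else 0) - deriv φ y / φ y)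

section Energy

variable {D : Set ℂ} {x : ℂ} {φ : ℂ → ℂ}

theorem hasGradientAt_greenReg (hD : IsOpen D) (hx : x ∈ D) (hφ : IsConformalToDisc D x φ) {ε : ℝ}
    {y : ℂ} (hy : y ∈ D) (hyx : y ≠ x) (hyε : ‖y - x‖ ≠ ε) :
    HasGradientAt (greenReg D ε x) (greenGrad φ x ε y) y := by
  have hφy := hφ.ne_zero hx hy hyx
  have h1 := hasGradientAt_log_norm (hφ.hasDerivAt hD hy) hφy
  have hev : ∀ᶠ w in 𝓝 y, w ∈ D ∧ w ≠ x := (hD.eventually_mem hy).and (isOpen_ne.eventually_mem hyx)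
  have hcorr : ∀ w ∈ D, w ≠ x → greenCorrection D x w = Real.log ‖w - x‖ - Real.log ‖φ w‖ := by
    intro w hw hwx
    rw [greenCorrection_eq hD hx hφ hw, hφ.log_norm_eq hD hx hw hwx, norm_sub_rev x w]
    ring
  have hcn : ContinuousAt (fun w : ℂ ↦ ‖w - x‖) y := by fun_prop
  rw [hasGradientAt_iff_hasFDerivAt] at h1 ⊢
  rcases lt_or_gt_of_ne hyε with hlt | hgt
  · have h2 := hasGradientAt_log_norm ((hasDerivAt_id y).sub_const x) (sub_ne_zero.mpr hyx)
    rw [hasGradientAt_iff_hasFDerivAt] at h2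
    refine (((h2.sub h1).const_add (Real.log (1 / ε))).congr_of_eventuallyEq ?_).congr_fderiv ?_
    · filter_upwards [hev, hcn.eventually (gt_mem_nhds hlt)] with w hw hwε
      rw [norm_sub_rev] at hwε
      rw [greenReg, max_eq_left hwε.le, hcorr w hw.1 hw.2]
      simp
    · rw [← map_sub, ← map_sub, greenGrad, if_pos hlt]
      simp
  · refine (h1.neg.congr_of_eventuallyEq ?_).congr_fderiv ?_
    · filter_upwards [hev, hcn.eventually (lt_mem_nhds hgt)] with w hw hwε
      rw [norm_sub_rev] at hwε
      rw [greenReg, max_eq_right hwε.le, hcorr w hw.1 hw.2, one_div, Real.log_inv, norm_sub_rev]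
      simp only [Pi.neg_apply]
      ring
    · rw [← map_neg, greenGrad, if_neg hgt.le.not_gt]
      simp

theorem volume_sphere_complex (x : ℂ) (ε : ℝ) : volume {y : ℂ | ‖y - x‖ = ε} = 0 := by
  rcases eq_or_ne ε 0 with rfl | h
  · have : {y : ℂ | ‖y - x‖ = 0} = {x} := by ext y; simp [sub_eq_zero]
    rw [this]; simp
  · have : {y : ℂ | ‖y - x‖ = ε} = sphere x ε := by ext y; simp
    rw [this]; exact Measure.addHaar_sphere_of_ne_zero volume x h

theorem ae_ne_and_norm_ne (x : ℂ) (ε : ℝ) : ∀ᵐ y : ℂ, y ≠ x ∧ ‖y - x‖ ≠ ε := by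
  have h1 : ∀ᵐ y : ℂ, y ≠ x := by simp [ae_iff]
  have h2 : ∀ᵐ y : ℂ, ‖y - x‖ ≠ ε := by
    rw [ae_iff]; simpa using volume_sphere_complex x ε
  filter_upwards [h1, h2] with y a b using ⟨a, b⟩

theorem dirichletMeasure_absolutelyContinuous (D : Set ℂ) :
    dirichletMeasure D ≪ volume.restrict D := Measure.smul_absolutelyContinuous

theorem gradient_greenReg_ae (hD : IsOpen D) (hx : x ∈ D) (hφ : IsConformalToDisc D x φ) (ε : ℝ) :
    ∀ᵐ y ∂(volume.restrict D), gradient (greenReg D ε x) y = greenGrad φ x ε y := by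
  filter_upwards [ae_restrict_of_ae (ae_ne_and_norm_ne x ε), ae_restrict_mem hD.measurableSet]
    with y hy hyD
  exact (hasGradientAt_greenReg hD hx hφ hyD hy.1 hy.2).gradient

/-! ### Dirichlet energies -/

theorem deriv_div_eq (hφ : IsConformalToDisc D x φ) (hD : IsOpen D) (hx : x ∈ D) {y : ℂ}
    (hy : y ∈ D) (hyx : y ≠ x) :
    deriv φ y / φ y = (y - x)⁻¹ + deriv (dslope φ x) y / dslope φ x y := by
  have hg := hφ.dslope_ne_zero hD hx hy
  have hyx' := sub_ne_zero.mpr hyx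
  have h2 : HasDerivAt φ (1 * dslope φ x y + (y - x) * deriv (dslope φ x) y) y := by
    have hd := ((hφ.differentiableOn_dslope hD hx).differentiableAt (hD.mem_nhds hy)).hasDerivAt
    have := ((hasDerivAt_id y).sub_const x).mul hd
    exact this.congr_of_eventuallyEq (.of_forall hφ.eq_mul_dslope)
  rw [h2.deriv, hφ.eq_mul_dslope y]
  field_simp

theorem differentiableOn_logDeriv_dslope (hφ : IsConformalToDisc D x φ) (hD : IsOpen D)
    (hx : x ∈ D) : DifferentiableOn ℂ (fun y ↦ deriv (dslope φ x) y / dslope φ x y) D :=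
  ((hφ.differentiableOn_dslope hD hx).deriv hD).div (hφ.differentiableOn_dslope hD hx) fun _ hy ↦
    hφ.dslope_ne_zero hD hx hy

/-- Inside the disc the simple poles at `x` cancel, and the gradient stays bounded. -/
theorem greenGrad_of_lt (hφ : IsConformalToDisc D x φ) (hD : IsOpen D) (hx : x ∈ D) {y : ℂ}
    (hy : y ∈ D) (hyx : y ≠ x) {ε : ℝ} (h : ‖y - x‖ < ε) :
    greenGrad φ x ε y = -conj (deriv (dslope φ x) y / dslope φ x y) := by
  rw [greenGrad, if_pos h, deriv_div_eq hφ hD hx hy hyx, ← map_neg]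
  congr 1
  ring

theorem greenGrad_of_le {y : ℂ} {ε : ℝ} (h : ε ≤ ‖y - x‖) :
    greenGrad φ x ε y = -conj (deriv φ y / φ y) := by
  rw [greenGrad, if_neg h.not_gt, ← map_neg, zero_sub]

theorem aestronglyMeasurable_greenGrad (hφ : IsConformalToDisc D x φ) (hD : IsOpen D) (ε : ℝ) :
    AEStronglyMeasurable (greenGrad φ x ε) (volume.restrict D) := by
  have h1 : AEMeasurable φ (volume.restrict D) :=
    (hφ.1.continuousOn.aestronglyMeasurable hD.measurableSet).aemeasurable
  have h2 : Measurable fun y : ℂ ↦ if ‖y - x‖ < ε then (y - x)⁻¹ else 0 :=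
    Measurable.ite (measurableSet_lt (measurable_id.sub_const x).norm measurable_const)
      (measurable_id.sub_const x).inv measurable_const
  have h3 : AEMeasurable (fun y ↦ (if ‖y - x‖ < ε then (y - x)⁻¹ else 0) - deriv φ y / φ y)
      (volume.restrict D) := h2.aemeasurable.sub ((measurable_deriv φ).aemeasurable.div h1)
  exact (Complex.continuous_conj.measurable.comp_aemeasurable h3).aestronglyMeasurable

/-- Conformal invariance of the energy of the Green's function. -/
theorem lintegral_sq_norm_logDeriv (hφ : IsConformalToDisc D x φ) (hD : IsOpen D) {S : Set ℂ}
    (hS : MeasurableSet S) (hSD : S ⊆ D) :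
    ∫⁻ y in S, ENNReal.ofReal (‖deriv φ y / φ y‖ ^ 2)
      = ∫⁻ w in φ '' S, ENNReal.ofReal ((‖w‖ ^ 2)⁻¹) := by
  have hd : ∀ y ∈ S, HasFDerivWithinAt φ
      ((deriv φ y • (1 : ℂ →L[ℂ] ℂ)).restrictScalars ℝ) S y := by
    intro y hy
    have := (hφ.hasDerivAt hD (hSD hy)).hasFDerivAt.restrictScalars ℝ
    refine (this.congr_fderiv ?_).hasFDerivWithinAt
    ext v
    simp [mul_comm]
  rw [lintegral_image_eq_lintegral_abs_det_fderiv_mul volume hS hd (hφ.2.1.injOn.mono hSD)]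
  refine lintegral_congr fun y ↦ ?_
  have hdet : ((deriv φ y • (1 : ℂ →L[ℂ] ℂ)).restrictScalars ℝ).det = ‖deriv φ y‖ ^ 2 := by
    have hmul : (((deriv φ y • (1 : ℂ →L[ℂ] ℂ)).restrictScalars ℝ : ℂ →L[ℝ] ℂ) : ℂ →ₗ[ℝ] ℂ)
        = LinearMap.mul ℝ ℂ (deriv φ y) := by
      ext v
      simp
    rw [ContinuousLinearMap.det, hmul, Complex.sq_norm, ← Algebra.norm_complex_apply,
      Algebra.norm_apply]
    rfl
  rw [hdet, abs_of_nonneg (by positivity), ← ENNReal.ofReal_mul (by positivity), norm_div, div_pow,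
    div_eq_mul_inv]

end Energy
end LiouvilleGFF

namespace LiouvilleGFF

open Metric DiscAut InnerProductSpace ComplexConjugate

theorem integrable_inner_of_memLp {μ : Measure ℂ} {f g : ℂ → ℂ} (hf : MemLp f 2 μ)
    (hg : MemLp g 2 μ) : Integrable (fun y ↦ inner ℝ (f y) (g y)) μ := by
  refine (L2.integrable_inner (𝕜 := ℝ) hf.toLp hg.toLp).congr ?_
  filter_upwards [hf.coeFn_toLp, hg.coeFn_toLp] with y h1 h2
  rw [h1, h2]

/-! ### Exact energies and covariances of the regularised Green's functions -/

section Energy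

variable {D : Set ℂ} {x : ℂ} {φ : ℂ → ℂ}

/-- With the next lemma: the image of a small disc of radius `s` lies between discs of radii `c *
s`, for `c` on either side of `‖deriv φ x‖`, since `dslope φ x` is continuous at `x`. -/
theorem eventually_norm_lt_mul (hφ : IsConformalToDisc D x φ) (hD : IsOpen D) (hx : x ∈ D)
    {c : ℝ} (hc : ‖deriv φ x‖ < c) :
    ∀ᶠ s in 𝓝[>] (0 : ℝ), ∀ y ∈ ball x s, ‖φ y‖ < c * s := by
  have h1 : ∀ᶠ y in 𝓝 x, ‖dslope φ x y‖ < c := by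
    have h2 := ((hφ.differentiableOn_dslope hD hx).continuousOn.continuousAt (hD.mem_nhds hx)).norm
    exact h2.eventually (gt_mem_nhds (by simpa only [dslope_same] using hc))
  obtain ⟨R, hR, hRb⟩ := Metric.eventually_nhds_iff_ball.mp h1
  filter_upwards [Ioo_mem_nhdsGT hR] with s hs y hy
  have hb := hRb y (ball_subset_ball hs.2.le hy)
  rw [mem_ball_iff_norm] at hy
  rw [hφ.eq_mul_dslope y, norm_mul, mul_comm]
  exact mul_lt_mul' hb.le hy (norm_nonneg _) ((norm_nonneg _).trans_lt hb)

/-- Continuity of the inverse map at `0` is needed to know that a small `‖φ y‖` forces `y` to be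
near `x`. -/
theorem eventually_lt_of_norm_lt_mul (hφ : IsConformalToDisc D x φ) (hD : IsOpen D) (hx : x ∈ D)
    {c : ℝ} (hc0 : 0 < c) (hc : c < ‖deriv φ x‖) :
    ∀ᶠ s in 𝓝[>] (0 : ℝ), ∀ y ∈ D, ‖φ y‖ < c * s → ‖y - x‖ < s := by
  have h1 : ∀ᶠ y in 𝓝 x, c < ‖dslope φ x y‖ := by
    have h2 := ((hφ.differentiableOn_dslope hD hx).continuousOn.continuousAt (hD.mem_nhds hx)).norm
    exact h2.eventually (lt_mem_nhds (by simpa only [dslope_same] using hc))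
  obtain ⟨ψ, hm, hl, hr, hd⟩ := hφ.exists_inverse hD
  have h3 : ContinuousAt ψ 0 := by
    have := (hd x hx).continuousAt
    rwa [hφ.2.2] at this
  have hψ0 : ψ 0 = x := by rw [← hφ.2.2, hl x hx]
  have h4 : ∀ᶠ w in 𝓝 (0 : ℂ), c < ‖dslope φ x (ψ w)‖ := by
    have h5 := h3.tendsto
    rw [hψ0] at h5
    exact h5.eventually h1
  obtain ⟨R, hR, hRb⟩ := Metric.eventually_nhds_iff_ball.mp h4
  filter_upwards [Ioo_mem_nhdsGT (div_pos hR hc0)] with s hs y hy hys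
  have hsR : c * s < R := by
    have := hs.2
    rw [lt_div_iff₀ hc0] at this
    linarith
  have h6 := hRb (φ y) (mem_ball_zero_iff.mpr (hys.trans hsR))
  rw [hl y hy] at h6
  rw [hφ.eq_mul_dslope y, norm_mul] at hys
  by_contra! hcon
  have : s * c ≤ ‖y - x‖ * ‖dslope φ x y‖ := mul_le_mul hcon h6.le hc0.le (norm_nonneg _)
  linarith

theorem lintegral_annulus_inv_sq {ρ : ℝ} (hρ : 0 < ρ) (hρ1 : ρ ≤ 1) :
    ∫⁻ w in annulus 0 ρ 1, ENNReal.ofReal ((‖w‖ ^ 2)⁻¹)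
      = ENNReal.ofReal (2 * Real.pi * Real.log (1 / ρ)) := by
  have h := integral_annulus_inv_sq hρ hρ1 0
  simp only [sub_zero] at h
  rw [← h, ofReal_integral_eq_lintegral_ofReal]
  · refine integrableOn_annulus_of_continuousOn (ContinuousOn.inv₀ (by fun_prop) ?_)
    rintro w ⟨hw, -⟩
    rw [sub_zero] at hw
    exact (pow_pos (hρ.trans_le hw) 2).ne'
  · exact .of_forall fun w ↦ by positivity

/-- By conformal invariance the energy is that of the image region, which lies in the annulus `ρ ≤
|w| < 1`. In `le_lintegral_logDeriv` the region contains the annulus instead. -/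
theorem lintegral_logDeriv_le (hφ : IsConformalToDisc D x φ) (hD : IsOpen D) {s ρ : ℝ}
    (hρ : 0 < ρ) (hρ1 : ρ ≤ 1) (h : ∀ y ∈ D, ‖φ y‖ < ρ → ‖y - x‖ < s) :
    ∫⁻ y in D \ ball x s, ENNReal.ofReal (‖deriv φ y / φ y‖ ^ 2)
      ≤ ENNReal.ofReal (2 * Real.pi * Real.log (1 / ρ)) := by
  rw [lintegral_sq_norm_logDeriv hφ hD (hD.measurableSet.diff measurableSet_ball) sdiff_subset,
    ← lintegral_annulus_inv_sq hρ hρ1]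
  refine lintegral_mono_set ?_
  rintro _ ⟨y, ⟨hyD, hys⟩, rfl⟩
  rw [annulus, mem_ofPred_eq, sub_zero]
  refine ⟨?_, hφ.norm_lt_one hyD⟩
  by_contra! hlt
  exact hys (mem_ball_iff_norm.mpr (h y hyD hlt))

theorem le_lintegral_logDeriv (hφ : IsConformalToDisc D x φ) (hD : IsOpen D) {s ρ : ℝ}
    (hρ : 0 < ρ) (hρ1 : ρ ≤ 1) (h : ∀ y ∈ ball x s, ‖φ y‖ < ρ) :
    ENNReal.ofReal (2 * Real.pi * Real.log (1 / ρ))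
      ≤ ∫⁻ y in D \ ball x s, ENNReal.ofReal (‖deriv φ y / φ y‖ ^ 2) := by
  rw [lintegral_sq_norm_logDeriv hφ hD (hD.measurableSet.diff measurableSet_ball) sdiff_subset,
    ← lintegral_annulus_inv_sq hρ hρ1]
  refine lintegral_mono_set ?_
  rintro w hw
  rw [annulus, mem_ofPred_eq, sub_zero] at hw
  obtain ⟨y, hyD, rfl⟩ := hφ.2.1.surjOn (mem_ball_zero_iff.mpr hw.2)
  exact ⟨y, ⟨hyD, fun hys ↦ absurd (h y hys) (not_lt.mpr hw.1)⟩, rfl⟩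

theorem integrableOn_sq_norm_logDeriv (hφ : IsConformalToDisc D x φ) (hD : IsOpen D) (hx : x ∈ D)
    {ε : ℝ} (hε : 0 < ε) :
    IntegrableOn (fun y ↦ ‖deriv φ y / φ y‖ ^ 2) (D \ ball x ε) := by
  have hpos := norm_pos_iff.mpr (hφ.deriv_ne_zero hD hx)
  set c := ‖deriv φ x‖ / 2 with hc
  have hc0 : 0 < c := by positivity
  have h1 : ∀ᶠ s in 𝓝[>] (0 : ℝ), c * s ≤ 1 := by
    filter_upwards [Ioo_mem_nhdsGT (inv_pos.mpr hc0)] with s hs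
    calc c * s ≤ c * c⁻¹ := by gcongr; exact hs.2.le
      _ = 1 := mul_inv_cancel₀ hc0.ne'
  obtain ⟨s, ⟨⟨hs, hs1⟩, hsε⟩⟩ := (((eventually_lt_of_norm_lt_mul hφ hD hx hc0 (by
    rw [hc]; linarith)).and h1).and (Ioo_mem_nhdsGT hε)).exists
  have h2 := lintegral_logDeriv_le hφ hD (mul_pos hc0 hsε.1) hs1 hs
  have hmeas : AEStronglyMeasurable (fun y ↦ ‖deriv φ y / φ y‖ ^ 2)
      (volume.restrict (D \ ball x ε)) := by
    have h1 : AEMeasurable φ (volume.restrict D) :=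
      (hφ.1.continuousOn.aestronglyMeasurable hD.measurableSet).aemeasurable
    exact (((measurable_deriv φ).aemeasurable.div
      (h1.mono_measure (Measure.restrict_mono_set _ sdiff_subset))).norm.pow_const
        2).aestronglyMeasurable
  refine ⟨hmeas, ?_⟩
  rw [hasFiniteIntegral_iff_ofReal (.of_forall fun y ↦ by positivity)]
  exact ((lintegral_mono_set (sdiff_subset_sdiff_right (ball_subset_ball hsε.2.le))).trans
    h2).trans_lt ENNReal.ofReal_lt_top

theorem exists_bound_logDeriv_dslope (hφ : IsConformalToDisc D x φ) (hD : IsOpen D) (hx : x ∈ D)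
    {ε : ℝ} (hεD : closedBall x ε ⊆ D) :
    ∃ M, 0 ≤ M ∧ ∀ y ∈ closedBall x ε, ‖deriv (dslope φ x) y / dslope φ x y‖ ≤ M := by
  obtain ⟨M, hM⟩ := (isCompact_closedBall x ε).exists_bound_of_continuousOn
    ((differentiableOn_logDeriv_dslope hφ hD hx).continuousOn.mono hεD)
  exact ⟨max M 0, le_max_right _ _, fun y hy ↦ (hM y hy).trans (le_max_left _ _)⟩

theorem integrableOn_sq_norm_greenGrad_ball (hφ : IsConformalToDisc D x φ) (hD : IsOpen D)
    (hx : x ∈ D) {ε : ℝ} (hεD : closedBall x ε ⊆ D) :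
    IntegrableOn (fun y ↦ ‖greenGrad φ x ε y‖ ^ 2) (ball x ε) := by
  have h1 : IntegrableOn (fun y ↦ ‖deriv (dslope φ x) y / dslope φ x y‖ ^ 2) (ball x ε) :=
    ((((differentiableOn_logDeriv_dslope hφ hD hx).continuousOn.mono hεD).norm.pow
      2).integrableOn_compact (isCompact_closedBall x ε)).mono_set ball_subset_closedBall
  refine h1.congr ?_
  filter_upwards [ae_restrict_of_ae (ae_ne_and_norm_ne x ε), ae_restrict_mem measurableSet_ball]
    with y hy hyB
  rw [greenGrad_of_lt hφ hD hx (hεD (ball_subset_closedBall hyB)) hy.1 (mem_ball_iff_norm.mp hyB),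
    norm_neg, RCLike.norm_conj]

theorem integrableOn_sq_norm_greenGrad (hφ : IsConformalToDisc D x φ) (hD : IsOpen D)
    (hx : x ∈ D) {ε : ℝ} (hε : 0 < ε) (hεD : closedBall x ε ⊆ D) :
    IntegrableOn (fun y ↦ ‖greenGrad φ x ε y‖ ^ 2) D := by
  have h2 : IntegrableOn (fun y ↦ ‖greenGrad φ x ε y‖ ^ 2) (D \ ball x ε) := by
    refine (integrableOn_sq_norm_logDeriv hφ hD hx hε).congr_fun (fun y hy ↦ ?_)
      (hD.measurableSet.diff measurableSet_ball)
    have : ε ≤ ‖y - x‖ := by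
      by_contra! h
      exact hy.2 (mem_ball_iff_norm.mpr h)
    simp only [greenGrad_of_le this, norm_neg, RCLike.norm_conj]
  have h3 := (integrableOn_sq_norm_greenGrad_ball hφ hD hx hεD).union h2
  rwa [union_sdiff_cancel (ball_subset_closedBall.trans hεD)] at h3

theorem memLp_greenGrad (hφ : IsConformalToDisc D x φ) (hD : IsOpen D)
    (hx : x ∈ D) {ε : ℝ} (hε : 0 < ε) (hεD : closedBall x ε ⊆ D) :
    MemLp (greenGrad φ x ε) 2 (volume.restrict D) :=
  (memLp_two_iff_integrable_sq_norm (aestronglyMeasurable_greenGrad hφ hD ε)).mpr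
    (integrableOn_sq_norm_greenGrad hφ hD hx hε hεD)

/-- The gradients differ only on the annulus, where up to sign and conjugation they are `(y - x)⁻¹ +
Q` and `Q` with `Q` holomorphic. The cross term integrates to zero and the square of `(y - x)⁻¹`
gives the logarithm. -/
theorem integral_sq_norm_greenGrad_sub (hφ : IsConformalToDisc D x φ) (hD : IsOpen D)
    (hx : x ∈ D) {s ε : ℝ} (hs : 0 < s) (hsε : s ≤ ε) (hεD : closedBall x ε ⊆ D) :
    (∫ y in D, ‖greenGrad φ x s y‖ ^ 2) - ∫ y in D, ‖greenGrad φ x ε y‖ ^ 2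
      = 2 * Real.pi * Real.log (ε / s) := by
  have hsD : closedBall x s ⊆ D := (closedBall_subset_closedBall hsε).trans hεD
  set Q : ℂ → ℂ := fun y ↦ deriv (dslope φ x) y / dslope φ x y with hQ
  have hQd := differentiableOn_logDeriv_dslope hφ hD hx
  have hne : ∀ w ∈ {w : ℂ | s ≤ ‖w - x‖ ∧ ‖w - x‖ ≤ ε}, w - x ≠ 0 := fun w hw ↦
    norm_pos_iff.mp (hs.trans_le hw.1)
  have hsub : {w : ℂ | s ≤ ‖w - x‖ ∧ ‖w - x‖ ≤ ε} ⊆ D := fun w hw ↦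
    hεD (mem_closedBall_iff_norm.mpr hw.2)
  have hi1 : IntegrableOn (fun w ↦ conj ((w - x)⁻¹) * Q w) (annulus x s ε) := by
    refine integrableOn_annulus_of_continuousOn (ContinuousOn.mul ?_ (hQd.continuousOn.mono hsub))
    exact Complex.continuous_conj.comp_continuousOn (ContinuousOn.inv₀ (by fun_prop) hne)
  have hi2 : IntegrableOn (fun w : ℂ ↦ (‖w - x‖ ^ 2)⁻¹) (annulus x s ε) :=
    integrableOn_annulus_of_continuousOn (ContinuousOn.inv₀ (by fun_prop) fun w hw ↦
      pow_ne_zero 2 (norm_ne_zero_iff.mpr (hne w hw)))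
  rw [← integral_sub (integrableOn_sq_norm_greenGrad hφ hD hx hs hsD)
    (integrableOn_sq_norm_greenGrad hφ hD hx (hs.trans_le hsε) hεD)]
  have hpt : ∀ y ∈ D, ‖greenGrad φ x s y‖ ^ 2 - ‖greenGrad φ x ε y‖ ^ 2
      = (annulus x s ε).indicator (fun w ↦ 2 * (conj ((w - x)⁻¹) * Q w).re + (‖w - x‖ ^ 2)⁻¹) y := by
    intro y hy
    by_cases hA : y ∈ annulus x s ε
    · have hyx : y ≠ x := sub_ne_zero.mp (norm_pos_iff.mp (hs.trans_le hA.1))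
      rw [indicator_of_mem hA, greenGrad_of_le hA.1, greenGrad_of_lt hφ hD hx hy hyx hA.2,
        deriv_div_eq hφ hD hx hy hyx]
      simp only [norm_neg, RCLike.norm_conj]
      rw [← inv_pow, ← norm_inv]
      change ‖(y - x)⁻¹ + Q y‖ ^ 2 - ‖Q y‖ ^ 2 = _
      simp only [Complex.sq_norm, Complex.normSq_apply, Complex.add_re, Complex.add_im,
        Complex.mul_re, Complex.conj_re, Complex.conj_im]
      ring
    · rw [indicator_of_notMem hA, sub_eq_zero]
      congr 2
      rw [greenGrad, greenGrad]
      congr 2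
      by_cases h1 : ‖y - x‖ < s
      · rw [if_pos h1, if_pos (h1.trans_le hsε)]
      · rw [if_neg h1, if_neg fun h2 ↦ hA ⟨not_lt.mp h1, h2⟩]
  rw [setIntegral_congr_fun hD.measurableSet hpt, setIntegral_indicator (measurableSet_annulus x s ε),
    inter_eq_right.mpr ((annulus_subset_ball x s ε).trans (ball_subset_closedBall.trans hεD)),
    integral_add (f := fun w ↦ 2 * (conj ((w - x)⁻¹) * Q w).re) (hi1.re.const_mul 2) hi2, integral_const_mul, integral_annulus_inv_sq hs hsε,
    show ∫ w in annulus x s ε, (conj ((w - x)⁻¹) * Q w).re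
      = (∫ w in annulus x s ε, conj ((w - x)⁻¹) * Q w).re from integral_re hi1,
    integral_annulus_conj_inv_mul hs hεD hQd]
  simp

/-- The Dirichlet energy of the regularised Green's function. -/
theorem integral_sq_norm_greenGrad (hφ : IsConformalToDisc D x φ) (hD : IsOpen D)
    (hx : x ∈ D) {ε : ℝ} (hε : 0 < ε) (hεD : closedBall x ε ⊆ D) :
    ∫ y in D, ‖greenGrad φ x ε y‖ ^ 2
      = 2 * Real.pi * (Real.log (1 / ε) + Real.log (conformalRadius D x)) := by
  set E : ℝ → ℝ := fun s ↦ ∫ y in D, ‖greenGrad φ x s y‖ ^ 2 with hE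
  set d := ‖deriv φ x‖ with hd
  have hd0 : 0 < d := norm_pos_iff.mpr (hφ.deriv_ne_zero hD hx)
  rw [conformalRadius_eq hD hx hφ, ← hd, Real.log_inv, one_div, Real.log_inv]
  obtain ⟨M, hM0, hM⟩ := exists_bound_logDeriv_dslope hφ hD hx hεD
  -- This quantity is constant in `s`, so it can be evaluated in the limit `s → 0`.
  have hκ : ∀ s, 0 < s → s ≤ ε → E s + 2 * Real.pi * Real.log s
      = E ε + 2 * Real.pi * Real.log ε := by
    intro s hs hsε
    have := integral_sq_norm_greenGrad_sub hφ hD hx hs hsε hεD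
    rw [Real.log_div hε.ne' hs.ne'] at this
    change E s - E ε = _ at this
    linarith
  have hsplit : ∀ s, 0 < s → s ≤ ε → E s = (∫ y in ball x s, ‖greenGrad φ x s y‖ ^ 2)
      + ∫ y in D \ ball x s, ‖deriv φ y / φ y‖ ^ 2 := by
    intro s hs hsε
    have hsD : closedBall x s ⊆ D := (closedBall_subset_closedBall hsε).trans hεD
    have hI := integrableOn_sq_norm_greenGrad hφ hD hx hs hsD
    rw [hE, ← setIntegral_congr_fun (f := fun y ↦ ‖greenGrad φ x s y‖ ^ 2)
      (hD.measurableSet.diff measurableSet_ball) ?_]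
    · simp only
      rw [← setIntegral_union disjoint_sdiff_right (hD.measurableSet.diff measurableSet_ball)
        (hI.mono_set (ball_subset_closedBall.trans hsD)) (hI.mono_set sdiff_subset),
        union_sdiff_cancel (ball_subset_closedBall.trans hsD)]
    · intro y hy
      have : s ≤ ‖y - x‖ := by
        by_contra! h
        exact hy.2 (mem_ball_iff_norm.mpr h)
      simp only [greenGrad_of_le this, norm_neg, RCLike.norm_conj]
  -- The energy outside the disc of radius `s` is at most `2π log (1 / (c s))`, and the energy
  -- inside is `O(s²)`.
  have hupper : ∀ c, 0 < c → c < d → E ε + 2 * Real.pi * Real.log ε ≤ -(2 * Real.pi * Real.log c) := by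
    intro c hc hcd
    have hev : ∀ᶠ s in 𝓝[>] (0 : ℝ), E ε + 2 * Real.pi * Real.log ε
        ≤ M ^ 2 * (s ^ 2 * Real.pi) + -(2 * Real.pi * Real.log c) := by
      have h1 : ∀ᶠ s in 𝓝[>] (0 : ℝ), c * s ≤ 1 := by
        filter_upwards [Ioo_mem_nhdsGT (inv_pos.mpr hc)] with s hs
        calc c * s ≤ c * c⁻¹ := by gcongr; exact hs.2.le
          _ = 1 := mul_inv_cancel₀ hc.ne'
      filter_upwards [eventually_lt_of_norm_lt_mul hφ hD hx hc hcd, h1, Ioo_mem_nhdsGT hε]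
        with s hs hs1 hsε
      have hsD : closedBall x s ⊆ D := (closedBall_subset_closedBall hsε.2.le).trans hεD
      rw [← hκ s hsε.1 hsε.2.le, hsplit s hsε.1 hsε.2.le]
      have e1 : ∫ y in D \ ball x s, ‖deriv φ y / φ y‖ ^ 2 ≤ 2 * Real.pi * Real.log (1 / (c * s)) := by
        rw [← ENNReal.ofReal_le_ofReal_iff, ofReal_integral_eq_lintegral_ofReal
          (integrableOn_sq_norm_logDeriv hφ hD hx hsε.1) (.of_forall fun y ↦ by positivity)]
        · exact lintegral_logDeriv_le hφ hD (mul_pos hc hsε.1) hs1 hs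
        · have : 0 ≤ Real.log (1 / (c * s)) := Real.log_nonneg (by
            rw [le_div_iff₀ (mul_pos hc hsε.1)]; linarith)
          positivity
      have e2 : ∫ y in ball x s, ‖greenGrad φ x s y‖ ^ 2 ≤ M ^ 2 * (s ^ 2 * Real.pi) := by
        have e3 : ∀ᵐ y ∂(volume.restrict (ball x s)), ‖greenGrad φ x s y‖ ^ 2 ≤ M ^ 2 := by
          filter_upwards [ae_restrict_of_ae (ae_ne_and_norm_ne x s),
            ae_restrict_mem measurableSet_ball] with y hy hyB
          rw [greenGrad_of_lt hφ hD hx (hsD (ball_subset_closedBall hyB)) hy.1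
            (mem_ball_iff_norm.mp hyB), norm_neg, RCLike.norm_conj]
          exact pow_le_pow_left₀ (norm_nonneg _) (hM y (closedBall_subset_closedBall hsε.2.le
            (ball_subset_closedBall hyB))) 2
        refine (integral_mono_ae (integrableOn_sq_norm_greenGrad_ball hφ hD hx hsD)
          (integrableOn_const (by rw [Complex.volume_ball]; finiteness)) e3).trans_eq ?_
        rw [setIntegral_const, measureReal_def, Complex.volume_ball]
        simp only [ENNReal.toReal_mul, ENNReal.toReal_pow, ENNReal.toReal_ofReal hsε.1.le,
          ENNReal.coe_toReal, NNReal.coe_real_pi, smul_eq_mul]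
        ring
      rw [one_div, Real.log_inv, Real.log_mul hc.ne' hsε.1.ne'] at e1
      linarith
    have hlim : Tendsto (fun s : ℝ ↦ M ^ 2 * (s ^ 2 * Real.pi) + -(2 * Real.pi * Real.log c)) (𝓝[>] 0)
        (𝓝 (-(2 * Real.pi * Real.log c))) := by
      have : Continuous fun s : ℝ ↦ M ^ 2 * (s ^ 2 * Real.pi) + -(2 * Real.pi * Real.log c) := by
        fun_prop
      have h2 := this.tendsto 0
      simp only [ne_eq, OfNat.ofNat_ne_zero, not_false_eq_true, zero_pow, zero_mul, mul_zero,
        zero_add] at h2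
      exact h2.mono_left nhdsWithin_le_nhds
    exact ge_of_tendsto hlim hev
  have hlower : ∀ c, d < c → -(2 * Real.pi * Real.log c) ≤ E ε + 2 * Real.pi * Real.log ε := by
    intro c hc
    have hc0 := hd0.trans hc
    have h1 : ∀ᶠ s in 𝓝[>] (0 : ℝ), c * s ≤ 1 := by
      filter_upwards [Ioo_mem_nhdsGT (inv_pos.mpr hc0)] with s hs
      calc c * s ≤ c * c⁻¹ := by gcongr; exact hs.2.le
        _ = 1 := mul_inv_cancel₀ hc0.ne'
    obtain ⟨s, ⟨⟨hs, hs1⟩, hsε⟩⟩ := (((eventually_norm_lt_mul hφ hD hx hc).and h1).and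
      (Ioo_mem_nhdsGT hε)).exists
    rw [← hκ s hsε.1 hsε.2.le, hsplit s hsε.1 hsε.2.le]
    have e1 : 2 * Real.pi * Real.log (1 / (c * s)) ≤ ∫ y in D \ ball x s, ‖deriv φ y / φ y‖ ^ 2 := by
      rw [← ENNReal.ofReal_le_ofReal_iff (integral_nonneg fun y ↦ by positivity),
        ofReal_integral_eq_lintegral_ofReal
          (integrableOn_sq_norm_logDeriv hφ hD hx hsε.1) (.of_forall fun y ↦ by positivity)]
      exact le_lintegral_logDeriv hφ hD (mul_pos hc0 hsε.1) hs1 hs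
    have e2 : 0 ≤ ∫ y in ball x s, ‖greenGrad φ x s y‖ ^ 2 := integral_nonneg fun y ↦ by positivity
    rw [one_div, Real.log_inv, Real.log_mul hc0.ne' hsε.1.ne'] at e1
    linarith
  -- The two bounds meet as `c` tends to `d` from below and from above.
  have hcont : ContinuousAt (fun c ↦ -(2 * Real.pi * Real.log c)) d :=
    ((Real.continuousAt_log hd0.ne').const_mul _).neg
  have hle : E ε + 2 * Real.pi * Real.log ε ≤ -(2 * Real.pi * Real.log d) := by
    refine ge_of_tendsto (hcont.tendsto.mono_left (nhdsWithin_le_nhds (s := Iio d))) ?_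
    filter_upwards [Ioo_mem_nhdsLT hd0] with c hc using hupper c hc.1 hc.2
  have hge : -(2 * Real.pi * Real.log d) ≤ E ε + 2 * Real.pi * Real.log ε := by
    refine le_of_tendsto (hcont.tendsto.mono_left (nhdsWithin_le_nhds (s := Ioi d))) ?_
    filter_upwards [self_mem_nhdsWithin] with c hc using hlower c hc
  linarith

/-- The covariance of regularised Green's functions on disjoint discs does not depend on the radii. -/
theorem integral_inner_greenGrad_eq {x' : ℂ} {φ' : ℂ → ℂ} (hφ : IsConformalToDisc D x φ)
    (hφ' : IsConformalToDisc D x' φ') (hD : IsOpen D) (hx : x ∈ D) (hx' : x' ∈ D)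
    {s ε δ : ℝ} (hs : 0 < s) (hsε : s ≤ ε) (hδ : 0 < δ) (hεD : closedBall x ε ⊆ D)
    (hδD : closedBall x' δ ⊆ D) (hdisj : ε + δ < ‖x - x'‖) :
    ∫ y in D, inner ℝ (greenGrad φ x s y) (greenGrad φ' x' δ y)
      = ∫ y in D, inner ℝ (greenGrad φ x ε y) (greenGrad φ' x' δ y) := by
  have hsD : closedBall x s ⊆ D := (closedBall_subset_closedBall hsε).trans hεD
  have m1 := memLp_greenGrad hφ hD hx hs hsD
  have m2 := memLp_greenGrad hφ hD hx (hs.trans_le hsε) hεD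
  have m3 := memLp_greenGrad hφ' hD hx' hδ hδD
  set A : ℂ → ℂ := fun y ↦ deriv φ' y / φ' y with hA
  -- Changing the radius at `x` changes the gradient only on an annulus disjoint from the disc
  -- around `x'`; there the other gradient is `-conj A` with `A` holomorphic near the closed disc
  -- around `x`.
  have hAd : DifferentiableOn ℂ A (D \ {x'}) := by
    refine DifferentiableOn.div ((hφ'.1.deriv hD).mono sdiff_subset) (hφ'.1.mono sdiff_subset) ?_
    exact fun y hy ↦ hφ'.ne_zero hx' hy.1 hy.2
  have hfar : ∀ y ∈ closedBall x ε, δ < ‖y - x'‖ := by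
    intro y hy
    rw [mem_closedBall_iff_norm] at hy
    have : ‖x - x'‖ ≤ ‖y - x'‖ + ‖y - x‖ := by
      rw [show x - x' = (y - x') - (y - x) by ring]
      exact norm_sub_le _ _
    linarith
  have hxU : closedBall x ε ⊆ D \ {x'} := by
    refine fun y hy ↦ ⟨hεD hy, ?_⟩
    rintro rfl
    have := hfar y hy
    simp only [sub_self, norm_zero] at this
    linarith
  have hi1 : IntegrableOn (fun w ↦ conj ((w - x)⁻¹) * A w) (annulus x s ε) := by
    have hne : ∀ w ∈ {w : ℂ | s ≤ ‖w - x‖ ∧ ‖w - x‖ ≤ ε}, w - x ≠ 0 := fun w hw ↦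
      norm_pos_iff.mp (hs.trans_le hw.1)
    refine integrableOn_annulus_of_continuousOn (ContinuousOn.mul ?_ (hAd.continuousOn.mono
      fun w hw ↦ hxU (mem_closedBall_iff_norm.mpr hw.2)))
    exact Complex.continuous_conj.comp_continuousOn (ContinuousOn.inv₀ (by fun_prop) hne)
  rw [← sub_eq_zero, ← integral_sub (integrable_inner_of_memLp m1 m3)
    (integrable_inner_of_memLp m2 m3)]
  have hpt : ∀ y ∈ D, inner ℝ (greenGrad φ x s y) (greenGrad φ' x' δ y)
      - inner ℝ (greenGrad φ x ε y) (greenGrad φ' x' δ y)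
      = (annulus x s ε).indicator (fun w ↦ (conj ((w - x)⁻¹) * A w).re) y := by
    intro y hy
    rw [← inner_sub_left]
    by_cases hAn : y ∈ annulus x s ε
    · have hδy := (hfar y (mem_closedBall_iff_norm.mpr hAn.2.le)).le
      rw [indicator_of_mem hAn, greenGrad_of_le hδy, greenGrad, greenGrad, if_neg hAn.1.not_gt,
        if_pos hAn.2, ← map_sub, Complex.inner]
      simp only [Complex.conj_conj]
      change (-conj (A y) * (0 - deriv φ y / φ y - ((y - x)⁻¹ - deriv φ y / φ y))).re = _
      rw [show -conj (A y) * (0 - deriv φ y / φ y - ((y - x)⁻¹ - deriv φ y / φ y))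
        = conj (conj ((y - x)⁻¹) * A y) by rw [map_mul, Complex.conj_conj]; ring, Complex.conj_re]
    · rw [indicator_of_notMem hAn]
      have : greenGrad φ x s y = greenGrad φ x ε y := by
        rw [greenGrad, greenGrad]
        congr 2
        by_cases h1 : ‖y - x‖ < s
        · rw [if_pos h1, if_pos (h1.trans_le hsε)]
        · rw [if_neg h1, if_neg fun h2 ↦ hAn ⟨not_lt.mp h1, h2⟩]
      rw [this, sub_self, inner_zero_left]
  rw [setIntegral_congr_fun hD.measurableSet hpt, setIntegral_indicator (measurableSet_annulus x s ε),
    inter_eq_right.mpr ((annulus_subset_ball x s ε).trans (ball_subset_closedBall.trans hεD)),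
    show ∫ w in annulus x s ε, (conj ((w - x)⁻¹) * A w).re
      = (∫ w in annulus x s ε, conj ((w - x)⁻¹) * A w).re from integral_re hi1,
    integral_annulus_conj_inv_mul hs hxU hAd]
  simp

end Energy
end LiouvilleGFF

namespace LiouvilleGFF

open Metric DiscAut InnerProductSpace ComplexConjugate

/-! ### Dominated convergence in `L²` and a smooth cutoff -/

theorem tendsto_eLpNorm_two_of_dominated {μ : Measure ℂ} {F : ℕ → ℂ → ℂ} {f : ℂ → ℂ} {g : ℂ → ℝ}
    (hF : ∀ n, AEStronglyMeasurable (F n) μ) (hf : AEStronglyMeasurable f μ) (hg : MemLp g 2 μ)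
    (hb : ∀ n, ∀ᵐ y ∂μ, ‖F n y‖ ≤ g y)
    (hlim : ∀ᵐ y ∂μ, Tendsto (fun n ↦ F n y) atTop (𝓝 (f y))) :
    Tendsto (fun n ↦ eLpNorm (F n - f) 2 μ) atTop (𝓝 0) := by
  have hall : ∀ᵐ y ∂μ, ∀ n, ‖F n y‖ ≤ g y := ae_all_iff.mpr hb
  have hg2 : ∫⁻ y, ENNReal.ofReal ((2 * g y) ^ 2) ∂μ ≠ ⊤ := by
    have h1 : Integrable (fun y ↦ (2 * g y) ^ 2) μ := by
      have := (hg.integrable_sq).const_mul 4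
      refine this.congr (.of_forall fun y ↦ ?_)
      simp only; ring
    exact ((hasFiniteIntegral_iff_ofReal (.of_forall fun y ↦ by positivity)).mp h1.2).ne
  have h := tendsto_lintegral_of_dominated_convergence' (μ := μ)
    (F := fun n y ↦ ‖F n y - f y‖ₑ ^ (2 : ℝ)) (f := fun _ ↦ 0)
    (fun y ↦ ENNReal.ofReal ((2 * g y) ^ 2))
    (fun n ↦ (((hF n).sub hf).enorm.pow_const _)) (fun n ↦ ?_) hg2 ?_
  · simp only [lintegral_zero] at h
    have h2 : ∀ n, eLpNorm (F n - f) 2 μ = (∫⁻ y, ‖F n y - f y‖ₑ ^ (2 : ℝ) ∂μ) ^ (1 / 2 : ℝ) := by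
      intro n
      rw [eLpNorm_eq_lintegral_rpow_enorm_toReal two_ne_zero ENNReal.ofNat_ne_top]
      simp
    simp only [h2]
    have h3 := ((ENNReal.continuous_rpow_const (y := (1 / 2 : ℝ))).tendsto 0).comp h
    rwa [ENNReal.zero_rpow_of_pos (by norm_num)] at h3
  · filter_upwards [hall, hlim] with y hy hl
    have h1 : ‖f y‖ ≤ g y := le_of_tendsto hl.norm (.of_forall hy)
    have h2 : ‖F n y - f y‖ ≤ 2 * g y := (norm_sub_le _ _).trans (by linarith [hy n])
    rw [← ofReal_norm, ENNReal.ofReal_rpow_of_nonneg (norm_nonneg _) (by norm_num)]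
    refine ENNReal.ofReal_le_ofReal ?_
    rw [Real.rpow_ofNat]
    exact pow_le_pow_left₀ (norm_nonneg _) h2 2
  · filter_upwards [hlim] with y hl
    have h1 : Tendsto (fun n ↦ ‖F n y - f y‖ₑ) atTop (𝓝 0) := by
      have := (hl.sub_const (f y)).enorm
      simpa using this
    have h3 := ((ENNReal.continuous_rpow_const (y := (2 : ℝ))).tendsto 0).comp h1
    rwa [ENNReal.zero_rpow_of_pos (by norm_num)] at h3

/-- A smooth function that vanishes on `(-∞, 1]` and is the identity on `[2, ∞)`. -/
noncomputable def cutoff (t : ℝ) : ℝ := t * Real.smoothTransition (t - 1)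

theorem contDiff_cutoff : ContDiff ℝ (⊤ : ℕ∞) cutoff :=
  contDiff_id.mul (Real.smoothTransition.contDiff.comp (contDiff_id.sub contDiff_const))

theorem cutoff_of_le {t : ℝ} (h : t ≤ 1) : cutoff t = 0 := by
  rw [cutoff, Real.smoothTransition.zero_of_nonpos (by linarith), mul_zero]

theorem cutoff_of_ge {t : ℝ} (h : 2 ≤ t) : cutoff t = t := by
  rw [cutoff, Real.smoothTransition.one_of_one_le (by linarith), mul_one]

theorem cutoff_nonneg (t : ℝ) : 0 ≤ cutoff t := by
  rcases le_total t 1 with h | h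
  · rw [cutoff_of_le h]
  · exact mul_nonneg (by linarith) (Real.smoothTransition.nonneg _)

theorem hasDerivAt_cutoff (t : ℝ) : HasDerivAt cutoff (deriv cutoff t) t :=
  (contDiff_cutoff.differentiable (by simp) t).hasDerivAt

theorem deriv_cutoff_of_lt {t : ℝ} (h : t < 1) : deriv cutoff t = 0 := by
  have : cutoff =ᶠ[𝓝 t] fun _ ↦ 0 := by
    filter_upwards [gt_mem_nhds h] with s hs using cutoff_of_le hs.le
  rw [this.deriv_eq, deriv_const]

theorem deriv_cutoff_of_gt {t : ℝ} (h : 2 < t) : deriv cutoff t = 1 := by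
  have : cutoff =ᶠ[𝓝 t] fun s ↦ s := by
    filter_upwards [lt_mem_nhds h] with s hs using cutoff_of_ge hs.le
  rw [this.deriv_eq, deriv_id'']

theorem exists_bound_deriv_cutoff : ∃ C, 1 ≤ C ∧ ∀ t, |deriv cutoff t| ≤ C := by
  obtain ⟨C, hC⟩ := (isCompact_Icc (a := (1 : ℝ)) (b := 2)).exists_bound_of_continuousOn
    (contDiff_cutoff.continuous_deriv (by simp)).continuousOn
  refine ⟨max C 1, le_max_right _ _, fun t ↦ ?_⟩
  rcases lt_or_ge t 1 with h | h
  · rw [deriv_cutoff_of_lt h, abs_zero]; positivity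
  · rcases lt_or_ge 2 t with h2 | h2
    · rw [deriv_cutoff_of_gt h2, abs_one]; exact le_max_right _ _
    · exact (hC t ⟨h, h2⟩).trans (le_max_left _ _)

/-- The rescaled cutoff, an approximation of the positive part. -/
noncomputable def cutoffAt (n : ℕ) (t : ℝ) : ℝ := cutoff ((n + 1) * t) / (n + 1)

theorem contDiff_cutoffAt (n : ℕ) : ContDiff ℝ (⊤ : ℕ∞) (cutoffAt n) :=
  (contDiff_cutoff.comp (contDiff_const.mul contDiff_id)).div_const _

theorem cutoffAt_nonneg (n : ℕ) (t : ℝ) : 0 ≤ cutoffAt n t :=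
  div_nonneg (cutoff_nonneg _) (by positivity)

theorem cutoffAt_of_le {n : ℕ} {t : ℝ} (h : (n + 1) * t ≤ 1) : cutoffAt n t = 0 := by
  rw [cutoffAt, cutoff_of_le h, zero_div]

theorem cutoffAt_of_ge {n : ℕ} {t : ℝ} (h : 2 ≤ (n + 1) * t) : cutoffAt n t = t := by
  rw [cutoffAt, cutoff_of_ge h, mul_div_cancel_left₀ _ (by positivity)]

theorem hasDerivAt_cutoffAt (n : ℕ) (t : ℝ) :
    HasDerivAt (cutoffAt n) (deriv cutoff ((n + 1) * t)) t := by
  have h := ((hasDerivAt_cutoff ((n + 1) * t)).comp t ((hasDerivAt_id t).const_mul (n + 1 : ℝ))).div_const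
    (n + 1 : ℝ)
  refine h.congr_deriv ?_
  field_simp

theorem tendsto_natCast_succ_mul_atTop {t : ℝ} (ht : 0 < t) :
    Tendsto (fun n : ℕ ↦ ((n : ℝ) + 1) * t) atTop atTop :=
  (tendsto_atTop_add_const_right _ 1 tendsto_natCast_atTop_atTop).atTop_mul_const ht

theorem HasDerivAt.comp_hasGradientAt {g : ℝ → ℝ} {g' : ℝ} {f : ℂ → ℝ} {f' y : ℂ}
    (hg : HasDerivAt g g' (f y)) (hf : HasGradientAt f f' y) :
    HasGradientAt (fun w ↦ g (f w)) (g' * f') y := by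
  rw [hasGradientAt_iff_hasFDerivAt] at hf ⊢
  refine (hg.comp_hasFDerivAt y hf).congr_fderiv ?_
  rw [← map_smul]
  congr 1

theorem hasGradientAt_sq_norm_sub (x y : ℂ) :
    HasGradientAt (fun w : ℂ ↦ ‖w - x‖ ^ 2) (2 * (y - x)) y := by
  rw [hasGradientAt_iff_hasFDerivAt]
  have h0 : HasFDerivAt (fun v : ℂ ↦ ‖v‖ ^ 2) (2 • (innerSL ℝ) (y - x)) (y - x) :=
    (hasStrictFDerivAt_norm_sq (y - x)).hasFDerivAt
  have h1 : HasFDerivAt (fun w : ℂ ↦ ‖w - x‖ ^ 2)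
      ((2 • (innerSL ℝ) (y - x)).comp (ContinuousLinearMap.id ℝ ℂ)) y :=
    HasFDerivAt.comp (g := fun v : ℂ ↦ ‖v‖ ^ 2) (f := fun w : ℂ ↦ w - x) y h0
      ((hasFDerivAt_id y).sub_const x)
  refine h1.congr_fderiv ?_
  refine ContinuousLinearMap.ext fun v ↦ ?_
  simp [Complex.inner]
  ring

/-! ### The regularised Green's function belongs to `H¹` -/

section Membership

variable {D : Set ℂ} {x : ℂ} {φ : ℂ → ℂ}

/-- A smooth approximation of the regularised Green's function. -/
noncomputable def smoothGreen (φ : ℂ → ℂ) (x : ℂ) (ε : ℝ) (n : ℕ) (y : ℂ) : ℝ :=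
  -Real.log ‖dslope φ x y‖ - 1 / 2 * Real.log (ε ^ 2 + cutoffAt n (‖y - x‖ ^ 2 - ε ^ 2))

/-- The gradient of `smoothGreen`. -/
noncomputable def smoothGreenGrad (φ : ℂ → ℂ) (x : ℂ) (ε : ℝ) (n : ℕ) (y : ℂ) : ℂ :=
  -conj (deriv (dslope φ x) y / dslope φ x y) -
    (deriv cutoff ((n + 1) * (‖y - x‖ ^ 2 - ε ^ 2)) /
      (ε ^ 2 + cutoffAt n (‖y - x‖ ^ 2 - ε ^ 2)) : ℝ) * (y - x)

/-- Replacing the cutoff by the positive part would give `max (ε ^ 2) (‖y - x‖ ^ 2)` in the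
logarithm, hence the regularised Green's function. Squares are used because the norm is not smooth
at `x`. -/
theorem contDiffAt_smoothGreen (hφ : IsConformalToDisc D x φ) (hD : IsOpen D) (hx : x ∈ D)
    {ε : ℝ} (hε : 0 < ε) (n : ℕ) {y : ℂ} (hy : y ∈ D) :
    ContDiffAt ℝ (⊤ : ℕ∞) (smoothGreen φ x ε n) y := by
  have h1 : AnalyticAt ℝ (fun y ↦ Real.log ‖dslope φ x y‖) y :=
    HarmonicAt.analyticAt (((hφ.differentiableOn_dslope hD hx).analyticAt
      (hD.mem_nhds hy)).harmonicAt_log_norm (hφ.dslope_ne_zero hD hx hy))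
  have h2 : ContDiff ℝ (⊤ : ℕ∞) fun y : ℂ ↦ ε ^ 2 + cutoffAt n (‖y - x‖ ^ 2 - ε ^ 2) :=
    contDiff_const.add ((contDiff_cutoffAt n).comp
      (((contDiff_id.sub contDiff_const).norm_sq ℝ).sub contDiff_const))
  refine h1.contDiffAt.neg.sub (contDiffAt_const.mul (h2.contDiffAt.log ?_))
  have := cutoffAt_nonneg n (‖y - x‖ ^ 2 - ε ^ 2)
  positivity

theorem hasGradientAt_smoothGreen (hφ : IsConformalToDisc D x φ) (hD : IsOpen D) (hx : x ∈ D)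
    {ε : ℝ} (hε : 0 < ε) (n : ℕ) {y : ℂ} (hy : y ∈ D) :
    HasGradientAt (smoothGreen φ x ε n) (smoothGreenGrad φ x ε n y) y := by
  have h1 := hasGradientAt_log_norm (((hφ.differentiableOn_dslope hD hx).differentiableAt
    (hD.mem_nhds hy)).hasDerivAt) (hφ.dslope_ne_zero hD hx hy)
  have hpos : 0 < ε ^ 2 + cutoffAt n (‖y - x‖ ^ 2 - ε ^ 2) := by
    have := cutoffAt_nonneg n (‖y - x‖ ^ 2 - ε ^ 2)
    positivity
  have h0 : HasDerivAt (fun u ↦ cutoffAt n (u - ε ^ 2))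
      (deriv cutoff ((n + 1) * (‖y - x‖ ^ 2 - ε ^ 2))) (‖y - x‖ ^ 2) :=
    HasDerivAt.comp_sub_const _ _ (hasDerivAt_cutoffAt n _)
  have h2 := ((((h0.const_add (ε ^ 2)).log hpos.ne').const_mul (1 / 2)).neg)
  have h3 := HasDerivAt.comp_hasGradientAt (f := fun w : ℂ ↦ ‖w - x‖ ^ 2) h2
    (hasGradientAt_sq_norm_sub x y)
  rw [hasGradientAt_iff_hasFDerivAt] at h1 h3 ⊢
  refine ((h1.neg.add h3).congr_of_eventuallyEq (.of_forall fun w ↦ ?_)).congr_fderiv ?_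
  · simp only [smoothGreen, Pi.add_apply, Pi.neg_apply]
    ring
  · rw [← map_neg, ← map_add, smoothGreenGrad]
    congr 1
    push_cast
    ring

theorem smoothGreen_of_ge (hφ : IsConformalToDisc D x φ) (hD : IsOpen D) (hx : x ∈ D)
    {ε : ℝ} {n : ℕ} {y : ℂ} (hy : y ∈ D) (hyx : y ≠ x)
    (h : 2 ≤ (n + 1) * (‖y - x‖ ^ 2 - ε ^ 2)) :
    smoothGreen φ x ε n y = -Real.log ‖φ y‖ := by
  rw [smoothGreen, cutoffAt_of_ge h, hφ.log_norm_eq hD hx hy hyx, norm_sub_rev x y,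
    add_sub_cancel, Real.log_pow]
  push_cast
  ring

theorem smoothGreenGrad_of_gt (hφ : IsConformalToDisc D x φ) (hD : IsOpen D) (hx : x ∈ D)
    {ε : ℝ} {n : ℕ} {y : ℂ} (hy : y ∈ D) (hyx : y ≠ x)
    (h : 2 < (n + 1) * (‖y - x‖ ^ 2 - ε ^ 2)) :
    smoothGreenGrad φ x ε n y = -conj (deriv φ y / φ y) := by
  rw [smoothGreenGrad, deriv_cutoff_of_gt h, cutoffAt_of_ge h.le, deriv_div_eq hφ hD hx hy hyx,
    add_sub_cancel, map_add, neg_add, sub_eq_add_neg, add_comm]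
  congr 1
  rw [Complex.inv_def, map_mul, Complex.conj_conj, Complex.conj_ofReal, Complex.normSq_eq_norm_sq]
  push_cast
  ring

theorem exists_lt_closedBall_subset (hD : IsOpen D) {ε : ℝ} (hεD : closedBall x ε ⊆ D) :
    ∃ ε' > ε, closedBall x ε' ⊆ D := by
  obtain ⟨δ, hδ, h⟩ := (isCompact_closedBall x ε).exists_cthickening_subset_open hD hεD
  rcases le_or_gt 0 ε with h0 | h0
  · refine ⟨ε + δ, by linarith, ?_⟩
    rwa [cthickening_closedBall hδ.le h0, add_comm] at h
  · refine ⟨ε / 2, by linarith, ?_⟩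
    rw [closedBall_eq_empty.mpr (by linarith)]
    exact empty_subset _

/-- Schwarz's lemma on a slightly larger disc, whence the strict inequality. It makes the
regularised Green's function positive on its disc, so that the outer cutoff is eventually inactive
there. -/
theorem norm_dslope_lt (hφ : IsConformalToDisc D x φ) (hD : IsOpen D) {ε : ℝ} (hε : 0 < ε)
    (hεD : closedBall x ε ⊆ D) {y : ℂ} (hy : ‖y - x‖ ≤ ε) : ‖dslope φ x y‖ < 1 / ε := by
  obtain ⟨ε', hε', hD'⟩ := exists_lt_closedBall_subset hD hεD
  have h1 := Complex.norm_dslope_le_div_of_mapsTo_ball (R₁ := ε') (R₂ := 1) (c := x) (z := y)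
    (hφ.1.mono (ball_subset_closedBall.trans hD')) (fun w hw ↦ by
      rw [hφ.2.2]
      exact ball_subset_closedBall (hφ.2.1.mapsTo (hD' (ball_subset_closedBall hw))))
    (mem_ball_iff_norm.mpr (hy.trans_lt hε'))
  exact h1.trans_lt (by gcongr)

open Classical in
/-- Test functions that approximate the regularised Green's function. -/
noncomputable def greenTest (D : Set ℂ) (φ : ℂ → ℂ) (x : ℂ) (ε : ℝ) (n : ℕ) (y : ℂ) : ℝ :=
  if y ∈ D then cutoffAt n (smoothGreen φ x ε n y) else 0

theorem hasGradientAt_greenTest (hφ : IsConformalToDisc D x φ) (hD : IsOpen D) (hx : x ∈ D)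
    {ε : ℝ} (hε : 0 < ε) (n : ℕ) {y : ℂ} (hy : y ∈ D) :
    HasGradientAt (greenTest D φ x ε n)
      ((deriv cutoff ((n + 1) * smoothGreen φ x ε n y) : ℝ) * smoothGreenGrad φ x ε n y) y := by
  have h := HasDerivAt.comp_hasGradientAt (hasDerivAt_cutoffAt n (smoothGreen φ x ε n y))
    (hasGradientAt_smoothGreen hφ hD hx hε n hy)
  refine h.congr_of_eventuallyEq ?_
  filter_upwards [hD.mem_nhds hy] with w hw
  rw [greenTest, if_pos hw]

theorem greenTest_mem_testFunctions (hφ : IsConformalToDisc D x φ) (hD : IsOpen D) (hx : x ∈ D)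
    {ε ε' : ℝ} (hε : 0 < ε) (hεε' : ε < ε') (hε'D : closedBall x ε' ⊆ D) {n : ℕ}
    (hn : 2 < (n + 1) * (ε' ^ 2 - ε ^ 2)) : greenTest D φ x ε n ∈ testFunctions D := by
  -- Outside `K` the function is `-log ‖φ‖`, below the level `1 / (n + 1)` under which `cutoffAt n`
  -- vanishes.
  set K : Set ℂ := closedBall x ε' ∪ {y ∈ D | ‖φ y‖ ≤ Real.exp (-(1 / (n + 1)))} with hK
  have hKc : IsCompact K := (isCompact_closedBall x ε').union (hφ.isCompact_preimage hD (by
    rw [Real.exp_lt_one_iff, neg_lt_zero]; positivity))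
  have hKD : K ⊆ D := union_subset hε'D (sep_subset _ _)
  have hzero : ∀ y ∉ K, greenTest D φ x ε n y = 0 := by
    intro y hy
    rw [greenTest]
    split_ifs with hyD
    · have h1 : ε' < ‖y - x‖ := by
        by_contra! h
        exact hy (Or.inl (mem_closedBall_iff_norm.mpr h))
      have h2 : Real.exp (-(1 / (n + 1))) < ‖φ y‖ := by
        by_contra! h
        exact hy (Or.inr ⟨hyD, h⟩)
      have hyx : y ≠ x := sub_ne_zero.mp (norm_pos_iff.mp ((hε.trans hεε').trans h1))
      have h3 : (n + 1 : ℝ) * (ε' ^ 2 - ε ^ 2) ≤ (n + 1) * (‖y - x‖ ^ 2 - ε ^ 2) := by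
        have : ε' ^ 2 ≤ ‖y - x‖ ^ 2 := pow_le_pow_left₀ (hε.trans hεε').le h1.le 2
        gcongr
      rw [smoothGreen_of_ge hφ hD hx hyD hyx (hn.le.trans h3)]
      apply cutoffAt_of_le
      have h4 : -(1 / (n + 1 : ℝ)) < Real.log ‖φ y‖ :=
        (Real.lt_log_iff_exp_lt ((Real.exp_pos _).trans h2)).mpr h2
      calc (n + 1 : ℝ) * -Real.log ‖φ y‖ ≤ (n + 1) * (1 / (n + 1)) := by gcongr; linarith
        _ = 1 := by field_simp
    · rfl
  have hsupp : tsupport (greenTest D φ x ε n) ⊆ K := by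
    refine closure_minimal (fun y hy ↦ ?_) hKc.isClosed
    by_contra h
    exact hy (hzero y h)
  refine ⟨contDiff_iff_contDiffAt.mpr fun y ↦ ?_, hKc.of_isClosed_subset (isClosed_tsupport _) hsupp,
    hsupp.trans hKD⟩
  by_cases hy : y ∈ D
  · refine ((contDiff_cutoffAt n).contDiffAt.comp y
      (contDiffAt_smoothGreen hφ hD hx hε n hy)).congr_of_eventuallyEq ?_
    filter_upwards [hD.mem_nhds hy] with w hw
    rw [greenTest, if_pos hw]
    rfl
  · refine (contDiffAt_const (c := (0 : ℝ))).congr_of_eventuallyEq ?_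
    filter_upwards [hKc.isClosed.isOpen_compl.mem_nhds fun h ↦ hy (hKD h)] with w hw
    exact hzero w hw

/-- Off the circle the gradients are eventually equal: the arguments of both cutoffs leave the
transition zone, where the inner derivative is `0` inside the disc and `1` outside it, and the outer
one is `1`. -/
theorem tendsto_gradient_greenTest (hφ : IsConformalToDisc D x φ) (hD : IsOpen D) (hx : x ∈ D)
    {ε : ℝ} (hε : 0 < ε) (hεD : closedBall x ε ⊆ D) {y : ℂ} (hy : y ∈ D) (hyx : y ≠ x)
    (hyε : ‖y - x‖ ≠ ε) :
    ∀ᶠ n : ℕ in atTop, (deriv cutoff ((n + 1) * smoothGreen φ x ε n y) : ℝ) *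
      smoothGreenGrad φ x ε n y = greenGrad φ x ε y := by
  rcases lt_or_gt_of_ne hyε with hlt | hgt
  · have hneg : ‖y - x‖ ^ 2 - ε ^ 2 < 0 := by
      have := pow_lt_pow_left₀ hlt (norm_nonneg _) two_ne_zero
      linarith
    have hc : ∀ n : ℕ, (n + 1 : ℝ) * (‖y - x‖ ^ 2 - ε ^ 2) < 1 := fun n ↦
      (mul_neg_of_pos_of_neg (by positivity) hneg).trans one_pos
    have hW : ∀ n, smoothGreen φ x ε n y = Real.log (1 / ε) - Real.log ‖dslope φ x y‖ := by
      intro n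
      rw [smoothGreen, cutoffAt_of_le (hc n).le, add_zero, Real.log_pow, one_div ε, Real.log_inv]
      push_cast
      ring
    have hWpos : 0 < Real.log (1 / ε) - Real.log ‖dslope φ x y‖ := by
      rw [sub_pos]
      exact Real.log_lt_log (norm_pos_iff.mpr (hφ.dslope_ne_zero hD hx hy))
        (norm_dslope_lt hφ hD hε hεD hlt.le)
    filter_upwards [(tendsto_natCast_succ_mul_atTop hWpos).eventually_gt_atTop 2] with n hn
    rw [hW, deriv_cutoff_of_gt hn, smoothGreenGrad, deriv_cutoff_of_lt (hc n),
      greenGrad_of_lt hφ hD hx hy hyx hlt]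
    simp
  · have hpos : 0 < ‖y - x‖ ^ 2 - ε ^ 2 := by
      have := pow_lt_pow_left₀ hgt hε.le two_ne_zero
      linarith
    have hWpos : 0 < -Real.log ‖φ y‖ :=
      neg_pos.mpr (Real.log_neg (norm_pos_iff.mpr (hφ.ne_zero hx hy hyx)) (hφ.norm_lt_one hy))
    filter_upwards [(tendsto_natCast_succ_mul_atTop hWpos).eventually_gt_atTop 2,
      (tendsto_natCast_succ_mul_atTop hpos).eventually_gt_atTop 2] with n hn hn2
    rw [smoothGreen_of_ge hφ hD hx hy hyx hn2.le, deriv_cutoff_of_gt hn,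
      smoothGreenGrad_of_gt hφ hD hx hy hyx hn2, greenGrad_of_le hgt.le]
    simp

/-- On the disc of radius `ε'` everything is bounded uniformly in `n`. Beyond it the inner cutoff is
inactive, and the gradient is that of the Green's function times a bounded factor. -/
theorem exists_dominating_gradient_greenTest (hφ : IsConformalToDisc D x φ) (hD : IsOpen D)
    (hx : x ∈ D) {ε ε' : ℝ} (hε : 0 < ε) (hεε' : ε < ε') (hε'D : closedBall x ε' ⊆ D) :
    ∃ g : ℂ → ℝ, MemLp g 2 (volume.restrict D) ∧ ∀ n : ℕ, 2 < (n + 1) * (ε' ^ 2 - ε ^ 2) →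
      ∀ y ∈ D, ‖(deriv cutoff ((n + 1) * smoothGreen φ x ε n y) : ℝ) * smoothGreenGrad φ x ε n y‖
        ≤ g y := by
  have hεD : closedBall x ε ⊆ D := (closedBall_subset_closedBall hεε'.le).trans hε'D
  obtain ⟨C, hC1, hC⟩ := exists_bound_deriv_cutoff
  obtain ⟨M, hM0, hM⟩ := exists_bound_logDeriv_dslope hφ hD hx hε'D
  set B := C * (M + C / ε ^ 2 * ε') with hB
  have hB0 : 0 ≤ B := by
    have := hε.trans hεε'
    positivity
  refine ⟨fun y ↦ C * ‖greenGrad φ x ε y‖ + (closedBall x ε').indicator (fun _ ↦ B) y, ?_, ?_⟩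
  · refine ((memLp_greenGrad hφ hD hx hε hεD).norm.const_mul C).add ?_
    refine memLp_indicator_const 2 measurableSet_closedBall B (Or.inr ?_)
    exact ((Measure.restrict_apply_le _ _).trans_lt measure_closedBall_lt_top).ne
  · intro n hn y hy
    rw [norm_mul, Complex.norm_real, Real.norm_eq_abs]
    rcases le_or_gt ‖y - x‖ ε' with hle | hgt
    · simp only []
      rw [indicator_of_mem (mem_closedBall_iff_norm.mpr hle)]
      have h1 : ‖smoothGreenGrad φ x ε n y‖ ≤ M + C / ε ^ 2 * ε' := by
        rw [smoothGreenGrad]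
        refine (norm_sub_le _ _).trans (add_le_add ?_ ?_)
        · rw [norm_neg, RCLike.norm_conj]
          exact hM y (mem_closedBall_iff_norm.mpr hle)
        · rw [norm_mul, Complex.norm_real, norm_div, Real.norm_eq_abs]
          have h2 := cutoffAt_nonneg n (‖y - x‖ ^ 2 - ε ^ 2)
          rw [Real.norm_of_nonneg (by positivity)]
          have h3 := hC ((n + 1) * (‖y - x‖ ^ 2 - ε ^ 2))
          gcongr
          linarith
      calc _ ≤ C * (M + C / ε ^ 2 * ε') := by
            gcongr
            exact hC _
        _ ≤ _ := by rw [← hB]; linarith [mul_nonneg (zero_le_one.trans hC1) (norm_nonneg (greenGrad φ x ε y))]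
    · simp only []
      rw [indicator_of_notMem (fun h ↦ absurd (mem_closedBall_iff_norm.mp h) hgt.not_ge), add_zero]
      have hyx : y ≠ x := sub_ne_zero.mp (norm_pos_iff.mp ((hε.trans hεε').trans hgt))
      have h3 : (n + 1 : ℝ) * (ε' ^ 2 - ε ^ 2) ≤ (n + 1) * (‖y - x‖ ^ 2 - ε ^ 2) := by
        have : ε' ^ 2 ≤ ‖y - x‖ ^ 2 := pow_le_pow_left₀ (hε.trans hεε').le hgt.le 2
        gcongr
      rw [smoothGreenGrad_of_gt hφ hD hx hy hyx (hn.trans_le h3),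
        greenGrad_of_le (hεε'.trans hgt).le]
      gcongr
      exact hC _

theorem memLp_dirichletMeasure {f : ℂ → ℂ} (h : MemLp f 2 (volume.restrict D)) :
    MemLp f 2 (dirichletMeasure D) := h.smul_measure ENNReal.ofReal_ne_top

theorem memLp_greenGrad_dirichletMeasure (hφ : IsConformalToDisc D x φ) (hD : IsOpen D)
    (hx : x ∈ D) {ε : ℝ} (hε : 0 < ε) (hεD : closedBall x ε ⊆ D) :
    MemLp (greenGrad φ x ε) 2 (dirichletMeasure D) :=
  memLp_dirichletMeasure (memLp_greenGrad hφ hD hx hε hεD)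

theorem toLp_greenGrad_mem_H1 (hφ : IsConformalToDisc D x φ) (hD : IsOpen D) (hx : x ∈ D)
    {ε : ℝ} (hε : 0 < ε) (hεD : closedBall x ε ⊆ D) :
    (memLp_greenGrad_dirichletMeasure hφ hD hx hε hεD).toLp ∈ H1 D := by
  obtain ⟨ε', hεε', hε'D⟩ := exists_lt_closedBall_subset hD hεD
  obtain ⟨g, hg, hgb⟩ := exists_dominating_gradient_greenTest hφ hD hx hε hεε' hε'D
  have hpos : 0 < ε' ^ 2 - ε ^ 2 := by
    have := pow_lt_pow_left₀ hεε' hε.le two_ne_zero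
    linarith
  obtain ⟨N, hN⟩ := eventually_atTop.mp
    ((tendsto_natCast_succ_mul_atTop hpos).eventually_gt_atTop 2)
  -- The index is shifted by `N`, since smoothness with compact support and the domination hold only
  -- for large indices.
  set F : ℕ → ℂ → ℂ := fun n ↦ gradient (greenTest D φ x ε (n + N)) with hF
  have hFD : ∀ n, ∀ y ∈ D, F n y = (deriv cutoff (((n + N : ℕ) + 1) * smoothGreen φ x ε (n + N) y) : ℝ) *
      smoothGreenGrad φ x ε (n + N) y := fun n y hy ↦
    (hasGradientAt_greenTest hφ hD hx hε (n + N) hy).gradient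
  have hFb : ∀ n, ∀ᵐ y ∂(volume.restrict D), ‖F n y‖ ≤ g y := by
    intro n
    filter_upwards [ae_restrict_mem hD.measurableSet] with y hy
    rw [hFD n y hy]
    exact hgb (n + N) (hN (n + N) (by omega)) y hy
  have hFm : ∀ n, AEStronglyMeasurable (F n) (volume.restrict D) := by
    intro n
    have h1 := (greenTest_mem_testFunctions hφ hD hx hε hεε' hε'D (hN (n + N) (by omega))).1
    have h2 : Continuous (F n) :=
      (toDual ℝ ℂ).symm.continuous.comp (h1.continuous_fderiv (by simp))
    exact h2.aestronglyMeasurable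
  have hFL : ∀ n, MemLp (F n) 2 (volume.restrict D) := fun n ↦ hg.mono' (hFm n) (hFb n)
  have hlim : ∀ᵐ y ∂(volume.restrict D), Tendsto (fun n ↦ F n y) atTop (𝓝 (greenGrad φ x ε y)) := by
    filter_upwards [ae_restrict_of_ae (ae_ne_and_norm_ne x ε), ae_restrict_mem hD.measurableSet]
      with y hy hyD
    refine tendsto_const_nhds.congr' ?_
    have h := tendsto_gradient_greenTest hφ hD hx hε hεD hyD hy.1 hy.2
    filter_upwards [(tendsto_add_atTop_nat N).eventually h] with n hn
    rw [hFD n y hyD, hn]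
  have hac := dirichletMeasure_absolutelyContinuous D
  have htend := tendsto_eLpNorm_two_of_dominated (μ := dirichletMeasure D) (F := F)
    (f := greenGrad φ x ε) (g := g) (fun n ↦ (hFm n).mono_ac hac)
    ((memLp_greenGrad hφ hD hx hε hεD).1.mono_ac hac) (hg.smul_measure ENNReal.ofReal_ne_top)
    (fun n ↦ hac (hFb n)) (hac hlim)
  have htend2 := (Lp.tendsto_Lp_iff_tendsto_eLpNorm'' F (fun n ↦ memLp_dirichletMeasure (hFL n))
    (greenGrad φ x ε) (memLp_greenGrad_dirichletMeasure hφ hD hx hε hεD)).mpr htend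
  rw [H1, ← SetLike.mem_coe, Submodule.topologicalClosure_coe]
  refine mem_closure_of_tendsto htend2 (.of_forall fun n ↦ Submodule.subset_span ?_)
  exact ⟨_, greenTest_mem_testFunctions hφ hD hx hε hεε' hε'D (hN (n + N) (by omega)),
    MemLp.coeFn_toLp _⟩

end Membership
end LiouvilleGFF

namespace LiouvilleGFF

open Metric DiscAut InnerProductSpace ComplexConjugate

/-! ### The coefficients of the regularised Green's function in an orthonormal basis of `H¹` -/

instance (D : Set ℂ) : SFinite (dirichletMeasure D) := by
  unfold dirichletMeasure
  infer_instance

theorem integral_dirichletMeasure (D : Set ℂ) (f : ℂ → ℝ) :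
    ∫ y, f y ∂(dirichletMeasure D) = (2 * Real.pi)⁻¹ * ∫ y in D, f y := by
  rw [dirichletMeasure, integral_smul_measure, ENNReal.toReal_ofReal (by positivity), smul_eq_mul,
    one_div]

theorem exists_isConformalToDisc {D : Set ℂ} (hD : IsOpen D) (hsc : IsSimplyConnected D)
    (hne : D ≠ univ) {x : ℂ} (hx : x ∈ D) : ∃ φ, IsConformalToDisc D x φ := by
  obtain ⟨φ, h1, h2, h3⟩ := RiemannMap.exists_bijOn_ball hD hsc hne hx
  exact ⟨φ, h1, h2, h3⟩

section Coefficients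

variable {D : Set ℂ} {x : ℂ} {φ : ℂ → ℂ}

/-- The regularised Green's function as an element of `H¹`. -/
noncomputable def greenVec (hφ : IsConformalToDisc D x φ) (hD : IsOpen D) (hx : x ∈ D) {ε : ℝ}
    (hε : 0 < ε) (hεD : closedBall x ε ⊆ D) : H1 D :=
  ⟨(memLp_greenGrad_dirichletMeasure hφ hD hx hε hεD).toLp, toLp_greenGrad_mem_H1 hφ hD hx hε hεD⟩

/-- The bridge from the integral of classical gradients to the Hilbert space: the coefficients of
the field are genuine Fourier coefficients, so Parseval's identity turns their sums into energies.
-/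
theorem dirichletInner_greenReg (hφ : IsConformalToDisc D x φ) (hD : IsOpen D) (hx : x ∈ D) {ε : ℝ}
    (hε : 0 < ε) (hεD : closedBall x ε ⊆ D) (v : H1 D) :
    dirichletInner D v (greenReg D ε x) = inner ℝ v (greenVec hφ hD hx hε hεD) := by
  rw [Submodule.coe_inner, L2.inner_def, dirichletInner]
  refine integral_congr_ae ?_
  filter_upwards [dirichletMeasure_absolutelyContinuous D (gradient_greenReg_ae hD hx hφ ε),
    (memLp_greenGrad_dirichletMeasure hφ hD hx hε hεD).coeFn_toLp] with y h1 h2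
  rw [h1, greenVec, h2]

theorem inner_greenVec {x' : ℂ} {φ' : ℂ → ℂ} (hφ : IsConformalToDisc D x φ)
    (hφ' : IsConformalToDisc D x' φ') (hD : IsOpen D) (hx : x ∈ D) (hx' : x' ∈ D) {ε δ : ℝ}
    (hε : 0 < ε) (hδ : 0 < δ) (hεD : closedBall x ε ⊆ D) (hδD : closedBall x' δ ⊆ D) :
    inner ℝ (greenVec hφ hD hx hε hεD) (greenVec hφ' hD hx' hδ hδD)
      = (2 * Real.pi)⁻¹ * ∫ y in D, inner ℝ (greenGrad φ x ε y) (greenGrad φ' x' δ y) := by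
  rw [Submodule.coe_inner, L2.inner_def, ← integral_dirichletMeasure]
  refine integral_congr_ae ?_
  filter_upwards [(memLp_greenGrad_dirichletMeasure hφ hD hx hε hεD).coeFn_toLp,
    (memLp_greenGrad_dirichletMeasure hφ' hD hx' hδ hδD).coeFn_toLp] with y h1 h2
  rw [greenVec, greenVec, h1, h2]

theorem inner_greenVec_self (hφ : IsConformalToDisc D x φ) (hD : IsOpen D) (hx : x ∈ D) {ε : ℝ}
    (hε : 0 < ε) (hεD : closedBall x ε ⊆ D) :
    inner ℝ (greenVec hφ hD hx hε hεD) (greenVec hφ hD hx hε hεD)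
      = Real.log (1 / ε) + Real.log (conformalRadius D x) := by
  rw [inner_greenVec]
  simp_rw [real_inner_self_eq_norm_sq]
  rw [integral_sq_norm_greenGrad hφ hD hx hε hεD, ← mul_assoc, inv_mul_cancel₀ (by positivity),
    one_mul]

/-- The coefficients of the regularised Green's function in an orthonormal basis of `H¹`. -/
noncomputable def greenCoeff (D : Set ℂ) (e : HilbertBasis ℕ ℝ (H1 D)) (ε : ℝ) (x : ℂ) (n : ℕ) :
    ℝ :=
  dirichletInner D (e n) (greenReg D ε x)

/-- The covariance of the regularised fields at two points. -/
noncomputable def greenCov (D : Set ℂ) (e : HilbertBasis ℕ ℝ (H1 D)) (ε : ℝ) (x : ℂ) (δ : ℝ)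
    (y : ℂ) : ℝ :=
  ∑' n, greenCoeff D e ε x n * greenCoeff D e δ y n

variable (e : HilbertBasis ℕ ℝ (H1 D))

theorem hasSum_greenCoeff_mul_inner {x' : ℂ} {φ' : ℂ → ℂ} (hφ : IsConformalToDisc D x φ)
    (hφ' : IsConformalToDisc D x' φ') (hD : IsOpen D) (hx : x ∈ D) (hx' : x' ∈ D) {ε δ : ℝ}
    (hε : 0 < ε) (hδ : 0 < δ) (hεD : closedBall x ε ⊆ D) (hδD : closedBall x' δ ⊆ D) :
    HasSum (fun n ↦ greenCoeff D e ε x n * greenCoeff D e δ x' n)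
      (inner ℝ (greenVec hφ hD hx hε hεD) (greenVec hφ' hD hx' hδ hδD)) := by
  refine (e.hasSum_inner_mul_inner _ _).congr_fun fun n ↦ ?_
  rw [greenCoeff, greenCoeff, dirichletInner_greenReg hφ hD hx hε hεD,
    dirichletInner_greenReg hφ' hD hx' hδ hδD, real_inner_comm]

theorem hasSum_greenCoeff_mul (hD : IsOpen D) (hsc : IsSimplyConnected D) (hne : D ≠ univ)
    {x' : ℂ} {ε δ : ℝ} (hε : 0 < ε) (hδ : 0 < δ) (hεD : closedBall x ε ⊆ D)
    (hδD : closedBall x' δ ⊆ D) :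
    HasSum (fun n ↦ greenCoeff D e ε x n * greenCoeff D e δ x' n) (greenCov D e ε x δ x') := by
  have hx := hεD (mem_closedBall_self hε.le)
  have hx' := hδD (mem_closedBall_self hδ.le)
  obtain ⟨φ, hφ⟩ := exists_isConformalToDisc hD hsc hne hx
  obtain ⟨φ', hφ'⟩ := exists_isConformalToDisc hD hsc hne hx'
  exact (hasSum_greenCoeff_mul_inner e hφ hφ' hD hx hx' hε hδ hεD hδD).summable.hasSum

theorem hasSum_greenCoeff_sq (hD : IsOpen D) (hsc : IsSimplyConnected D) (hne : D ≠ univ)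
    {ε : ℝ} (hε : 0 < ε) (hεD : closedBall x ε ⊆ D) :
    HasSum (fun n ↦ greenCoeff D e ε x n ^ 2)
      (Real.log (1 / ε) + Real.log (conformalRadius D x)) := by
  have hx := hεD (mem_closedBall_self hε.le)
  obtain ⟨φ, hφ⟩ := exists_isConformalToDisc hD hsc hne hx
  simp_rw [sq]
  rw [← inner_greenVec_self hφ hD hx hε hεD]
  exact hasSum_greenCoeff_mul_inner e hφ hφ hD hx hx hε hε hεD hεD

theorem greenCov_eq_of_le (hD : IsOpen D) (hsc : IsSimplyConnected D) (hne : D ≠ univ)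
    {x' : ℂ} {s ε δ : ℝ} (hs : 0 < s) (hsε : s ≤ ε) (hδ : 0 < δ) (hεD : closedBall x ε ⊆ D)
    (hδD : closedBall x' δ ⊆ D) (hdisj : ε + δ < ‖x - x'‖) :
    greenCov D e s x δ x' = greenCov D e ε x δ x' := by
  have hsD : closedBall x s ⊆ D := (closedBall_subset_closedBall hsε).trans hεD
  have hx := hsD (mem_closedBall_self hs.le)
  have hx' := hδD (mem_closedBall_self hδ.le)
  obtain ⟨φ, hφ⟩ := exists_isConformalToDisc hD hsc hne hx
  obtain ⟨φ', hφ'⟩ := exists_isConformalToDisc hD hsc hne hx'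
  rw [greenCov, greenCov, (hasSum_greenCoeff_mul_inner e hφ hφ' hD hx hx' hs hδ hsD hδD).tsum_eq,
    (hasSum_greenCoeff_mul_inner e hφ hφ' hD hx hx' (hs.trans_le hsε) hδ hεD hδD).tsum_eq,
    inner_greenVec, inner_greenVec,
    integral_inner_greenGrad_eq hφ hφ' hD hx hx' hs hsε hδ hεD hδD hdisj]

theorem greenCov_comm (ε : ℝ) (x : ℂ) (δ : ℝ) (y : ℂ) :
    greenCov D e ε x δ y = greenCov D e δ y ε x := by
  simp_rw [greenCov, mul_comm]

/-! ### Measurability in the pole -/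

theorem greenGrad_moebius_comp {z : ℂ} (hφ : IsConformalToDisc D z φ) (hD : IsOpen D) (hx : x ∈ D)
    (ε : ℝ) {y : ℂ} (hy : y ∈ D) :
    greenGrad (fun y ↦ moebius (φ x) (φ y)) x ε y
      = conj ((if ‖y - x‖ < ε then (y - x)⁻¹ else 0) - deriv φ y * (1 - (‖φ x‖ ^ 2 : ℝ)) /
        ((1 - conj (φ x) * φ y) * (φ y - φ x))) := by
  have h1 := hasDerivAt_moebius (hφ.norm_lt_one hx) (hφ.norm_lt_one hy)
  have h0 := one_sub_conj_mul_ne_zero (hφ.norm_lt_one hx) (hφ.norm_lt_one hy)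
  have h2 : deriv (fun y ↦ moebius (φ x) (φ y)) y = _ := (h1.comp y (hφ.hasDerivAt hD hy)).deriv
  rw [greenGrad, h2, moebius]
  congr 2
  rcases eq_or_ne (φ y - φ x) 0 with h | h
  · simp [h]
  · field_simp

/-- The Green's function is chosen separately for each pole, so nothing is measurable in `x` by
definition. Writing all gradients through one map `φ` and a disc automorphism gives a kernel jointly
measurable in `(x, y)`. -/
theorem exists_measurable_dirichletInner_greenReg {z : ℂ} (hφ : IsConformalToDisc D z φ)
    (hD : IsOpen D) (v : H1 D) (ε : ℝ) :
    ∃ g : ℂ → ℝ, Measurable g ∧ ∀ x ∈ D, dirichletInner D v (greenReg D ε x) = g x := by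
  -- `φ` is arbitrary off `D`; cutting it to `0` there makes it measurable.
  set ψ : ℂ → ℂ := D.indicator φ with hψ
  have hψm : Measurable ψ := by
    classical
    rw [hψ, ← piecewise_eq_indicator]
    exact hφ.1.continuousOn.measurable_piecewise continuousOn_const hD.measurableSet
  have hψe : ∀ y ∈ D, ψ y = φ y := fun y hy ↦ indicator_of_mem hy φ
  set K : ℂ × ℂ → ℂ := fun p ↦ conj ((if ‖p.2 - p.1‖ < ε then (p.2 - p.1)⁻¹ else 0) -
    deriv φ p.2 * (1 - (‖ψ p.1‖ ^ 2 : ℝ)) /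
        ((1 - conj (ψ p.1) * ψ p.2) * (ψ p.2 - ψ p.1))) with hK
  have hKm : Measurable K := by
    have h1 : Measurable fun p : ℂ × ℂ ↦ ψ p.1 := hψm.comp measurable_fst
    have h2 : Measurable fun p : ℂ × ℂ ↦ ψ p.2 := hψm.comp measurable_snd
    have h3 : Measurable fun p : ℂ × ℂ ↦ deriv φ p.2 := (measurable_deriv φ).comp measurable_snd
    have hc : Measurable (fun w : ℂ ↦ conj w) := Complex.continuous_conj.measurable
    have h4 : Measurable fun p : ℂ × ℂ ↦ ((‖ψ p.1‖ ^ 2 : ℝ) : ℂ) :=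
      Complex.measurable_ofReal.comp (h1.norm.pow_const 2)
    refine hc.comp (Measurable.sub ?_ ?_)
    · refine Measurable.ite (measurableSet_lt (by fun_prop) measurable_const) (by fun_prop)
        measurable_const
    · exact (h3.mul (measurable_const.sub h4)).div
        ((measurable_const.sub ((hc.comp h1).mul h2)).mul (h2.sub h1))
  refine ⟨fun x ↦ ∫ y, inner ℝ ((v : Lp ℂ 2 (dirichletMeasure D)) y) (K (x, y))
    ∂(dirichletMeasure D), ?_, fun x hx ↦ ?_⟩
  · have hv := (Lp.stronglyMeasurable (v : Lp ℂ 2 (dirichletMeasure D))).measurable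
    have h : Measurable fun p : ℂ × ℂ ↦
        inner ℝ ((v : Lp ℂ 2 (dirichletMeasure D)) p.2) (K p) :=
      (hv.comp measurable_snd).inner hKm
    exact (StronglyMeasurable.integral_prod_right' h.stronglyMeasurable).measurable
  · rw [dirichletInner]
    refine integral_congr_ae ?_
    filter_upwards [dirichletMeasure_absolutelyContinuous D
      (gradient_greenReg_ae hD hx (hφ.moebius_comp hx) ε),
      dirichletMeasure_absolutelyContinuous D (ae_restrict_mem hD.measurableSet)] with y h1 hy
    rw [h1, greenGrad_moebius_comp hφ hD hx ε hy, hK]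
    simp only [hψe x hx, hψe y hy]

end Coefficients
end LiouvilleGFF

namespace LiouvilleGFF

/-! ### Gaussian series -/

section GaussianSeries

variable {Ω : Type*} [MeasurableSpace Ω] {P : Measure Ω} {a : ℕ → Ω → ℝ}

theorem map_gaussian_mul_const {X : Ω → ℝ} (hX : HasLaw X (gaussianReal 0 1) P)
    (c : ℝ) : P.map (fun ω ↦ X ω * c) = gaussianReal 0 (c ^ 2).toNNReal := by
  have h : (fun ω ↦ X ω * c) = (fun x ↦ x * c) ∘ X := rfl
  rw [h, ← AEMeasurable.map_map_of_aemeasurable (by fun_prop) hX.aemeasurable, hX.map_eq,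
    gaussianReal_map_mul_const, mul_zero]
  congr 1
  ext
  simp [Real.coe_toNNReal _ (sq_nonneg c)]

theorem integrable_exp_of_map_gaussianReal {X : Ω → ℝ} {v : NNReal}
    (hX : P.map X = gaussianReal 0 v) (t : ℝ) : Integrable (fun ω ↦ Real.exp (t * X ω)) P := by
  have hm : AEMeasurable X P := aemeasurable_of_map_neZero (by rw [hX]; infer_instance)
  have h := integrable_exp_mul_gaussianReal (μ := 0) (v := v) t
  rw [← hX] at h
  exact (integrable_map_measure (by fun_prop) hm).mp h

theorem integral_exp_of_map_gaussianReal {X : Ω → ℝ} {v : NNReal}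
    (hX : P.map X = gaussianReal 0 v) (t : ℝ) :
    ∫ ω, Real.exp (t * X ω) ∂P = Real.exp (t ^ 2 / 2 * v) := by
  have h := mgf_gaussianReal hX t
  rw [mgf] at h
  rw [h]
  congr 1
  ring

variable [IsProbabilityMeasure P]

theorem map_gaussian_partialSum (ha : ∀ n, Measurable (a n))
    (hlaw : ∀ n, HasLaw (a n) (gaussianReal 0 1) P) (hind : iIndepFun a P) (α : ℕ → ℝ) (N : ℕ) :
    P.map (fun ω ↦ ∑ n ∈ Finset.range N, a n ω * α n)
      = gaussianReal 0 (∑ n ∈ Finset.range N, α n ^ 2).toNNReal := by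
  induction N with
  | zero => simp
  | succ N ih =>
    have h1 : iIndepFun (fun n ω ↦ a n ω * α n) P :=
      hind.comp (fun n x ↦ x * α n) fun n ↦ by fun_prop
    have h2 : IndepFun (fun ω ↦ ∑ n ∈ Finset.range N, a n ω * α n) (fun ω ↦ a N ω * α N) P := by
      have := h1.indepFun_finsetSum_of_notMem (fun n ↦ (ha n).mul_const _)
        (Finset.notMem_range_self (n := N))
      convert this using 1
      ext ω
      simp
    have h3 := gaussianReal_add_gaussianReal_of_indepFun h2 ih (map_gaussian_mul_const (hlaw N) (α N))
    rw [Finset.sum_range_succ, Real.toNNReal_add (Finset.sum_nonneg fun _ _ ↦ sq_nonneg _)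
      (sq_nonneg _)]
    simp_rw [Finset.sum_range_succ]
    rw [add_zero] at h3
    exact h3

/-- The partial sums form a martingale bounded in `L¹`, and Doob's convergence theorem applies. -/
theorem ae_tendsto_gaussian_series (ha : ∀ n, Measurable (a n))
    (hlaw : ∀ n, HasLaw (a n) (gaussianReal 0 1) P) (hind : iIndepFun a P) {α : ℕ → ℝ}
    (hα : Summable fun n ↦ α n ^ 2) :
    ∀ᵐ ω ∂P, ∃ l, Tendsto (fun N ↦ ∑ n ∈ Finset.range N, a n ω * α n) atTop (𝓝 l) := by
  set σ := ∑' n, α n ^ 2 with hσ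
  set S : ℕ → Ω → ℝ := fun N ω ↦ ∑ n ∈ Finset.range N, a n ω * α n with hS
  have hsm : ∀ n, StronglyMeasurable (a n) := fun n ↦ (ha n).stronglyMeasurable
  set ℱ := Filtration.natural a hsm with hℱ
  have hSlaw := map_gaussian_partialSum ha hlaw hind α
  have hint : ∀ n, Integrable (a n) P := by
    intro n
    have h := (memLp_id_gaussianReal (μ := 0) (v := 1) 1).integrable (by simp)
    rw [← (hlaw n).map_eq] at h
    exact (integrable_map_measure (by fun_prop) (ha n).aemeasurable).mp h
  have hSint : ∀ N, Integrable (S N) P := fun N ↦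
    integrable_finsetSum _ fun n _ ↦ (hint n).mul_const _
  -- The shift by one matches the indices: `S (N + 1)` involves `a 0, …, a N`, which are known at
  -- time `N`.
  have hadp : StronglyAdapted ℱ (fun N ↦ S (N + 1)) := by
    intro N
    refine Finset.stronglyMeasurable_fun_sum _ fun n hn ↦ ?_
    refine StronglyMeasurable.mul_const ?_ _
    exact (Filtration.stronglyAdapted_natural hsm n).mono
      (ℱ.mono (Nat.lt_succ_iff.mp (Finset.mem_range.mp hn)))
  have hmart : Martingale (fun N ↦ S (N + 1)) ℱ P := by
    refine martingale_nat hadp (fun N ↦ hSint _) fun N ↦ ?_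
    have h1 : S (N + 1 + 1) = S (N + 1) + fun ω ↦ a (N + 1) ω * α (N + 1) := by
      ext ω
      simp only [hS, Pi.add_apply, Finset.sum_range_succ]
    have h2 : P[fun ω ↦ a (N + 1) ω * α (N + 1) | ℱ N] =ᵐ[P] 0 := by
      have h3 := iIndepFun.condExp_natural_ae_eq_of_lt hsm hind (Nat.lt_succ_self N)
      have h4 : P[a (N + 1)] = 0 := by
        rw [(hlaw (N + 1)).integral_eq, integral_id_gaussianReal]
      have h5 := condExp_smul (μ := P) (α (N + 1)) (a (N + 1)) (ℱ N)
      have h6 : (α (N + 1)) • (a (N + 1)) = fun ω ↦ a (N + 1) ω * α (N + 1) := by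
        ext ω
        simp [mul_comm]
      rw [h6] at h5
      filter_upwards [h3, h5] with ω h3 h5
      rw [h5, Pi.smul_apply, h3, h4, smul_zero, Pi.zero_apply]
    have h7 := condExp_add (hSint (N + 1)) ((hint (N + 1)).mul_const (α (N + 1))) (ℱ N)
    have h8 := condExp_of_stronglyMeasurable (ℱ.le N) (hadp N) (hSint (N + 1))
    rw [h1]
    filter_upwards [h2, h7] with ω h2 h7
    rw [h7, Pi.add_apply, h2, h8, Pi.zero_apply, add_zero]
  -- From `|s| ≤ exp s + exp (-s)` and the exponential moments of a Gaussian of variance at most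
  -- `σ`.
  have hbdd : ∀ N, eLpNorm (S (N + 1)) 1 P ≤ (2 * Real.exp (σ / 2)).toNNReal := by
    intro N
    rw [eLpNorm_one_eq_lintegral_enorm, ← ofReal_integral_norm_eq_lintegral_enorm (hSint _)]
    refine ENNReal.ofReal_le_ofReal ?_
    have h1 := integrable_exp_of_map_gaussianReal (hSlaw (N + 1)) 1
    have h2 := integrable_exp_of_map_gaussianReal (hSlaw (N + 1)) (-1)
    calc ∫ ω, ‖S (N + 1) ω‖ ∂P
        ≤ ∫ ω, (Real.exp (1 * S (N + 1) ω) + Real.exp (-1 * S (N + 1) ω)) ∂P := by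
          refine integral_mono (hSint _).norm (h1.add h2) fun ω ↦ ?_
          simp only [Real.norm_eq_abs, one_mul, neg_mul]
          rcases abs_cases (S (N + 1) ω) with ⟨h, -⟩ | ⟨h, -⟩ <;> rw [h]
          · linarith [Real.add_one_le_exp (S (N + 1) ω), Real.exp_pos (-S (N + 1) ω)]
          · linarith [Real.add_one_le_exp (-S (N + 1) ω), Real.exp_pos (S (N + 1) ω)]
      _ = 2 * Real.exp (1 / 2 * (∑ n ∈ Finset.range (N + 1), α n ^ 2)) := by
          rw [integral_add h1 h2, integral_exp_of_map_gaussianReal (hSlaw (N + 1)),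
            integral_exp_of_map_gaussianReal (hSlaw (N + 1)),
            Real.coe_toNNReal _ (Finset.sum_nonneg fun _ _ ↦ sq_nonneg _)]
          norm_num
          ring
      _ ≤ 2 * Real.exp (σ / 2) := by
          have := hα.sum_le_tsum (Finset.range (N + 1)) fun _ _ ↦ sq_nonneg _
          gcongr
          linarith
  filter_upwards [hmart.submartingale.ae_tendsto_limitProcess hbdd] with ω hω
  exact ⟨_, (tendsto_add_atTop_iff_nat 1).mp hω⟩

/-- The characteristic functions of the partial sums converge, on one side by dominated convergence
and on the other by their explicit formula. -/
theorem map_gaussian_limit (ha : ∀ n, Measurable (a n))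
    (hlaw : ∀ n, HasLaw (a n) (gaussianReal 0 1) P) (hind : iIndepFun a P) {α : ℕ → ℝ} {v : ℝ}
    (hα : HasSum (fun n ↦ α n ^ 2) v) {L : Ω → ℝ}
    (hL : ∀ᵐ ω ∂P, Tendsto (fun N ↦ ∑ n ∈ Finset.range N, a n ω * α n) atTop (𝓝 (L ω))) :
    P.map L = gaussianReal 0 v.toNNReal := by
  have hv : 0 ≤ v := hα.nonneg fun _ ↦ sq_nonneg _
  have hSm : ∀ N, Measurable fun ω ↦ ∑ n ∈ Finset.range N, a n ω * α n := fun N ↦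
    Finset.measurable_fun_sum _ fun n _ ↦ (ha n).mul_const _
  have hLm : AEMeasurable L P := aemeasurable_of_tendsto_metrizable_ae atTop
    (fun N ↦ (hSm N).aemeasurable) hL
  have := Measure.isProbabilityMeasure_map hLm
  refine Measure.ext_of_charFun (funext fun t ↦ ?_)
  have h1 : Tendsto (fun N ↦ ∫ ω, Complex.exp
      (t * (∑ n ∈ Finset.range N, a n ω * α n : ℝ) * Complex.I) ∂P) atTop
      (𝓝 (∫ ω, Complex.exp (t * (L ω : ℝ) * Complex.I) ∂P)) := by
    refine tendsto_integral_of_dominated_convergence (fun _ ↦ 1) (fun N ↦ ?_)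
      (integrable_const _) (fun N ↦ .of_forall fun ω ↦ ?_) ?_
    · have := hSm N
      exact (Complex.measurable_exp.comp (((Complex.measurable_ofReal.comp this).const_mul
        (t : ℂ)).mul_const Complex.I)).aestronglyMeasurable
    · rw [← Complex.ofReal_mul, Complex.norm_exp_ofReal_mul_I]
    · filter_upwards [hL] with ω hω
      exact (Complex.continuous_exp.tendsto _).comp ((((Complex.continuous_ofReal.tendsto _).comp
        hω).const_mul (t : ℂ)).mul_const Complex.I)
  have h2 : ∀ N, ∫ ω, Complex.exp (t * (∑ n ∈ Finset.range N, a n ω * α n : ℝ) * Complex.I) ∂P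
      = Complex.exp (-((∑ n ∈ Finset.range N, α n ^ 2 : ℝ) * t ^ 2 / 2)) := by
    intro N
    have h3 := charFun_gaussianReal (μ := 0) (v := (∑ n ∈ Finset.range N, α n ^ 2).toNNReal) t
    rw [← map_gaussian_partialSum ha hlaw hind α N, charFun_apply_real,
      integral_map (hSm N).aemeasurable (by fun_prop)] at h3
    rw [h3, Real.coe_toNNReal _ (Finset.sum_nonneg fun _ _ ↦ sq_nonneg _)]
    simp
  have h4 : Tendsto (fun N ↦ Complex.exp (-((∑ n ∈ Finset.range N, α n ^ 2 : ℝ) * t ^ 2 / 2))) atTop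
      (𝓝 (Complex.exp (-((v : ℝ) * t ^ 2 / 2)))) := by
    have h5 := (Complex.continuous_ofReal.tendsto _).comp hα.tendsto_sum_nat
    exact (Complex.continuous_exp.tendsto _).comp (((h5.mul_const _).div_const _).neg)
  simp_rw [h2] at h1
  rw [charFun_apply_real, integral_map hLm (by fun_prop), tendsto_nhds_unique h1 h4,
    charFun_gaussianReal, Real.coe_toNNReal _ hv]
  simp

end GaussianSeries
end LiouvilleGFF

namespace LiouvilleGFF

open Metric

/-! ### Moments of the regularised field -/

section Moments

variable {Ω : Type*} {D : Set ℂ} (e : HilbertBasis ℕ ℝ (H1 D)) (a : ℕ → Ω → ℝ)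

theorem gffReg_eq_limUnder (ε : ℝ) (x : ℂ) (ω : Ω) :
    gffReg D e a ε x ω
      = limUnder atTop fun N ↦ ∑ n ∈ Finset.range N, a n ω * greenCoeff D e ε x n := rfl

/-- The density `ε ^ (γ² / 2) * exp (γ h_ε(x))`. -/
noncomputable def chaosDensity (γ ε : ℝ) (x : ℂ) (ω : Ω) : ℝ :=
  ε ^ (γ ^ 2 / 2) * Real.exp (γ * gffReg D e a ε x ω)

theorem chaosDensity_nonneg (γ : ℝ) {ε : ℝ} (hε : 0 < ε) (x : ℂ) (ω : Ω) :
    0 ≤ chaosDensity e a γ ε x ω := by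
  rw [chaosDensity]
  positivity

variable [MeasurableSpace Ω] {P : Measure Ω} [IsProbabilityMeasure P]

theorem exists_measurable_gffReg (hD : IsOpen D) (hsc : IsSimplyConnected D) (hne : D ≠ univ)
    (ha : ∀ n, Measurable (a n)) (ε : ℝ) :
    ∃ H : ℂ × Ω → ℝ, Measurable H ∧ ∀ x ∈ D, ∀ ω, gffReg D e a ε x ω = H (x, ω) := by
  obtain ⟨z, hz⟩ := hsc.nonempty
  obtain ⟨φ, hφ⟩ := exists_isConformalToDisc hD hsc hne hz
  choose g hgm hg using fun n ↦ exists_measurable_dirichletInner_greenReg hφ hD (e n) ε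
  refine ⟨fun p ↦ limUnder atTop fun N ↦ ∑ n ∈ Finset.range N, a n p.2 * g n p.1, ?_,
    fun x hx ω ↦ ?_⟩
  · refine (StronglyMeasurable.limUnder fun N ↦ ?_).measurable
    refine Finset.stronglyMeasurable_fun_sum _ fun n _ ↦ Measurable.stronglyMeasurable ?_
    exact ((ha n).comp measurable_snd).mul ((hgm n).comp measurable_fst)
  · simp only [gffReg_eq_limUnder, greenCoeff, hg _ x hx]

theorem measurable_chaosDensity (hD : IsOpen D) (hsc : IsSimplyConnected D) (hne : D ≠ univ)
    (ha : ∀ n, Measurable (a n)) (γ ε : ℝ) :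
    ∃ H : ℂ × Ω → ℝ, Measurable H ∧ ∀ x ∈ D, ∀ ω, chaosDensity e a γ ε x ω = H (x, ω) := by
  obtain ⟨H, hHm, hH⟩ := exists_measurable_gffReg e a hD hsc hne ha ε
  refine ⟨fun p ↦ ε ^ (γ ^ 2 / 2) * Real.exp (γ * H p), by fun_prop, fun x hx ω ↦ ?_⟩
  rw [chaosDensity, hH x hx]

section FixedPoint

variable {a} {ε δ : ℝ} {x y : ℂ}

theorem ae_tendsto_gffReg (hD : IsOpen D) (hsc : IsSimplyConnected D) (hne : D ≠ univ)
    (ha : ∀ n, Measurable (a n)) (hlaw : ∀ n, HasLaw (a n) (gaussianReal 0 1) P)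
    (hind : iIndepFun a P) (hε : 0 < ε) (hεD : closedBall x ε ⊆ D) :
    ∀ᵐ ω ∂P, Tendsto (fun N ↦ ∑ n ∈ Finset.range N, a n ω * greenCoeff D e ε x n) atTop
      (𝓝 (gffReg D e a ε x ω)) := by
  filter_upwards [ae_tendsto_gaussian_series ha hlaw hind
    (hasSum_greenCoeff_sq e hD hsc hne hε hεD).summable] with ω hω
  exact tendsto_nhds_limUnder hω

theorem log_add_log_conformalRadius_nonneg (hD : IsOpen D) (hsc : IsSimplyConnected D)
    (hne : D ≠ univ) (hε : 0 < ε) (hεD : closedBall x ε ⊆ D) :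
    0 ≤ Real.log (1 / ε) + Real.log (conformalRadius D x) := by
  obtain ⟨φ, hφ⟩ := exists_isConformalToDisc hD hsc hne (hεD (mem_closedBall_self hε.le))
  rw [← inner_greenVec_self hφ hD (hεD (mem_closedBall_self hε.le)) hε hεD]
  exact real_inner_self_nonneg

theorem map_gffReg (hD : IsOpen D) (hsc : IsSimplyConnected D) (hne : D ≠ univ)
    (ha : ∀ n, Measurable (a n)) (hlaw : ∀ n, HasLaw (a n) (gaussianReal 0 1) P)
    (hind : iIndepFun a P) (hε : 0 < ε) (hεD : closedBall x ε ⊆ D) :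
    P.map (gffReg D e a ε x)
      = gaussianReal 0 (Real.log (1 / ε) + Real.log (conformalRadius D x)).toNNReal :=
  map_gaussian_limit ha hlaw hind (hasSum_greenCoeff_sq e hD hsc hne hε hεD)
    (ae_tendsto_gffReg e hD hsc hne ha hlaw hind hε hεD)

/-- The sum of two field values is again a Gaussian series, with added coefficients. Its law alone
determines the mean of a product of two exponentials, so no joint law is needed. -/
theorem map_gffReg_add (hD : IsOpen D) (hsc : IsSimplyConnected D) (hne : D ≠ univ)
    (ha : ∀ n, Measurable (a n)) (hlaw : ∀ n, HasLaw (a n) (gaussianReal 0 1) P)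
    (hind : iIndepFun a P) (hε : 0 < ε) (hεD : closedBall x ε ⊆ D) (hδ : 0 < δ)
    (hδD : closedBall y δ ⊆ D) :
    ∃ v : ℝ, 0 ≤ v ∧ v = Real.log (1 / ε) + Real.log (conformalRadius D x)
      + (Real.log (1 / δ) + Real.log (conformalRadius D y)) + 2 * greenCov D e ε x δ y ∧
      P.map (fun ω ↦ gffReg D e a ε x ω + gffReg D e a δ y ω) = gaussianReal 0 v.toNNReal := by
  have h := ((hasSum_greenCoeff_sq e hD hsc hne hε hεD).add
    (hasSum_greenCoeff_sq e hD hsc hne hδ hδD)).add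
    ((hasSum_greenCoeff_mul e hD hsc hne hε hδ hεD hδD).mul_left 2)
  have h' : HasSum (fun n ↦ (greenCoeff D e ε x n + greenCoeff D e δ y n) ^ 2) _ :=
    h.congr_fun fun n ↦ by ring
  refine ⟨_, h'.nonneg fun _ ↦ sq_nonneg _, rfl, map_gaussian_limit ha hlaw hind h' ?_⟩
  filter_upwards [ae_tendsto_gffReg e hD hsc hne ha hlaw hind hε hεD,
    ae_tendsto_gffReg e hD hsc hne ha hlaw hind hδ hδD] with ω h1 h2
  simp_rw [mul_add, Finset.sum_add_distrib]
  exact h1.add h2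

theorem conformalRadius_pos (hD : IsOpen D) (hsc : IsSimplyConnected D) (hne : D ≠ univ)
    (hx : x ∈ D) : 0 < conformalRadius D x := by
  obtain ⟨φ, hφ⟩ := exists_isConformalToDisc hD hsc hne hx
  rw [conformalRadius_eq hD hx hφ]
  exact inv_pos.mpr (norm_pos_iff.mpr (hφ.deriv_ne_zero hD hx))

theorem exp_mul_log_add_log (hε : 0 < ε) {C : ℝ} (hC : 0 < C) (t : ℝ) :
    Real.exp (t * (Real.log (1 / ε) + Real.log C)) = ε ^ (-t) * C ^ t := by
  rw [mul_add, Real.exp_add, Real.rpow_def_of_pos hε, Real.rpow_def_of_pos hC, one_div, Real.log_inv]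
  congr 2 <;> ring

theorem integral_exp_gffReg (hD : IsOpen D) (hsc : IsSimplyConnected D) (hne : D ≠ univ)
    (ha : ∀ n, Measurable (a n)) (hlaw : ∀ n, HasLaw (a n) (gaussianReal 0 1) P)
    (hind : iIndepFun a P) (hε : 0 < ε) (hεD : closedBall x ε ⊆ D) (t : ℝ) :
    Integrable (fun ω ↦ Real.exp (t * gffReg D e a ε x ω)) P ∧
    ∫ ω, Real.exp (t * gffReg D e a ε x ω) ∂P
      = ε ^ (-(t ^ 2 / 2)) * conformalRadius D x ^ (t ^ 2 / 2) := by
  have h := map_gffReg e hD hsc hne ha hlaw hind hε hεD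
  refine ⟨integrable_exp_of_map_gaussianReal h t, ?_⟩
  rw [integral_exp_of_map_gaussianReal h,
    Real.coe_toNNReal _ (log_add_log_conformalRadius_nonneg hD hsc hne hε hεD),
    exp_mul_log_add_log hε (conformalRadius_pos hD hsc hne (hεD (mem_closedBall_self hε.le)))]

/-- The factor `ε ^ (γ ^ 2 / 2)` cancels exactly the growth of the exponential moment. -/
theorem integral_chaosDensity (hD : IsOpen D) (hsc : IsSimplyConnected D) (hne : D ≠ univ)
    (ha : ∀ n, Measurable (a n)) (hlaw : ∀ n, HasLaw (a n) (gaussianReal 0 1) P)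
    (hind : iIndepFun a P) (hε : 0 < ε) (hεD : closedBall x ε ⊆ D) (γ : ℝ) :
    Integrable (chaosDensity e a γ ε x) P ∧
    ∫ ω, chaosDensity e a γ ε x ω ∂P = conformalRadius D x ^ (γ ^ 2 / 2) := by
  obtain ⟨h1, h2⟩ := integral_exp_gffReg e hD hsc hne ha hlaw hind hε hεD γ
  refine ⟨h1.const_mul _, ?_⟩
  simp only [chaosDensity]
  rw [integral_const_mul, h2, ← mul_assoc, ← Real.rpow_add hε, add_neg_cancel, Real.rpow_zero,
    one_mul]

theorem integral_chaosDensity_sq (hD : IsOpen D) (hsc : IsSimplyConnected D) (hne : D ≠ univ)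
    (ha : ∀ n, Measurable (a n)) (hlaw : ∀ n, HasLaw (a n) (gaussianReal 0 1) P)
    (hind : iIndepFun a P) (hε : 0 < ε) (hεD : closedBall x ε ⊆ D) (γ : ℝ) :
    Integrable (fun ω ↦ chaosDensity e a γ ε x ω ^ 2) P ∧
    ∫ ω, chaosDensity e a γ ε x ω ^ 2 ∂P
      = ε ^ (-γ ^ 2) * conformalRadius D x ^ (2 * γ ^ 2) := by
  obtain ⟨h1, h2⟩ := integral_exp_gffReg e hD hsc hne ha hlaw hind hε hεD (2 * γ)
  have h3 : ∀ ω, chaosDensity e a γ ε x ω ^ 2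
      = ε ^ (γ ^ 2) * Real.exp (2 * γ * gffReg D e a ε x ω) := by
    intro ω
    rw [chaosDensity, mul_pow, ← Real.rpow_mul_natCast hε.le, ← Real.exp_nat_mul]
    congr 2 <;> push_cast <;> ring
  simp_rw [h3]
  refine ⟨h1.const_mul _, ?_⟩
  rw [integral_const_mul, h2, ← mul_assoc, ← Real.rpow_add hε]
  congr 2 <;> ring

theorem integral_chaosDensity_mul (hD : IsOpen D) (hsc : IsSimplyConnected D) (hne : D ≠ univ)
    (ha : ∀ n, Measurable (a n)) (hlaw : ∀ n, HasLaw (a n) (gaussianReal 0 1) P)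
    (hind : iIndepFun a P) (hε : 0 < ε) (hεD : closedBall x ε ⊆ D) (hδ : 0 < δ)
    (hδD : closedBall y δ ⊆ D) (γ : ℝ) :
    Integrable (fun ω ↦ chaosDensity e a γ ε x ω * chaosDensity e a γ δ y ω) P ∧
    ∫ ω, chaosDensity e a γ ε x ω * chaosDensity e a γ δ y ω ∂P
      = conformalRadius D x ^ (γ ^ 2 / 2) * conformalRadius D y ^ (γ ^ 2 / 2)
        * Real.exp (γ ^ 2 * greenCov D e ε x δ y) := by
  obtain ⟨v, hv0, hv, hmap⟩ := map_gffReg_add e hD hsc hne ha hlaw hind hε hεD hδ hδD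
  have h3 : ∀ ω, chaosDensity e a γ ε x ω * chaosDensity e a γ δ y ω
      = (ε ^ (γ ^ 2 / 2) * δ ^ (γ ^ 2 / 2)) *
        Real.exp (γ * (gffReg D e a ε x ω + gffReg D e a δ y ω)) := by
    intro ω
    rw [chaosDensity, chaosDensity, mul_add, Real.exp_add]
    ring
  simp_rw [h3]
  refine ⟨(integrable_exp_of_map_gaussianReal hmap γ).const_mul _, ?_⟩
  rw [integral_const_mul, integral_exp_of_map_gaussianReal hmap, Real.coe_toNNReal _ hv0, hv,
    mul_add, mul_add, Real.exp_add, Real.exp_add,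
    exp_mul_log_add_log hε (conformalRadius_pos hD hsc hne (hεD (mem_closedBall_self hε.le))),
    exp_mul_log_add_log hδ (conformalRadius_pos hD hsc hne (hδD (mem_closedBall_self hδ.le))),
    Real.rpow_neg hε.le, Real.rpow_neg hδ.le]
  have h1 := (Real.rpow_pos_of_pos hε (γ ^ 2 / 2)).ne'
  have h2 := (Real.rpow_pos_of_pos hδ (γ ^ 2 / 2)).ne'
  rw [show γ ^ 2 / 2 * (2 * greenCov D e ε x δ y) = γ ^ 2 * greenCov D e ε x δ y by ring]
  field_simp

/-- The four products in the expansion have the same mean, because the covariance does not see the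
radii of disjoint discs. -/
theorem integral_chaosDensity_sub_mul_sub (hD : IsOpen D) (hsc : IsSimplyConnected D)
    (hne : D ≠ univ) (ha : ∀ n, Measurable (a n))
    (hlaw : ∀ n, HasLaw (a n) (gaussianReal 0 1) P) (hind : iIndepFun a P) (hδ : 0 < δ)
    (hδε : δ ≤ ε) (hxD : closedBall x ε ⊆ D) (hyD : closedBall y ε ⊆ D)
    (hxy : 2 * ε < ‖x - y‖) (γ : ℝ) :
    ∫ ω, (chaosDensity e a γ δ x ω - chaosDensity e a γ ε x ω) *
      (chaosDensity e a γ δ y ω - chaosDensity e a γ ε y ω) ∂P = 0 := by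
  have hε := hδ.trans_le hδε
  have hxD' := (closedBall_subset_closedBall hδε).trans hxD
  have hyD' := (closedBall_subset_closedBall hδε).trans hyD
  obtain ⟨i1, e1⟩ := integral_chaosDensity_mul e hD hsc hne ha hlaw hind hδ hxD' hδ hyD' γ
  obtain ⟨i2, e2⟩ := integral_chaosDensity_mul e hD hsc hne ha hlaw hind hδ hxD' hε hyD γ
  obtain ⟨i3, e3⟩ := integral_chaosDensity_mul e hD hsc hne ha hlaw hind hε hxD hδ hyD' γ
  obtain ⟨i4, e4⟩ := integral_chaosDensity_mul e hD hsc hne ha hlaw hind hε hxD hε hyD γ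
  have c2 : greenCov D e δ x ε y = greenCov D e ε x ε y :=
    greenCov_eq_of_le e hD hsc hne hδ hδε hε hxD hyD (by linarith)
  have c3 : greenCov D e ε x δ y = greenCov D e ε x ε y := by
    rw [greenCov_comm, greenCov_comm e ε x]
    exact greenCov_eq_of_le e hD hsc hne hδ hδε hε hyD hxD (by rw [norm_sub_rev]; linarith)
  have c1 : greenCov D e δ x δ y = greenCov D e ε x ε y := by
    rw [greenCov_eq_of_le e hD hsc hne hδ hδε hδ hxD hyD' (by linarith), c3]
  have h : ∀ ω, (chaosDensity e a γ δ x ω - chaosDensity e a γ ε x ω) *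
      (chaosDensity e a γ δ y ω - chaosDensity e a γ ε y ω)
      = (chaosDensity e a γ δ x ω * chaosDensity e a γ δ y ω -
        chaosDensity e a γ δ x ω * chaosDensity e a γ ε y ω) -
        (chaosDensity e a γ ε x ω * chaosDensity e a γ δ y ω -
        chaosDensity e a γ ε x ω * chaosDensity e a γ ε y ω) := fun ω ↦ by ring
  simp_rw [h]
  have j1 : Integrable (fun ω ↦ chaosDensity e a γ δ x ω * chaosDensity e a γ δ y ω -
    chaosDensity e a γ δ x ω * chaosDensity e a γ ε y ω) P := i1.sub i2
  have j2 : Integrable (fun ω ↦ chaosDensity e a γ ε x ω * chaosDensity e a γ δ y ω -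
    chaosDensity e a γ ε x ω * chaosDensity e a γ ε y ω) P := i3.sub i4
  rw [integral_sub j1 j2, integral_sub i1 i2, integral_sub i3 i4, e1, e2, e3, e4,
    c1, c2, c3]
  ring

/-- The crude bound `(u - v) ^ 2 ≤ 2 * u ^ 2 + 2 * v ^ 2` is enough: the decay comes from
decorrelation, not from small increments at a point. -/
theorem integral_chaosDensity_sub_sq_le (hD : IsOpen D) (hsc : IsSimplyConnected D)
    (hne : D ≠ univ) (ha : ∀ n, Measurable (a n))
    (hlaw : ∀ n, HasLaw (a n) (gaussianReal 0 1) P) (hind : iIndepFun a P) (hδ : 0 < δ)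
    (hδε : δ ≤ ε) (hxD : closedBall x ε ⊆ D) (γ : ℝ) :
    Integrable (fun ω ↦ (chaosDensity e a γ δ x ω - chaosDensity e a γ ε x ω) ^ 2) P ∧
    ∫ ω, (chaosDensity e a γ δ x ω - chaosDensity e a γ ε x ω) ^ 2 ∂P
      ≤ 4 * δ ^ (-γ ^ 2) * conformalRadius D x ^ (2 * γ ^ 2) := by
  have hε := hδ.trans_le hδε
  have hxD' := (closedBall_subset_closedBall hδε).trans hxD
  obtain ⟨i1, e1⟩ := integral_chaosDensity_sq e hD hsc hne ha hlaw hind hδ hxD' γ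
  obtain ⟨i2, e2⟩ := integral_chaosDensity_sq e hD hsc hne ha hlaw hind hε hxD γ
  obtain ⟨i3, -⟩ := integral_chaosDensity_mul e hD hsc hne ha hlaw hind hδ hxD' hε hxD γ
  have hi : Integrable (fun ω ↦ (chaosDensity e a γ δ x ω - chaosDensity e a γ ε x ω) ^ 2) P := by
    refine ((i1.add i2).sub (i3.const_mul 2)).congr (.of_forall fun ω ↦ ?_)
    simp only [Pi.add_apply, Pi.sub_apply]
    ring
  refine ⟨hi, ?_⟩
  have h1 : ε ^ (-γ ^ 2) ≤ δ ^ (-γ ^ 2) :=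
    Real.rpow_le_rpow_of_nonpos hδ hδε (neg_nonpos.mpr (sq_nonneg γ))
  have hC := (conformalRadius_pos hD hsc hne (hxD (mem_closedBall_self hε.le))).le
  calc ∫ ω, (chaosDensity e a γ δ x ω - chaosDensity e a γ ε x ω) ^ 2 ∂P
      ≤ ∫ ω, (2 * chaosDensity e a γ δ x ω ^ 2 + 2 * chaosDensity e a γ ε x ω ^ 2) ∂P := by
        refine integral_mono hi ((i1.const_mul 2).add (i2.const_mul 2)) fun ω ↦ ?_
        simp only
        nlinarith [sq_nonneg (chaosDensity e a γ δ x ω + chaosDensity e a γ ε x ω)]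
    _ = 2 * (δ ^ (-γ ^ 2) * conformalRadius D x ^ (2 * γ ^ 2)) +
        2 * (ε ^ (-γ ^ 2) * conformalRadius D x ^ (2 * γ ^ 2)) := by
        rw [integral_add (i1.const_mul 2) (i2.const_mul 2), integral_const_mul, integral_const_mul,
          e1, e2]
    _ ≤ 2 * (δ ^ (-γ ^ 2) * conformalRadius D x ^ (2 * γ ^ 2)) +
        2 * (δ ^ (-γ ^ 2) * conformalRadius D x ^ (2 * γ ^ 2)) := by gcongr
    _ = _ := by ring

end FixedPoint
end Moments
end LiouvilleGFF

namespace LiouvilleGFF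

open Metric

/-! ### First and second moments of integrals of random functions -/

section RandomIntegral

variable {Ω : Type*} [MeasurableSpace Ω]

/-- On `A`, the random function `X` agrees with a jointly measurable one. -/
def JointlyMeasurableOn (A : Set ℂ) (X : ℂ → Ω → ℝ) : Prop :=
  ∃ H : ℂ × Ω → ℝ, Measurable H ∧ ∀ x ∈ A, ∀ ω, X x ω = H (x, ω)

theorem JointlyMeasurableOn.mono {A B : Set ℂ} {X : ℂ → Ω → ℝ} (h : JointlyMeasurableOn B X)
    (hAB : A ⊆ B) : JointlyMeasurableOn A X := by
  obtain ⟨H, hH, he⟩ := h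
  exact ⟨H, hH, fun x hx ↦ he x (hAB hx)⟩

theorem JointlyMeasurableOn.sub {A : Set ℂ} {X Y : ℂ → Ω → ℝ} (hX : JointlyMeasurableOn A X)
    (hY : JointlyMeasurableOn A Y) : JointlyMeasurableOn A fun x ω ↦ X x ω - Y x ω := by
  obtain ⟨H, hH, he⟩ := hX
  obtain ⟨H', hH', he'⟩ := hY
  exact ⟨fun p ↦ H p - H' p, hH.sub hH', fun x hx ω ↦ by
    simp only [he x hx, he' x hx]⟩

theorem JointlyMeasurableOn.const_mul_of_continuousOn {A : Set ℂ} {X : ℂ → Ω → ℝ}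
    (hX : JointlyMeasurableOn A X) (hA : MeasurableSet A) {g : ℂ → ℝ} (hg : ContinuousOn g A) :
    JointlyMeasurableOn A fun x ω ↦ g x * X x ω := by
  obtain ⟨H, hH, he⟩ := hX
  have hm : Measurable (A.indicator g) := by
    classical
    rw [← piecewise_eq_indicator]
    exact hg.measurable_piecewise continuousOn_const hA
  exact ⟨fun p ↦ A.indicator g p.1 * H p, (hm.comp measurable_fst).mul hH, fun x hx ω ↦ by
    simp only [he x hx, indicator_of_mem hx]⟩

variable {P : Measure Ω} [IsProbabilityMeasure P] {A : Set ℂ} {X : ℂ → Ω → ℝ}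

theorem integrable_prod_of_integral_abs_le (hA : MeasurableSet A) (hX : JointlyMeasurableOn A X)
    (hXi : ∀ x ∈ A, Integrable (X x) P) {b : ℂ → ℝ} (hb : IntegrableOn b A)
    (hXb : ∀ x ∈ A, ∫ ω, |X x ω| ∂P ≤ b x) :
    Integrable (Function.uncurry X) ((volume.restrict A).prod P) := by
  obtain ⟨H, hH, he⟩ := hX
  have hAe : ∀ᵐ x ∂(volume.restrict A), x ∈ A := ae_restrict_mem hA
  have h1 : Integrable H ((volume.restrict A).prod P) := by
    rw [integrable_prod_iff hH.aestronglyMeasurable]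
    constructor
    · filter_upwards [hAe] with x hx
      exact (hXi x hx).congr (.of_forall fun ω ↦ he x hx ω)
    · refine hb.mono' (hH.stronglyMeasurable.norm.integral_prod_right').aestronglyMeasurable ?_
      filter_upwards [hAe] with x hx
      rw [Real.norm_of_nonneg (integral_nonneg fun ω ↦ norm_nonneg _)]
      simpa only [Real.norm_eq_abs, he x hx] using hXb x hx
  refine h1.congr ?_
  have h2 : ∀ᵐ p : ℂ × Ω ∂((volume.restrict A).prod P), p.1 ∈ A :=
    Measure.quasiMeasurePreserving_fst.ae hAe
  filter_upwards [h2] with p hp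
  exact (he p.1 hp p.2).symm

theorem integral_abs_setIntegral_le (hA : MeasurableSet A) (hX : JointlyMeasurableOn A X)
    (hXi : ∀ x ∈ A, Integrable (X x) P) {b : ℂ → ℝ} (hb : IntegrableOn b A)
    (hXb : ∀ x ∈ A, ∫ ω, |X x ω| ∂P ≤ b x) :
    Integrable (fun ω ↦ ∫ x in A, X x ω) P ∧ ∫ ω, |∫ x in A, X x ω| ∂P ≤ ∫ x in A, b x := by
  have h1 := integrable_prod_of_integral_abs_le hA hX hXi hb hXb
  have h2 : Integrable (fun ω ↦ ∫ x in A, X x ω) P := h1.integral_prod_right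
  have h3 : Integrable (fun ω ↦ ∫ x in A, |X x ω|) P := h1.abs.integral_prod_right
  refine ⟨h2, ?_⟩
  calc ∫ ω, |∫ x in A, X x ω| ∂P ≤ ∫ ω, (∫ x in A, |X x ω|) ∂P :=
        integral_mono h2.abs h3 fun ω ↦ abs_integral_le_integral_abs
    _ = ∫ x in A, ∫ ω, |X x ω| ∂P := (integral_integral_swap h1.abs).symm
    _ ≤ ∫ x in A, b x := by
        refine setIntegral_mono_on h1.abs.integral_prod_left hb hA hXb

/-- Fubini's theorem on `A ×ˢ A`: only pairs within distance `η` contribute, each at most `M`, and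
they fill at most `volume A` times the area of a disc of radius `η`. -/
theorem integral_setIntegral_sq_le (hA : MeasurableSet A) (hAf : volume A ≠ ⊤)
    (hX : JointlyMeasurableOn A X) {M η : ℝ} (hM : 0 ≤ M) (hη : 0 ≤ η)
    (hXi : ∀ x ∈ A, Integrable (fun ω ↦ X x ω ^ 2) P) (hXM : ∀ x ∈ A, ∫ ω, X x ω ^ 2 ∂P ≤ M)
    (horth : ∀ x ∈ A, ∀ y ∈ A, η < ‖x - y‖ → ∫ ω, X x ω * X y ω ∂P = 0) :
    Integrable (fun ω ↦ (∫ x in A, X x ω) ^ 2) P ∧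
      ∫ ω, (∫ x in A, X x ω) ^ 2 ∂P ≤ M * (volume.real A * (Real.pi * η ^ 2)) := by
  wlog hXm : Measurable (Function.uncurry X) generalizing X
  · obtain ⟨H, hH, he⟩ := hX
    have h1 : ∀ ω, ∫ x in A, X x ω = ∫ x in A, H (x, ω) := fun ω ↦
      setIntegral_congr_fun hA fun x hx ↦ he x hx ω
    simp_rw [h1]
    refine this (X := fun x ω ↦ H (x, ω)) ⟨H, hH, fun _ _ _ ↦ rfl⟩ (fun x hx ↦ ?_) (fun x hx ↦ ?_)
      (fun x hx y hy hxy ↦ ?_) hH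
    · simpa only [he x hx] using hXi x hx
    · simpa only [he x hx] using hXM x hx
    · simpa only [he x hx, he y hy] using horth x hx y hy hxy
  set ν := (volume : Measure ℂ).restrict A with hν
  have hfin : IsFiniteMeasure ν := ⟨by rw [hν, Measure.restrict_apply_univ]; exact hAf.lt_top⟩
  have hmem : ∀ᵐ p ∂(ν.prod ν), p ∈ A ×ˢ A := by
    rw [hν, Measure.prod_restrict]
    exact ae_restrict_mem (hA.prod hA)
  have hL2 : ∀ x ∈ A, MemLp (X x) 2 P := fun x hx ↦
    (memLp_two_iff_integrable_sq (hXm.of_uncurry_left (x := x)).aestronglyMeasurable).mpr (hXi x hx)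
  have hbound : ∀ x ∈ A, ∀ y ∈ A, ∫ ω, |X x ω * X y ω| ∂P ≤ M := by
    intro x hx y hy
    calc ∫ ω, |X x ω * X y ω| ∂P ≤ ∫ ω, (1 / 2 * X x ω ^ 2 + 1 / 2 * X y ω ^ 2) ∂P := by
          refine integral_mono ((hL2 x hx).integrable_mul (hL2 y hy)).abs
            (((hXi x hx).const_mul _).add ((hXi y hy).const_mul _)) fun ω ↦ ?_
          simp only
          rw [abs_le]
          constructor <;> nlinarith [sq_nonneg (X x ω + X y ω), sq_nonneg (X x ω - X y ω)]
      _ = 1 / 2 * ∫ ω, X x ω ^ 2 ∂P + 1 / 2 * ∫ ω, X y ω ^ 2 ∂P := by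
          rw [integral_add ((hXi x hx).const_mul _) ((hXi y hy).const_mul _), integral_const_mul,
            integral_const_mul]
      _ ≤ M := by linarith [hXM x hx, hXM y hy]
  set F : (ℂ × ℂ) × Ω → ℝ := fun q ↦ X q.1.1 q.2 * X q.1.2 q.2 with hF
  have hFm : Measurable F :=
    (hXm.comp ((measurable_fst.comp measurable_fst).prodMk measurable_snd)).mul
      (hXm.comp ((measurable_snd.comp measurable_fst).prodMk measurable_snd))
  have hFi : Integrable F ((ν.prod ν).prod P) := by
    rw [integrable_prod_iff hFm.aestronglyMeasurable]
    constructor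
    · filter_upwards [hmem] with p hp
      exact (hL2 _ hp.1).integrable_mul (hL2 _ hp.2)
    · refine (integrable_const M).mono'
        (hFm.stronglyMeasurable.norm.integral_prod_right').aestronglyMeasurable ?_
      filter_upwards [hmem] with p hp
      rw [Real.norm_of_nonneg (integral_nonneg fun ω ↦ norm_nonneg _)]
      exact hbound _ hp.1 _ hp.2
  have hsq : ∀ ω, (∫ x, X x ω ∂ν) ^ 2 = ∫ p, F (p, ω) ∂(ν.prod ν) := fun ω ↦ by
    rw [sq, ← integral_prod_mul]
  simp_rw [hsq]
  refine ⟨hFi.integral_prod_right, ?_⟩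
  set S : Set (ℂ × ℂ) := {p | ‖p.1 - p.2‖ ≤ η} with hS
  have hSm : MeasurableSet S := measurableSet_le (by fun_prop) measurable_const
  calc ∫ ω, ∫ p, F (p, ω) ∂(ν.prod ν) ∂P
      = ∫ p, ∫ ω, F (p, ω) ∂P ∂(ν.prod ν) :=
        (integral_integral_swap (f := fun p ω ↦ F (p, ω)) hFi).symm
    _ ≤ ∫ p, S.indicator (fun _ ↦ M) p ∂(ν.prod ν) := by
        refine integral_mono_ae hFi.integral_prod_left ((integrable_const M).indicator hSm) ?_
        filter_upwards [hmem] with p hp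
        by_cases hpS : p ∈ S
        · rw [indicator_of_mem hpS]
          exact (integral_mono ((hL2 _ hp.1).integrable_mul (hL2 _ hp.2))
            ((hL2 _ hp.1).integrable_mul (hL2 _ hp.2)).abs fun ω ↦ le_abs_self _).trans
            (hbound _ hp.1 _ hp.2)
        · rw [indicator_of_notMem hpS]
          exact (horth _ hp.1 _ hp.2 (not_le.mp hpS)).le
    _ = (ν.prod ν).real S * M := by rw [integral_indicator_const _ hSm, smul_eq_mul]
    _ ≤ (volume.real A * (Real.pi * η ^ 2)) * M := by
        gcongr
        have h1 : (ν.prod ν) S ≤ ENNReal.ofReal (Real.pi * η ^ 2) * ν univ := by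
          rw [Measure.prod_apply hSm, ← lintegral_const]
          refine lintegral_mono fun x ↦ ?_
          have h2 : Prod.mk x ⁻¹' S ⊆ closedBall x η := by
            intro y hy
            rw [mem_closedBall, dist_comm, dist_eq_norm]
            exact hy
          calc ν (Prod.mk x ⁻¹' S) ≤ volume (closedBall x η) :=
                (measure_mono h2).trans (Measure.restrict_apply_le _ _)
            _ = ENNReal.ofReal (Real.pi * η ^ 2) := by
                rw [Complex.volume_closedBall, mul_comm, ENNReal.ofReal_mul Real.pi_pos.le,
                  ENNReal.ofReal_pow hη]
                congr 1
                exact (ENNReal.ofReal_coe_nnreal (p := NNReal.pi)).symm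
        rw [hν, Measure.restrict_apply_univ] at h1
        have h3 := ENNReal.toReal_mono (ENNReal.mul_ne_top ENNReal.ofReal_ne_top hAf) h1
        rw [ENNReal.toReal_mul, ENNReal.toReal_ofReal (by positivity)] at h3
        rw [mul_comm (volume.real A)]
        exact h3
    _ = _ := mul_comm _ _

/-- A root-free Cauchy–Schwarz inequality, from `|Y| ≤ Y ^ 2 / (2 * s) + s / 2`. -/
theorem integral_abs_le_of_integral_sq_le {Y : Ω → ℝ} (hY : AEStronglyMeasurable Y P)
    (hY2 : Integrable (fun ω ↦ Y ω ^ 2) P) {s : ℝ} (hs : 0 < s) (hYs : ∫ ω, Y ω ^ 2 ∂P ≤ s ^ 2) :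
    Integrable Y P ∧ ∫ ω, |Y ω| ∂P ≤ s := by
  have hYi : Integrable Y P := ((memLp_two_iff_integrable_sq hY).mpr hY2).integrable (by norm_num)
  refine ⟨hYi, ?_⟩
  calc ∫ ω, |Y ω| ∂P ≤ ∫ ω, ((2 * s)⁻¹ * Y ω ^ 2 + s / 2) ∂P := by
        refine integral_mono hYi.abs ((hY2.const_mul _).add (integrable_const _)) fun ω ↦ ?_
        simp only
        rw [← sq_abs (Y ω)]
        have h : (2 * s)⁻¹ * |Y ω| ^ 2 + s / 2 - |Y ω| = (2 * s)⁻¹ * (|Y ω| - s) ^ 2 := by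
          field_simp
          ring
        have : 0 ≤ (2 * s)⁻¹ * (|Y ω| - s) ^ 2 := by positivity
        linarith
    _ = (2 * s)⁻¹ * ∫ ω, Y ω ^ 2 ∂P + s / 2 := by
        rw [integral_add (hY2.const_mul _) (integrable_const _), integral_const_mul]
        simp
    _ ≤ (2 * s)⁻¹ * s ^ 2 + s / 2 := by gcongr
    _ = s := by field_simp; ring

end RandomIntegral

/-! ### A radial integral -/

theorem integrableOn_ball_rpow_norm_sub (z : ℂ) {d p : ℝ} (hp : p < 2) :
    IntegrableOn (fun x ↦ ‖x - z‖ ^ (-p)) (ball z d) ∧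
    (0 ≤ d → ∫ x in ball z d, ‖x - z‖ ^ (-p) = 2 * Real.pi * (d ^ (2 - p) / (2 - p))) := by
  set f : ℝ → ℝ := (Iio d).indicator fun r ↦ r ^ (-p) with hf
  have h1 : (ball z d).indicator (fun x ↦ ‖x - z‖ ^ (-p)) = fun x ↦ f ‖x - z‖ := by
    ext x
    simp only [hf, indicator, mem_ball_iff_norm, mem_Iio]
  have h2 : (Ioi (0 : ℝ)).indicator (fun r ↦ r * f r)
      = (Ioo 0 d).indicator fun r ↦ r ^ (1 - p) := by
    ext r
    simp only [hf, indicator, mem_Ioi, mem_Iio, mem_Ioo]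
    split_ifs with h3 h4 h5 h5 h5 <;> try tauto
    · rw [sub_eq_add_neg, Real.rpow_add h3, Real.rpow_one]
    · simp
  have h3 : IntegrableOn (fun r : ℝ ↦ r ^ (1 - p)) (Ioo 0 d) := by
    rcases le_or_gt d 0 with h | h
    · rw [Ioo_eq_empty (not_lt.mpr h)]
      exact integrableOn_empty
    · exact (intervalIntegral.integrableOn_Ioo_rpow_iff h).mpr (by linarith)
  constructor
  · rw [← integrable_indicator_iff measurableSet_ball, h1]
    refine integrable_radial.mpr ?_
    rw [← integrable_indicator_iff measurableSet_Ioi, h2,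
      integrable_indicator_iff measurableSet_Ioo]
    exact h3
  · intro hd
    rw [← integral_indicator measurableSet_ball, h1, integral_radial,
      ← integral_indicator measurableSet_Ioi, h2, integral_indicator measurableSet_Ioo,
      ← integral_Ioc_eq_integral_Ioo, ← intervalIntegral.integral_of_le hd,
      integral_rpow (Or.inl (by linarith)), Real.zero_rpow (by linarith)]
    ring_nf

end LiouvilleGFF

namespace LiouvilleGFF

open Metric

/-! ### Increments of the approximations of the rooted measure -/

/-- The weight `exp (γ² Gᶻ_ε(x))`. -/
noncomputable def rootWeight (D : Set ℂ) (γ : ℝ) (z : ℂ) (ε : ℝ) (x : ℂ) : ℝ :=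
  Real.exp (γ ^ 2 * greenReg D ε z x)

theorem rootWeight_eq (D : Set ℂ) (γ : ℝ) (z : ℂ) {ε : ℝ} (hε : 0 < ε) (x : ℂ) :
    rootWeight D γ z ε x
      = max ε ‖x - z‖ ^ (-γ ^ 2) * Real.exp (γ ^ 2 * greenCorrection D z x) := by
  have h : 0 < max ε ‖x - z‖ := lt_max_of_lt_left hε
  rw [rootWeight, greenReg, mul_add, Real.exp_add, norm_sub_rev z x, Real.rpow_def_of_pos h, one_div,
    Real.log_inv]
  congr 2
  ring

theorem rootWeight_of_le (D : Set ℂ) (γ : ℝ) (z : ℂ) {ε : ℝ} (hε : 0 < ε) {x : ℂ}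
    (h : ε ≤ ‖x - z‖) :
    rootWeight D γ z ε x = ‖x - z‖ ^ (-γ ^ 2) * Real.exp (γ ^ 2 * greenCorrection D z x) := by
  rw [rootWeight_eq D γ z hε, max_eq_right h]

theorem rootWeight_le (D : Set ℂ) (γ : ℝ) (z : ℂ) {ε : ℝ} (hε : 0 < ε) {x : ℂ} (hx : x ≠ z) :
    rootWeight D γ z ε x ≤ ‖x - z‖ ^ (-γ ^ 2) * Real.exp (γ ^ 2 * greenCorrection D z x) := by
  rw [rootWeight_eq D γ z hε]
  exact mul_le_mul_of_nonneg_right (Real.rpow_le_rpow_of_nonpos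
    (norm_pos_iff.mpr (sub_ne_zero.mpr hx)) (le_max_right _ _) (neg_nonpos.mpr (sq_nonneg γ)))
    (Real.exp_pos _).le

section Increments

variable {Ω : Type*} {D : Set ℂ} (e : HilbertBasis ℕ ℝ (H1 D)) (a : ℕ → Ω → ℝ) {γ : ℝ}
  {z : ℂ} {f : ℂ → ℝ}

theorem rootWeight_mul_chaosDensity (γ : ℝ) (z : ℂ) (ε : ℝ) (x : ℂ) (ω : Ω) :
    rootWeight D γ z ε x * chaosDensity e a γ ε x ω
      = ε ^ (γ ^ 2 / 2) * Real.exp (γ * rootedReg D e a γ z ε x ω) := by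
  rw [rootWeight, chaosDensity, rootedReg, mul_add, Real.exp_add]
  ring_nf

theorem continuousOn_rootWeight (hD : IsOpen D) (hsc : IsSimplyConnected D) (hne : D ≠ univ)
    (hz : z ∈ D) (γ : ℝ) {ε : ℝ} (hε : 0 < ε) : ContinuousOn (rootWeight D γ z ε) D := by
  obtain ⟨φ, hφ⟩ := exists_isConformalToDisc hD hsc hne hz
  have h1 := continuousOn_greenCorrection hD hz hφ
  have h2 : ContinuousOn (fun x ↦ max ε ‖x - z‖ ^ (-γ ^ 2)) D :=
    ContinuousOn.rpow_const (by fun_prop) fun x _ ↦ Or.inl (lt_max_of_lt_left hε).ne'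
  refine (h2.mul ((h1.const_mul (γ ^ 2)).rexp)).congr fun x _ ↦ rootWeight_eq D γ z hε x

theorem continuousOn_conformalRadius_rpow (hD : IsOpen D) (hsc : IsSimplyConnected D)
    (hne : D ≠ univ) (t : ℝ) : ContinuousOn (fun x ↦ conformalRadius D x ^ t) D := by
  obtain ⟨z, hz⟩ := hsc.nonempty
  obtain ⟨φ, hφ⟩ := exists_isConformalToDisc hD hsc hne hz
  exact (hφ.continuousOn_conformalRadius hD).rpow_const fun x hx ↦
    Or.inl (conformalRadius_pos hD hsc hne hx).ne'

/-- The first bound serves first moments. The second serves second moments: its factor `2 * C ^ (γ ^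
2)` is the square root of the `4 * C ^ (2 * γ ^ 2)` in `integral_chaosDensity_sub_sq_le`. The
constant is uniform in `ε`. -/
theorem exists_weight_bound (hD : IsOpen D) (hsc : IsSimplyConnected D) (hne : D ≠ univ)
    (hz : z ∈ D) (γ : ℝ) (hf : Continuous f) {K : Set ℂ} (hK : IsCompact K) (hKD : K ⊆ D) :
    ∃ B > 0, ∀ ε > 0, ∀ x ∈ K, x ≠ z →
      |f x| * rootWeight D γ z ε x * conformalRadius D x ^ (γ ^ 2 / 2) ≤ B * ‖x - z‖ ^ (-γ ^ 2) ∧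
      |f x| * rootWeight D γ z ε x * (2 * conformalRadius D x ^ (γ ^ 2))
        ≤ B * ‖x - z‖ ^ (-γ ^ 2) := by
  obtain ⟨φ, hφ⟩ := exists_isConformalToDisc hD hsc hne hz
  have h1 := ((continuousOn_greenCorrection hD hz hφ).const_mul (γ ^ 2)).rexp
  have h2 := continuousOn_conformalRadius_rpow hD hsc hne (γ ^ 2 / 2)
  have h3 := continuousOn_conformalRadius_rpow hD hsc hne (γ ^ 2)
  obtain ⟨B₁, hB₁⟩ := hK.exists_bound_of_continuousOn
    (((hf.continuousOn.abs.mul h1).mul h2).mono hKD)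
  obtain ⟨B₂, hB₂⟩ := hK.exists_bound_of_continuousOn
    (((hf.continuousOn.abs.mul h1).mul (h3.const_mul 2)).mono hKD)
  refine ⟨max 1 (max B₁ B₂), lt_max_of_lt_left one_pos, fun ε hε x hx hxz ↦ ?_⟩
  have hw := rootWeight_le D γ z hε hxz
  have hC := conformalRadius_pos hD hsc hne (hKD hx)
  have key : ∀ c, 0 ≤ c → |f x| * Real.exp (γ ^ 2 * greenCorrection D z x) * c
      ≤ max 1 (max B₁ B₂) → |f x| * rootWeight D γ z ε x * c
        ≤ max 1 (max B₁ B₂) * ‖x - z‖ ^ (-γ ^ 2) := by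
    intro c hc h
    calc |f x| * rootWeight D γ z ε x * c
        ≤ |f x| * (‖x - z‖ ^ (-γ ^ 2) * Real.exp (γ ^ 2 * greenCorrection D z x)) * c := by gcongr
      _ = (|f x| * Real.exp (γ ^ 2 * greenCorrection D z x) * c) * ‖x - z‖ ^ (-γ ^ 2) := by ring
      _ ≤ _ := by gcongr
  refine ⟨key _ (by positivity) ?_, key _ (by positivity) ?_⟩
  · exact ((le_abs_self _).trans (hB₁ x hx)).trans ((le_max_left _ _).trans (le_max_right _ _))
  · exact ((le_abs_self _).trans (hB₂ x hx)).trans ((le_max_right _ _).trans (le_max_right _ _))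

/-- The integrand of the integral of `f` against the approximation of the rooted measure. -/
noncomputable def rootedIntegrand (γ : ℝ) (z : ℂ) (f : ℂ → ℝ) (ε : ℝ) (x : ℂ) (ω : Ω) : ℝ :=
  f x * rootWeight D γ z ε x * chaosDensity e a γ ε x ω

variable [MeasurableSpace Ω] {P : Measure Ω} [IsProbabilityMeasure P]

theorem jointlyMeasurableOn_rootedIntegrand (hD : IsOpen D) (hsc : IsSimplyConnected D)
    (hne : D ≠ univ) (ha : ∀ n, Measurable (a n)) (hz : z ∈ D) (γ : ℝ) (hf : Continuous f)
    {ε : ℝ} (hε : 0 < ε) : JointlyMeasurableOn D (rootedIntegrand e a γ z f ε) :=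
  JointlyMeasurableOn.const_mul_of_continuousOn (measurable_chaosDensity e a hD hsc hne ha γ ε)
    hD.measurableSet
    (hf.continuousOn.mul (continuousOn_rootWeight hD hsc hne hz γ hε))

variable {a}

theorem integral_rootedIntegrand (hD : IsOpen D) (hsc : IsSimplyConnected D) (hne : D ≠ univ)
    (ha : ∀ n, Measurable (a n)) (hlaw : ∀ n, HasLaw (a n) (gaussianReal 0 1) P)
    (hind : iIndepFun a P) {ε : ℝ} (hε : 0 < ε) {x : ℂ} (hx : closedBall x ε ⊆ D) :
    Integrable (rootedIntegrand e a γ z f ε x) P ∧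
    ∫ ω, rootedIntegrand e a γ z f ε x ω ∂P
      = f x * rootWeight D γ z ε x * conformalRadius D x ^ (γ ^ 2 / 2) ∧
    ∫ ω, |rootedIntegrand e a γ z f ε x ω| ∂P
      = |f x| * rootWeight D γ z ε x * conformalRadius D x ^ (γ ^ 2 / 2) := by
  obtain ⟨h1, h2⟩ := integral_chaosDensity e hD hsc hne ha hlaw hind hε hx γ
  refine ⟨h1.const_mul _, ?_, ?_⟩
  · simp only [rootedIntegrand]
    rw [integral_const_mul, h2]
  · have h3 : ∀ ω, |rootedIntegrand e a γ z f ε x ω|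
        = |f x| * rootWeight D γ z ε x * chaosDensity e a γ ε x ω := fun ω ↦ by
      rw [rootedIntegrand, abs_mul, abs_mul, abs_of_nonneg (chaosDensity_nonneg e a γ hε x ω),
        abs_of_nonneg (a := rootWeight D γ z ε x) (Real.exp_pos _).le]
    simp_rw [h3]
    rw [integral_const_mul, h2]

theorem integrableOn_rpow_of_isCompact (hγ : γ ^ 2 < 2) {K : Set ℂ} (hK : IsCompact K) (B : ℝ) :
    IntegrableOn (fun x ↦ B * ‖x - z‖ ^ (-γ ^ 2)) K := by
  obtain ⟨d, hd⟩ := hK.isBounded.subset_ball z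
  exact ((integrableOn_ball_rpow_norm_sub z hγ).1.mono_set hd).const_mul B

/-- The integral of `f` against the approximation of the rooted measure. -/
noncomputable def rootedIntegral (e : HilbertBasis ℕ ℝ (H1 D)) (a : ℕ → Ω → ℝ) (γ : ℝ) (z : ℂ)
    (f : ℂ → ℝ) (ε : ℝ) (ω : Ω) : ℝ :=
  -- The root is removed because for `γ ≠ 0` the bound `‖x - z‖ ^ (-γ ^ 2)` takes the default value
  -- `0` there.
  ∫ x in tsupport f \ {z}, rootedIntegrand e a γ z f ε x ω

theorem exists_radius (hD : IsOpen D) {K : Set ℂ} (hK : IsCompact K) (hKD : K ⊆ D) :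
    ∃ r > 0, ∀ x ∈ K, closedBall x r ⊆ D := by
  obtain ⟨r, hr, h⟩ := hK.exists_cthickening_subset_open hD hKD
  exact ⟨r, hr, fun x hx ↦ (closedBall_subset_cthickening hx r).trans h⟩

theorem integral_rootedIntegral (hD : IsOpen D) (hsc : IsSimplyConnected D) (hne : D ≠ univ)
    (ha : ∀ n, Measurable (a n)) (hlaw : ∀ n, HasLaw (a n) (gaussianReal 0 1) P)
    (hind : iIndepFun a P) (hz : z ∈ D) (hγ : γ ^ 2 < 2) (hf : Continuous f)
    (hfc : HasCompactSupport f) (hfD : tsupport f ⊆ D) {ε : ℝ} (hε : 0 < ε)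
    (hεD : ∀ x ∈ tsupport f, closedBall x ε ⊆ D) :
    Integrable (Function.uncurry (rootedIntegrand e a γ z f ε))
      ((volume.restrict (tsupport f \ {z})).prod P) ∧
    Integrable (rootedIntegral e a γ z f ε) P ∧
    ∫ ω, rootedIntegral e a γ z f ε ω ∂P
      = ∫ x in tsupport f \ {z}, f x * rootWeight D γ z ε x * conformalRadius D x ^ (γ ^ 2 / 2) := by
  obtain ⟨B, hB0, hB⟩ := exists_weight_bound hD hsc hne hz γ hf hfc hfD
  have hAm : MeasurableSet (tsupport f \ {z}) :=
    (isClosed_tsupport f).measurableSet.diff (measurableSet_singleton z)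
  have hAK : tsupport f \ {z} ⊆ tsupport f := sdiff_subset
  have h1 : Integrable (Function.uncurry (rootedIntegrand e a γ z f ε))
      ((volume.restrict (tsupport f \ {z})).prod P) := by
    refine integrable_prod_of_integral_abs_le hAm
      ((jointlyMeasurableOn_rootedIntegrand e a hD hsc hne ha hz γ hf hε).mono (hAK.trans hfD))
      (fun x hx ↦ (integral_rootedIntegrand e hD hsc hne ha hlaw hind hε (hεD x (hAK hx))).1)
      ((integrableOn_rpow_of_isCompact (z := z) hγ hfc B).mono_set hAK) fun x hx ↦ ?_
    rw [(integral_rootedIntegrand e hD hsc hne ha hlaw hind hε (hεD x (hAK hx))).2.2]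
    exact (hB ε hε x (hAK hx) hx.2).1
  refine ⟨h1, h1.integral_prod_right, ?_⟩
  simp only [rootedIntegral]
  rw [← integral_integral_swap h1]
  refine setIntegral_congr_fun hAm fun x hx ↦ ?_
  exact (integral_rootedIntegrand e hD hsc hne ha hlaw hind hε (hεD x (hAK hx))).2.1

/-- Within distance `d` of the root both integrals are bounded in mean, since the second moment
could be infinite in the limit. Farther away the second moment is used, with a gain of `ε` from
decorrelation beyond distance `2 * ε`. -/
theorem exists_increment_bound (hD : IsOpen D) (hsc : IsSimplyConnected D) (hne : D ≠ univ)
    (ha : ∀ n, Measurable (a n)) (hlaw : ∀ n, HasLaw (a n) (gaussianReal 0 1) P)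
    (hind : iIndepFun a P) (hz : z ∈ D) (hγ : γ ^ 2 < 2) (hf : Continuous f)
    (hfc : HasCompactSupport f) (hfD : tsupport f ⊆ D) :
    ∃ A : ℝ, ∀ δ ε d : ℝ, 0 < δ → δ ≤ ε → ε ≤ d → (∀ x ∈ tsupport f, closedBall x ε ⊆ D) →
      ∫ ω, |rootedIntegral e a γ z f δ ω - rootedIntegral e a γ z f ε ω| ∂P
        ≤ A * (d ^ (2 - γ ^ 2) + d ^ (-γ ^ 2) * δ ^ (-(γ ^ 2 / 2)) * ε) := by
  obtain ⟨B, hB0, hB⟩ := exists_weight_bound hD hsc hne hz γ hf hfc hfD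
  set K := tsupport f with hKdef
  set V := volume.real K with hV
  set q := Real.sqrt ((V + 1) * Real.pi) with hq
  have hV0 : 0 ≤ V := measureReal_nonneg
  have hq0 : 0 < q := Real.sqrt_pos.mpr (by positivity)
  have hg2 : 0 < 2 - γ ^ 2 := by linarith
  set A₁ := 2 * (B * (2 * Real.pi * (1 / (2 - γ ^ 2)))) with hA₁
  set A₂ := 2 * B * q with hA₂
  have hA₁0 : 0 ≤ A₁ := by positivity
  have hA₂0 : 0 ≤ A₂ := by positivity
  refine ⟨A₁ + A₂, fun δ ε d hδ hδε hεd hεD ↦ ?_⟩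
  have hε := hδ.trans_le hδε
  have hd := hε.trans_le hεd
  have hδD : ∀ x ∈ K, closedBall x δ ⊆ D := fun x hx ↦
    (closedBall_subset_closedBall hδε).trans (hεD x hx)
  have hKm : MeasurableSet K := (isClosed_tsupport f).measurableSet
  have hSm : MeasurableSet (K \ {z}) := hKm.diff (measurableSet_singleton z)
  set K₁ := (K \ {z}) ∩ ball z d with hK₁
  set K₂ := (K \ {z}) \ ball z d with hK₂
  have hK₁m : MeasurableSet K₁ := hSm.inter measurableSet_ball
  have hK₂m : MeasurableSet K₂ := hSm.diff measurableSet_ball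
  have hK₁K : K₁ ⊆ K := fun x hx ↦ hx.1.1
  have hK₂K : K₂ ⊆ K := fun x hx ↦ hx.1.1
  have hfirst : ∀ s, 0 < s → (∀ x ∈ K, closedBall x s ⊆ D) →
      Integrable (fun ω ↦ ∫ x in K₁, rootedIntegrand e a γ z f s x ω) P ∧
      ∫ ω, |∫ x in K₁, rootedIntegrand e a γ z f s x ω| ∂P
        ≤ B * (2 * Real.pi * (1 / (2 - γ ^ 2))) * d ^ (2 - γ ^ 2) := by
    intro s hs hsD
    have h := integral_abs_setIntegral_le (P := P) hK₁m
      ((jointlyMeasurableOn_rootedIntegrand e a hD hsc hne ha hz γ hf hs).mono (hK₁K.trans hfD))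
      (fun x hx ↦ (integral_rootedIntegrand e hD hsc hne ha hlaw hind hs (hsD x (hK₁K hx))).1)
      ((integrableOn_rpow_of_isCompact hγ hfc B).mono_set hK₁K) fun x hx ↦ by
        rw [(integral_rootedIntegrand e hD hsc hne ha hlaw hind hs (hsD x (hK₁K hx))).2.2]
        exact (hB s hs x (hK₁K hx) hx.1.2).1
    refine ⟨h.1, h.2.trans ?_⟩
    have h2 := integrableOn_ball_rpow_norm_sub z (d := d) hγ
    calc ∫ x in K₁, B * ‖x - z‖ ^ (-γ ^ 2) ≤ ∫ x in ball z d, B * ‖x - z‖ ^ (-γ ^ 2) := by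
          refine setIntegral_mono_set (h2.1.const_mul B) (.of_forall fun x ↦ ?_)
            (LE.le.eventuallyLE inter_subset_right)
          simp only [Pi.zero_apply]
          positivity
      _ = _ := by
          rw [integral_const_mul, h2.2 hd.le]
          ring
  have hsecond : Integrable (fun ω ↦ ∫ x in K₂,
        (rootedIntegrand e a γ z f δ x ω - rootedIntegrand e a γ z f ε x ω)) P ∧
      ∫ ω, |∫ x in K₂, (rootedIntegrand e a γ z f δ x ω - rootedIntegrand e a γ z f ε x ω)| ∂P
        ≤ A₂ * (d ^ (-γ ^ 2) * δ ^ (-(γ ^ 2 / 2)) * ε) := by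
    have hfar : ∀ x ∈ K₂, d ≤ ‖x - z‖ := fun x hx ↦ by
      have := hx.2
      rwa [mem_ball_iff_norm, not_lt] at this
    -- Both radii are at most `d`, so the two weights coincide here and only the density changes.
    have hX : ∀ x ∈ K₂, ∀ ω, rootedIntegrand e a γ z f δ x ω - rootedIntegrand e a γ z f ε x ω
        = f x * rootWeight D γ z ε x *
          (chaosDensity e a γ δ x ω - chaosDensity e a γ ε x ω) := by
      intro x hx ω
      have h1 := hfar x hx
      rw [rootedIntegrand, rootedIntegrand, rootWeight_of_le D γ z hε (hεd.trans h1),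
        rootWeight_of_le D γ z hδ ((hδε.trans hεd).trans h1)]
      ring
    set M := (B * d ^ (-γ ^ 2)) ^ 2 * δ ^ (-γ ^ 2) with hM
    have hM0 : 0 ≤ M := by positivity
    have hjm := (((jointlyMeasurableOn_rootedIntegrand e a hD hsc hne ha hz γ hf hδ).sub
      (jointlyMeasurableOn_rootedIntegrand e a hD hsc hne ha hz γ hf hε)).mono (hK₂K.trans hfD))
    have hK₂f : volume K₂ ≠ ⊤ := ((measure_mono hK₂K).trans_lt hfc.measure_lt_top).ne
    have hsq := integral_setIntegral_sq_le (P := P) hK₂m hK₂f hjm hM0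
      (by positivity : 0 ≤ 2 * ε) (fun x hx ↦ ?_) (fun x hx ↦ ?_) (fun x hx y hy hxy ↦ ?_)
    · have hm : AEStronglyMeasurable (fun ω ↦ ∫ x in K₂,
          (rootedIntegrand e a γ z f δ x ω - rootedIntegrand e a γ z f ε x ω)) P := by
        obtain ⟨H, hHm, hH⟩ := hjm
        have h1 : ∀ ω, ∫ x in K₂, (rootedIntegrand e a γ z f δ x ω -
            rootedIntegrand e a γ z f ε x ω) = ∫ x in K₂, H (x, ω) := fun ω ↦
          setIntegral_congr_fun hK₂m fun x hx ↦ hH x hx ω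
        simp_rw [h1]
        exact (hHm.stronglyMeasurable.integral_prod_left').aestronglyMeasurable
      refine integral_abs_le_of_integral_sq_le hm hsq.1 (by positivity) (hsq.2.trans ?_)
      -- `A₂ = 2 * B * q` with `q ^ 2 = (V + 1) * π` is made for this identity; `V + 1` in place of
      -- `V` keeps the bound positive.
      have h1 : (A₂ * (d ^ (-γ ^ 2) * δ ^ (-(γ ^ 2 / 2)) * ε)) ^ 2
          = M * ((V + 1) * (Real.pi * (2 * ε) ^ 2)) := by
        have h2 : (δ ^ (-(γ ^ 2 / 2))) ^ 2 = δ ^ (-γ ^ 2) := by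
          rw [← Real.rpow_mul_natCast hδ.le]
          congr 1
          push_cast
          ring
        have h3 : q ^ 2 = (V + 1) * Real.pi := Real.sq_sqrt (by positivity)
        rw [hM, hA₂]
        simp only [mul_pow]
        rw [h2, h3]
        ring
      rw [h1]
      have h4 : volume.real K₂ ≤ V + 1 :=
        (measureReal_mono hK₂K hfc.measure_lt_top.ne).trans (by linarith)
      gcongr
    · simp_rw [hX x hx, mul_pow]
      exact (integral_chaosDensity_sub_sq_le e hD hsc hne ha hlaw hind hδ hδε
        (hεD x (hK₂K hx)) γ).1.const_mul _
    · simp_rw [hX x hx, mul_pow]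
      rw [integral_const_mul]
      have h1 := (integral_chaosDensity_sub_sq_le e hD hsc hne ha hlaw hind hδ hδε
        (hεD x (hK₂K hx)) γ).2
      have h2 := (hB ε hε x (hK₂K hx) hx.1.2).2
      have hC := (conformalRadius_pos hD hsc hne (hfD (hK₂K hx))).le
      have hw : 0 ≤ rootWeight D γ z ε x := (Real.exp_pos _).le
      have h3 : B * ‖x - z‖ ^ (-γ ^ 2) ≤ B * d ^ (-γ ^ 2) := by
        have := Real.rpow_le_rpow_of_nonpos hd (hfar x hx) (neg_nonpos.mpr (sq_nonneg γ))
        gcongr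
      have h4 : conformalRadius D x ^ (2 * γ ^ 2) = (conformalRadius D x ^ (γ ^ 2)) ^ 2 := by
        rw [← Real.rpow_mul_natCast hC]
        congr 1
        push_cast
        ring
      calc f x ^ 2 * rootWeight D γ z ε x ^ 2 *
            ∫ ω, (chaosDensity e a γ δ x ω - chaosDensity e a γ ε x ω) ^ 2 ∂P
          ≤ f x ^ 2 * rootWeight D γ z ε x ^ 2 *
            (4 * δ ^ (-γ ^ 2) * conformalRadius D x ^ (2 * γ ^ 2)) := by gcongr
        _ = (|f x| * rootWeight D γ z ε x * (2 * conformalRadius D x ^ (γ ^ 2))) ^ 2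
            * δ ^ (-γ ^ 2) := by
            rw [h4, ← sq_abs (f x)]
            ring
        _ ≤ M := by
            have h5 := h2.trans h3
            rw [hM]
            exact mul_le_mul_of_nonneg_right (pow_le_pow_left₀ (by positivity) h5 2) (by positivity)
    · simp_rw [hX x hx, hX y hy]
      have h1 := integral_chaosDensity_sub_mul_sub e hD hsc hne ha hlaw hind hδ hδε
        (hεD x (hK₂K hx)) (hεD y (hK₂K hy)) hxy γ
      calc _ = ∫ ω, (f x * rootWeight D γ z ε x * (f y * rootWeight D γ z ε y)) *
            ((chaosDensity e a γ δ x ω - chaosDensity e a γ ε x ω) *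
            (chaosDensity e a γ δ y ω - chaosDensity e a γ ε y ω)) ∂P :=
            integral_congr_ae (.of_forall fun ω ↦ by ring)
        _ = 0 := by rw [integral_const_mul, h1, mul_zero]
  have hiδ := (integral_rootedIntegral e hD hsc hne ha hlaw hind hz hγ hf hfc hfD hδ hδD)
  have hiε := (integral_rootedIntegral e hD hsc hne ha hlaw hind hz hγ hf hfc hfD hε hεD)
  obtain ⟨i1, b1⟩ := hfirst δ hδ hδD
  obtain ⟨i2, b2⟩ := hfirst ε hε hεD
  obtain ⟨i3, b3⟩ := hsecond
  have hsplit : ∀ᵐ ω ∂P, |rootedIntegral e a γ z f δ ω - rootedIntegral e a γ z f ε ω|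
      ≤ |∫ x in K₁, rootedIntegrand e a γ z f δ x ω| + |∫ x in K₁, rootedIntegrand e a γ z f ε x ω|
        + |∫ x in K₂, (rootedIntegrand e a γ z f δ x ω - rootedIntegrand e a γ z f ε x ω)| := by
    filter_upwards [hiδ.1.prod_left_ae, hiε.1.prod_left_ae] with ω h1 h2
    have h1' : IntegrableOn (fun x ↦ rootedIntegrand e a γ z f δ x ω) (K \ {z}) := h1
    have h2' : IntegrableOn (fun x ↦ rootedIntegrand e a γ z f ε x ω) (K \ {z}) := h2
    rw [rootedIntegral, rootedIntegral, ← hKdef, ← integral_inter_add_sdiff measurableSet_ball h1',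
      ← integral_inter_add_sdiff measurableSet_ball h2',
      integral_sub (h1'.mono_set sdiff_subset) (h2'.mono_set sdiff_subset)]
    rw [show ∀ p q r s : ℝ, p + q - (r + s) = p - r + (q - s) from fun _ _ _ _ ↦ by ring]
    refine (abs_add_le _ _).trans ?_
    gcongr
    exact abs_sub _ _
  calc ∫ ω, |rootedIntegral e a γ z f δ ω - rootedIntegral e a γ z f ε ω| ∂P
      ≤ ∫ ω, (|∫ x in K₁, rootedIntegrand e a γ z f δ x ω|
        + |∫ x in K₁, rootedIntegrand e a γ z f ε x ω|
        + |∫ x in K₂, (rootedIntegrand e a γ z f δ x ω - rootedIntegrand e a γ z f ε x ω)|) ∂P :=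
        integral_mono_ae (hiδ.2.1.sub hiε.2.1).abs ((i1.abs.add i2.abs).add i3.abs) hsplit
    _ ≤ A₁ * d ^ (2 - γ ^ 2) + A₂ * (d ^ (-γ ^ 2) * δ ^ (-(γ ^ 2 / 2)) * ε) := by
        have i12 : Integrable (fun ω ↦ |∫ x in K₁, rootedIntegrand e a γ z f δ x ω|
          + |∫ x in K₁, rootedIntegrand e a γ z f ε x ω|) P := i1.abs.add i2.abs
        rw [integral_add i12 i3.abs, integral_add i1.abs i2.abs, hA₁]
        linarith
    _ ≤ _ := by
        have h1 : 0 ≤ d ^ (2 - γ ^ 2) := by positivity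
        have h2 : 0 ≤ d ^ (-γ ^ 2) * δ ^ (-(γ ^ 2 / 2)) * ε := by positivity
        nlinarith [mul_nonneg hA₁0 h2, mul_nonneg hA₂0 h1]

end Increments
end LiouvilleGFF

namespace LiouvilleGFF

open Metric

/-! ### Convergence of the integrals of a test function -/

section Sequences

variable {Ω : Type*} [MeasurableSpace Ω] {P : Measure Ω}

theorem ae_summable_and_integrable_tsum {F : ℕ → Ω → ℝ} (hF : ∀ i, Integrable (F i) P)
    (hs : Summable fun i ↦ ∫ ω, ‖F i ω‖ ∂P) :
    (∀ᵐ ω ∂P, Summable fun i ↦ F i ω) ∧ Integrable (fun ω ↦ ∑' i, F i ω) P := by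
  have h1 : ∫⁻ ω, ∑' i, ‖F i ω‖ₑ ∂P ≠ ⊤ := by
    rw [lintegral_tsum fun i ↦ (hF i).1.enorm]
    simp_rw [← ofReal_integral_norm_eq_lintegral_enorm (hF _)]
    rw [← ENNReal.ofReal_tsum_of_nonneg (fun i ↦ integral_nonneg fun _ ↦ norm_nonneg _) hs]
    exact ENNReal.ofReal_ne_top
  have h2 : ∀ᵐ ω ∂P, Summable fun i ↦ ‖F i ω‖ := by
    filter_upwards [ae_lt_top' (AEMeasurable.tsum fun i ↦ (hF i).1.enorm) h1] with ω hω
    have h3 : ∑' i, ((‖F i ω‖₊ : NNReal) : ENNReal) ≠ ⊤ := hω.ne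
    exact NNReal.summable_coe.mpr (ENNReal.tsum_coe_ne_top_iff_summable.mp h3)
  have h3 : ∀ᵐ ω ∂P, Summable fun i ↦ F i ω := h2.mono fun ω h ↦ h.of_norm
  refine ⟨h3, ?_, ?_⟩
  · refine aestronglyMeasurable_of_tendsto_ae atTop (f := fun N ω ↦ ∑ i ∈ Finset.range N, F i ω)
      (fun N ↦ Finset.aestronglyMeasurable_fun_sum _ fun i _ ↦ (hF i).1) ?_
    filter_upwards [h3] with ω h
    exact h.hasSum.tendsto_sum_nat
  · refine lt_of_le_of_lt (lintegral_mono_ae ?_) h1.lt_top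
    filter_upwards [h2] with ω h
    have h4 : ∑' i, ‖F i ω‖ₑ = ENNReal.ofReal (∑' i, ‖F i ω‖) := by
      rw [ENNReal.ofReal_tsum_of_nonneg (fun i ↦ norm_nonneg _) h]
      simp_rw [ofReal_norm]
    rw [h4, ← ofReal_norm]
    exact ENNReal.ofReal_le_ofReal (norm_tsum_le_tsum_norm h)

/-- Telescoping: summable `L¹` norms of the increments give almost sure convergence and convergence
of the means together. -/
theorem exists_limit_of_summable_increments {Y : ℕ → Ω → ℝ} (hY : ∀ k, Integrable (Y k) P)
    (hs : Summable fun k ↦ ∫ ω, |Y (k + 1) ω - Y k ω| ∂P) :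
    ∃ L : Ω → ℝ, Integrable L P ∧ (∀ᵐ ω ∂P, Tendsto (fun k ↦ Y k ω) atTop (𝓝 (L ω))) ∧
      Tendsto (fun k ↦ ∫ ω, Y k ω ∂P) atTop (𝓝 (∫ ω, L ω ∂P)) := by
  set F : ℕ → Ω → ℝ := fun k ω ↦ Y (k + 1) ω - Y k ω with hF
  have hFi : ∀ k, Integrable (F k) P := fun k ↦ (hY (k + 1)).sub (hY k)
  obtain ⟨h1, h2⟩ := ae_summable_and_integrable_tsum hFi hs
  have hsum : ∀ k ω, Y k ω = Y 0 ω + ∑ i ∈ Finset.range k, F i ω := fun k ω ↦ by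
    rw [Finset.sum_range_sub (fun k ↦ Y k ω)]
    ring
  refine ⟨fun ω ↦ Y 0 ω + ∑' i, F i ω, (hY 0).add h2, ?_, ?_⟩
  · filter_upwards [h1] with ω h
    exact (h.hasSum.tendsto_sum_nat.const_add _).congr fun k ↦ (hsum k ω).symm
  · have h3 := (hasSum_integral_of_summable_integral_norm hFi hs).tendsto_sum_nat
    rw [integral_add (hY 0) h2]
    refine (h3.const_add (∫ ω, Y 0 ω ∂P)).congr fun k ↦ ?_
    rw [integral_congr_ae (.of_forall (hsum k)), integral_add (hY 0) (integrable_finsetSum _ fun i _ ↦ hFi i),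
      integral_finsetSum _ fun i _ ↦ hFi i]

end Sequences

/-- Take `d = ε ^ β` with `β = (2 - g) / 8`, `g = γ ^ 2`. The two terms decay like powers of `ε`
with exponents `β * (2 - g)` and `1 - g / 2 - β * g = (2 - g) * (4 - g) / 8`, both positive. The
condition `β ≤ 1` ensures `ε ≤ d`. -/
theorem summable_increment_rate {γ : ℝ} (hγ : γ ^ 2 < 2) :
    ∃ β : ℝ, 0 ≤ β ∧ β ≤ 1 ∧ Summable fun k : ℕ ↦
      (((2 : ℝ)⁻¹ ^ k) ^ β) ^ (2 - γ ^ 2) + (((2 : ℝ)⁻¹ ^ k) ^ β) ^ (-γ ^ 2)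
        * ((2 : ℝ)⁻¹ ^ (k + 1)) ^ (-(γ ^ 2 / 2)) * (2 : ℝ)⁻¹ ^ k := by
  have hg := sq_nonneg γ
  set g := γ ^ 2
  have hgeom : ∀ p : ℝ, 0 < p → Summable fun k : ℕ ↦ ((2 : ℝ)⁻¹ ^ p) ^ k := fun p hp ↦
    summable_geometric_of_lt_one (by positivity)
      (Real.rpow_lt_one (by norm_num) (by norm_num) hp)
  have hpow : ∀ (p : ℝ) (k : ℕ), ((2 : ℝ)⁻¹ ^ k) ^ p = ((2 : ℝ)⁻¹ ^ p) ^ k := fun p k ↦ by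
    rw [← Real.rpow_natCast, ← Real.rpow_natCast, ← Real.rpow_mul (by norm_num),
      ← Real.rpow_mul (by norm_num), mul_comm]
  refine ⟨(2 - g) / 8, by linarith, by linarith, Summable.add ?_ ?_⟩
  · refine (hgeom ((2 - g) / 8 * (2 - g)) (by nlinarith)).congr fun k ↦ ?_
    rw [← Real.rpow_mul (by positivity), hpow]
  · refine ((hgeom ((2 - g) / 8 * (-g) + (-(g / 2)) + 1) (by nlinarith)).mul_left
      ((2 : ℝ)⁻¹ ^ (-(g / 2)))).congr fun k ↦ ?_
    have h1 : (0 : ℝ) < 2⁻¹ := by norm_num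
    rw [← hpow, Real.rpow_add (by positivity), Real.rpow_add (by positivity), Real.rpow_one,
      ← Real.rpow_mul (by positivity), pow_succ, Real.mul_rpow (by positivity) h1.le]
    ring

theorem isOpen_setOf_closedBall_subset {D : Set ℂ} (hD : IsOpen D) (ε : ℝ) :
    IsOpen {x : ℂ | closedBall x ε ⊆ D} := by
  rw [Metric.isOpen_iff]
  intro x hx
  obtain ⟨ε', hε', h⟩ := exists_lt_closedBall_subset hD hx
  refine ⟨ε' - ε, by linarith, fun y hy ↦ (closedBall_subset_closedBall' ?_).trans h⟩
  have := mem_ball.mp hy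
  linarith

section Convergence

variable {Ω : Type*} {D : Set ℂ} (e : HilbertBasis ℕ ℝ (H1 D)) {a : ℕ → Ω → ℝ} {γ : ℝ}
  {z : ℂ} {f : ℂ → ℝ}

/-- The density of the mean of the rooted measure. -/
noncomputable def meanDensity (D : Set ℂ) (γ : ℝ) (z x : ℂ) : ℝ :=
  ‖x - z‖ ^ (-γ ^ 2) * Real.exp (γ ^ 2 * greenCorrection D z x) *
    conformalRadius D x ^ (γ ^ 2 / 2)

variable [MeasurableSpace Ω] {P : Measure Ω} [IsProbabilityMeasure P]

theorem measurable_density_rootedApprox (hD : IsOpen D) (hsc : IsSimplyConnected D)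
    (hne : D ≠ univ) (ha : ∀ n, Measurable (a n)) (hz : z ∈ D) (γ : ℝ) {ε : ℝ} (hε : 0 < ε) (ω : Ω) :
    AEMeasurable (fun x ↦ ε ^ (γ ^ 2 / 2) * Real.exp (γ * rootedReg D e a γ z ε x ω))
      (volume.restrict {x : ℂ | closedBall x ε ⊆ D}) := by
  obtain ⟨H, hHm, hH⟩ := measurable_chaosDensity e a hD hsc hne ha γ ε
  have hUm := (isOpen_setOf_closedBall_subset hD ε).measurableSet
  have hUD : {x : ℂ | closedBall x ε ⊆ D} ⊆ D := fun x hx ↦ hx (mem_closedBall_self hε.le)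
  have h1 : AEMeasurable (rootWeight D γ z ε) (volume.restrict {x : ℂ | closedBall x ε ⊆ D}) :=
    ((continuousOn_rootWeight hD hsc hne hz γ hε).mono hUD).aemeasurable hUm
  have h2 : Measurable fun x ↦ H (x, ω) := hHm.comp measurable_prodMk_right
  refine (h1.mul h2.aemeasurable).congr ?_
  filter_upwards [ae_restrict_mem hUm] with x hx
  rw [← rootWeight_mul_chaosDensity, Pi.mul_apply, hH x (hUD hx)]

theorem integral_rootedApprox (hD : IsOpen D) (hsc : IsSimplyConnected D)
    (hne : D ≠ univ) (ha : ∀ n, Measurable (a n)) (hz : z ∈ D) {ε : ℝ} (hε : 0 < ε)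
    (hεD : ∀ x ∈ tsupport f, closedBall x ε ⊆ D) (ω : Ω) :
    ∫ x, f x ∂(rootedApprox D e a γ z ε ω) = rootedIntegral e a γ z f ε ω := by
  have hUm := (isOpen_setOf_closedBall_subset hD ε).measurableSet
  rw [rootedApprox, integral_withDensity_eq_integral_toReal_smul₀
    (measurable_density_rootedApprox e hD hsc hne ha hz γ hε ω).ennreal_ofReal
    (.of_forall fun _ ↦ ENNReal.ofReal_lt_top), rootedIntegral]
  have h1 : ∀ x, (ENNReal.ofReal (ε ^ (γ ^ 2 / 2) *
      Real.exp (γ * rootedReg D e a γ z ε x ω))).toReal • f x = rootedIntegrand e a γ z f ε x ω := by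
    intro x
    rw [ENNReal.toReal_ofReal (by positivity), ← rootWeight_mul_chaosDensity, rootedIntegrand,
      smul_eq_mul]
    ring
  simp_rw [h1]
  refine setIntegral_eq_of_subset_of_ae_sdiff_eq_zero hUm.nullMeasurableSet
    (fun x hx ↦ hεD x hx.1) ?_
  filter_upwards [compl_mem_ae_iff.mpr (measure_singleton z)] with x hxz hx
  have hxf : x ∉ tsupport f := fun h ↦ hx.2 ⟨h, hxz⟩
  rw [rootedIntegrand, image_eq_zero_of_notMem_tsupport hxf, zero_mul, zero_mul]

theorem exists_limit_integral_rootedApprox (hD : IsOpen D) (hsc : IsSimplyConnected D)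
    (hne : D ≠ univ) (ha : ∀ n, Measurable (a n))
    (hlaw : ∀ n, HasLaw (a n) (gaussianReal 0 1) P) (hind : iIndepFun a P) (hz : z ∈ D)
    (hγ : γ ^ 2 < 2) (hf : Continuous f) (hfc : HasCompactSupport f) (hfD : tsupport f ⊆ D) :
    ∃ L : Ω → ℝ, Integrable L P ∧
      (∀ᵐ ω ∂P, Tendsto (fun k : ℕ ↦ ∫ x, f x ∂(rootedApprox D e a γ z ((2 : ℝ)⁻¹ ^ k) ω)) atTop
        (𝓝 (L ω))) ∧
      ∫ ω, L ω ∂P = ∫ x in D, f x * meanDensity D γ z x := by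
  obtain ⟨r, hr, hrD⟩ := exists_radius hD hfc hfD
  -- From `k₀` on, the discs around the support of `f` lie in `D`; the sequence is studied only from
  -- there.
  obtain ⟨k₀, hk₀⟩ := exists_pow_lt_of_lt_one hr (show (2 : ℝ)⁻¹ < 1 by norm_num)
  have hεpos : ∀ k : ℕ, 0 < (2 : ℝ)⁻¹ ^ k := fun k ↦ by positivity
  have hεr : ∀ k : ℕ, ∀ x ∈ tsupport f, closedBall x ((2 : ℝ)⁻¹ ^ (k + k₀)) ⊆ D := fun k x hx ↦
    (closedBall_subset_closedBall ((pow_le_pow_of_le_one (by norm_num) (by norm_num)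
      (Nat.le_add_left k₀ k)).trans hk₀.le)).trans (hrD x hx)
  set Y : ℕ → Ω → ℝ := fun k ↦ rootedIntegral e a γ z f ((2 : ℝ)⁻¹ ^ (k + k₀)) with hY
  have hYi : ∀ k, Integrable (Y k) P := fun k ↦ (integral_rootedIntegral e hD hsc hne ha hlaw hind
    hz hγ hf hfc hfD (hεpos _) (hεr k)).2.1
  obtain ⟨A, hA⟩ := exists_increment_bound e hD hsc hne ha hlaw hind hz hγ hf hfc hfD
  obtain ⟨β, hβ0, hβ1, hβ⟩ := summable_increment_rate hγ
  have hYs : Summable fun k ↦ ∫ ω, |Y (k + 1) ω - Y k ω| ∂P := by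
    refine Summable.of_nonneg_of_le (fun k ↦ integral_nonneg fun _ ↦ abs_nonneg _) (fun k ↦ ?_)
      (((summable_nat_add_iff k₀).mpr hβ).mul_left A)
    have h1 : (2 : ℝ)⁻¹ ^ (k + k₀ + 1) ≤ (2 : ℝ)⁻¹ ^ (k + k₀) :=
      pow_le_pow_of_le_one (by norm_num) (by norm_num) (Nat.le_succ _)
    have h2 : (2 : ℝ)⁻¹ ^ (k + k₀) ≤ ((2 : ℝ)⁻¹ ^ (k + k₀)) ^ β := by
      conv_lhs => rw [← Real.rpow_one ((2 : ℝ)⁻¹ ^ (k + k₀))]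
      exact Real.rpow_le_rpow_of_exponent_ge (hεpos _)
        (pow_le_one₀ (by norm_num) (by norm_num)) hβ1
    have h3 := hA _ _ _ (hεpos (k + k₀ + 1)) h1 h2 (hεr k)
    rw [add_right_comm k k₀ 1] at h3
    simpa only [hY, add_right_comm k k₀ 1] using h3
  obtain ⟨L, hLi, hLt, hLe⟩ := exists_limit_of_summable_increments hYi hYs
  refine ⟨L, hLi, ?_, ?_⟩
  · filter_upwards [hLt] with ω hω
    rw [← tendsto_add_atTop_iff_nat k₀]
    refine hω.congr fun k ↦ ?_
    rw [integral_rootedApprox e hD hsc hne ha hz (hεpos _) (hεr k) ω]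
  · have hSm : MeasurableSet (tsupport f \ {z}) :=
      (isClosed_tsupport f).measurableSet.diff (measurableSet_singleton z)
    have hmean : ∫ x in D, f x * meanDensity D γ z x
        = ∫ x in tsupport f \ {z}, f x * meanDensity D γ z x := by
      refine setIntegral_eq_of_subset_of_ae_sdiff_eq_zero hD.measurableSet.nullMeasurableSet
        (sdiff_subset.trans hfD) ?_
      filter_upwards [compl_mem_ae_iff.mpr (measure_singleton z)] with x hxz hx
      have hxf : x ∉ tsupport f := fun h ↦ hx.2 ⟨h, hxz⟩
      rw [image_eq_zero_of_notMem_tsupport hxf, zero_mul]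
    rw [hmean]
    refine tendsto_nhds_unique hLe ?_
    have hYe : ∀ k, ∫ ω, Y k ω ∂P = ∫ x in tsupport f \ {z},
        f x * rootWeight D γ z ((2 : ℝ)⁻¹ ^ (k + k₀)) x * conformalRadius D x ^ (γ ^ 2 / 2) :=
      fun k ↦ (integral_rootedIntegral e hD hsc hne ha hlaw hind hz hγ hf hfc hfD (hεpos _)
        (hεr k)).2.2
    simp_rw [hYe]
    obtain ⟨B, hB0, hB⟩ := exists_weight_bound hD hsc hne hz γ hf hfc hfD
    refine tendsto_integral_of_dominated_convergence (fun x ↦ B * ‖x - z‖ ^ (-γ ^ 2)) (fun k ↦ ?_)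
      ((integrableOn_rpow_of_isCompact hγ hfc B).mono_set sdiff_subset) (fun k ↦ ?_) ?_
    · refine (ContinuousOn.mono ?_ (sdiff_subset.trans hfD)).aestronglyMeasurable hSm
      exact (hf.continuousOn.mul (continuousOn_rootWeight hD hsc hne hz γ (hεpos _))).mul
        (continuousOn_conformalRadius_rpow hD hsc hne _)
    · filter_upwards [ae_restrict_mem hSm] with x hx
      have hC := conformalRadius_pos hD hsc hne (hfD hx.1)
      rw [norm_mul, norm_mul, Real.norm_eq_abs, Real.norm_of_nonneg (Real.rpow_nonneg hC.le _),
        Real.norm_of_nonneg (r := rootWeight D γ z _ x) (Real.exp_pos _).le]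
      exact (hB _ (hεpos _) x hx.1 hx.2).1
    · filter_upwards [ae_restrict_mem hSm] with x hx
      have hxz : 0 < ‖x - z‖ := norm_pos_iff.mpr (sub_ne_zero.mpr hx.2)
      -- For fixed `x ≠ z` the weight no longer changes once the radius is below `‖x - z‖`.
      refine tendsto_const_nhds.congr' ?_
      have h1 : Tendsto (fun k : ℕ ↦ (2 : ℝ)⁻¹ ^ (k + k₀)) atTop (𝓝 0) :=
        (tendsto_add_atTop_iff_nat k₀).mpr
          (tendsto_pow_atTop_nhds_zero_of_lt_one (by norm_num) (by norm_num))
      filter_upwards [h1.eventually (ge_mem_nhds hxz)] with k hk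
      rw [rootWeight_of_le D γ z (hεpos _) hk, meanDensity]
      ring

end Convergence
end LiouvilleGFF

namespace LiouvilleGFF

open Metric

/-! ### Exhaustion of an open set by compactly supported functions -/

section Exhaustion

/-- Continuous functions with compact support in `O` that increase to the indicator function
of `O`. -/
noncomputable def exhaust (O : Set ℂ) (j : ℕ) (x : ℂ) : ℝ :=
  max 0 (min 1 (j * infDist x Oᶜ - 1)) * max 0 (min 1 (j + 1 - ‖x‖))

variable {O : Set ℂ}

theorem continuous_exhaust (O : Set ℂ) (j : ℕ) : Continuous (exhaust O j) := by
  unfold exhaust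
  have := continuous_infDist_pt (Oᶜ)
  fun_prop

theorem exhaust_nonneg (O : Set ℂ) (j : ℕ) (x : ℂ) : 0 ≤ exhaust O j x :=
  mul_nonneg (le_max_left _ _) (le_max_left _ _)

theorem exhaust_le_one (O : Set ℂ) (j : ℕ) (x : ℂ) : exhaust O j x ≤ 1 :=
  mul_le_one₀ (max_le zero_le_one (min_le_left _ _)) (le_max_left _ _)
    (max_le zero_le_one (min_le_left _ _))

theorem monotone_exhaust (O : Set ℂ) (x : ℂ) : Monotone fun j ↦ exhaust O j x := by
  intro i j hij
  have h : (i : ℝ) ≤ j := by exact_mod_cast hij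
  simp only [exhaust]
  have := infDist_nonneg (x := x) (s := Oᶜ)
  gcongr

theorem tsupport_exhaust_subset' (O : Set ℂ) (j : ℕ) :
    tsupport (exhaust O j) ⊆ {x | 1 ≤ j * infDist x Oᶜ} ∩ closedBall 0 (j + 1) := by
  have h1 := continuous_infDist_pt (Oᶜ : Set ℂ)
  refine closure_minimal (fun x hx ↦ ?_) (IsClosed.inter (isClosed_le (by fun_prop) (by fun_prop))
    isClosed_closedBall)
  by_contra h
  refine hx ?_
  rw [exhaust]
  rw [mem_inter_iff, not_and_or, mem_closedBall_zero_iff] at h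
  rcases h with h | h
  · rw [mem_ofPred_eq, not_le] at h
    rw [max_eq_left ((min_le_right _ _).trans (by linarith)), zero_mul]
  · rw [max_eq_left (a := (0 : ℝ)) (b := min 1 ((j : ℝ) + 1 - ‖x‖))
      ((min_le_right _ _).trans (by linarith)), mul_zero]

theorem hasCompactSupport_exhaust (O : Set ℂ) (j : ℕ) : HasCompactSupport (exhaust O j) :=
  (isCompact_closedBall (0 : ℂ) (j + 1)).of_isClosed_subset (isClosed_tsupport _)
    ((tsupport_exhaust_subset' O j).trans inter_subset_right)

theorem tsupport_exhaust_subset (O : Set ℂ) (j : ℕ) : tsupport (exhaust O j) ⊆ O := by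
  intro x hx
  by_contra h
  have h1 := (tsupport_exhaust_subset' O j hx).1
  rw [mem_ofPred_eq, infDist_zero_of_mem (show x ∈ Oᶜ from h), mul_zero] at h1
  linarith

/-- A compact subset has positive distance to the complement. The condition `O ≠ univ` matters:
`infDist` to the empty set is `0`, so `exhaust univ` vanishes. -/
theorem exists_exhaust_eq_one (hO : IsOpen O) (hne : O ≠ univ) {K : Set ℂ} (hK : IsCompact K)
    (hKO : K ⊆ O) : ∃ j₀, ∀ j ≥ j₀, ∀ x ∈ K, exhaust O j x = 1 := by
  have hcne : (Oᶜ).Nonempty := nonempty_compl.mpr hne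
  obtain ⟨R, hR⟩ := hK.isBounded.exists_norm_le
  obtain ⟨d, hd, hKd⟩ : ∃ d > 0, ∀ x ∈ K, d ≤ infDist x Oᶜ := by
    rcases K.eq_empty_or_nonempty with rfl | hKne
    · exact ⟨1, one_pos, by simp⟩
    · obtain ⟨x₀, hx₀, hmin⟩ := hK.exists_isMinOn hKne (continuous_infDist_pt (Oᶜ)).continuousOn
      exact ⟨infDist x₀ Oᶜ, (hO.isClosed_compl.notMem_iff_infDist_pos hcne).mp
        (not_not_intro (hKO hx₀)), fun x hx ↦ hmin hx⟩
  obtain ⟨j₀, hj₀⟩ := exists_nat_ge (max R (2 / d))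
  refine ⟨j₀, fun j hj x hx ↦ ?_⟩
  have hjj : max R (2 / d) ≤ (j : ℝ) := hj₀.trans (by exact_mod_cast hj)
  have h1 : (2 : ℝ) ≤ j * infDist x Oᶜ := by
    have h2 : 2 / d * d ≤ j * infDist x Oᶜ := by
      have := hKd x hx
      have := (le_max_right R (2 / d)).trans hjj
      gcongr
    rwa [div_mul_cancel₀ _ hd.ne'] at h2
  have h2 : ‖x‖ ≤ j := (hR x hx).trans ((le_max_left _ _).trans hjj)
  rw [exhaust, min_eq_left (by linarith), min_eq_left (by linarith), max_eq_right zero_le_one,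
    mul_one]

theorem tendsto_exhaust (hO : IsOpen O) (hne : O ≠ univ) (x : ℂ) :
    Tendsto (fun j ↦ exhaust O j x) atTop (𝓝 (O.indicator 1 x)) := by
  by_cases hx : x ∈ O
  · obtain ⟨j₀, h⟩ := exists_exhaust_eq_one hO hne isCompact_singleton (singleton_subset_iff.mpr hx)
    refine tendsto_const_nhds.congr' ?_
    filter_upwards [eventually_ge_atTop j₀] with j hj
    rw [h j hj x rfl, indicator_of_mem hx, Pi.one_apply]
  · refine tendsto_const_nhds.congr fun j ↦ ?_
    rw [indicator_of_notMem hx]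
    exact (image_eq_zero_of_notMem_tsupport fun h ↦ hx (tsupport_exhaust_subset O j h)).symm

theorem tendsto_lintegral_exhaust (hO : IsOpen O) (hne : O ≠ univ) (μ : Measure ℂ)
    {g : ℂ → ENNReal} (hg : AEMeasurable g μ) :
    Tendsto (fun j ↦ ∫⁻ x, ENNReal.ofReal (exhaust O j x) * g x ∂μ) atTop
      (𝓝 (∫⁻ x in O, g x ∂μ)) := by
  rw [← lintegral_indicator hO.measurableSet]
  refine lintegral_tendsto_of_tendsto_of_monotone (fun j ↦ ?_) (.of_forall fun x ↦ ?_)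
    (.of_forall fun x ↦ ?_)
  · exact (continuous_exhaust O j).measurable.ennreal_ofReal.aemeasurable.mul hg
  · intro i j hij
    simp only
    have := monotone_exhaust O x hij
    gcongr
  · have h := ENNReal.tendsto_ofReal (tendsto_exhaust hO hne x)
    by_cases hx : x ∈ O
    · rw [indicator_of_mem hx] at h ⊢
      have h2 := ENNReal.Tendsto.mul_const (b := g x) h (Or.inl (by simp))
      simpa using h2
    · rw [indicator_of_notMem hx]
      refine tendsto_const_nhds.congr fun j ↦ ?_
      rw [image_eq_zero_of_notMem_tsupport fun h ↦ hx (tsupport_exhaust_subset O j h)]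
      simp

end Exhaustion

/-! ### Existence of vague limits -/

section VagueLimit

variable {D : Set ℂ} {m : ℕ → Measure ℂ}

/-- Integrability has to be tracked separately, since a non-integrable function has integral `0` by
convention and convergence of integrals would prove nothing. -/
theorem eventually_integrable_of_exhaust (hD : IsOpen D) (hne : D ≠ univ)
    (hint : ∀ j, ∀ᶠ k in atTop, Integrable (exhaust D j) (m k)) {f : ℂ → ℝ} (hf : Continuous f)
    (hfc : HasCompactSupport f) (hfD : tsupport f ⊆ D) : ∀ᶠ k in atTop, Integrable f (m k) := by
  obtain ⟨j, hj⟩ := exists_exhaust_eq_one hD hne hfc hfD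
  obtain ⟨c, hc⟩ := hfc.exists_bound_of_continuous hf
  filter_upwards [hint j] with k hk
  refine (hk.const_mul c).mono' hf.aestronglyMeasurable (.of_forall fun x ↦ ?_)
  by_cases hx : x ∈ tsupport f
  · rw [hj j le_rfl x hx, mul_one]
    exact hc x
  · rw [image_eq_zero_of_notMem_tsupport hx, norm_zero]
    exact mul_nonneg ((norm_nonneg _).trans (hc x)) (exhaust_nonneg _ _ _)

/-- Reduction to countably many test functions, needed to work on one almost sure event: `f` is
uniformly approximated by a member of a dense sequence times `exhaust D j`, and the error is
controlled by the bounded integrals of `exhaust D j`. -/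
theorem exists_tendsto_integral (hD : IsOpen D) (hne : D ≠ univ)
    (hint : ∀ j, ∀ᶠ k in atTop, Integrable (exhaust D j) (m k))
    (hlim : ∀ j, ∃ l, Tendsto (fun k ↦ ∫ x, exhaust D j x ∂(m k)) atTop (𝓝 l))
    (hlim' : ∀ i j, ∃ l, Tendsto (fun k ↦ ∫ x, exhaust D j x *
      (TopologicalSpace.denseSeq C(ℂ, ℝ) i) x ∂(m k)) atTop (𝓝 l))
    {f : ℂ → ℝ} (hf : Continuous f) (hfc : HasCompactSupport f) (hfD : tsupport f ⊆ D) :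
    ∃ l, Tendsto (fun k ↦ ∫ x, f x ∂(m k)) atTop (𝓝 l) := by
  obtain ⟨j, hj⟩ := exists_exhaust_eq_one hD hne hfc hfD
  replace hj := hj j le_rfl
  obtain ⟨l₀, hl₀⟩ := hlim j
  set M := l₀ + 1 with hM
  have hMev : ∀ᶠ k in atTop, ∫ x, exhaust D j x ∂(m k) < M :=
    hl₀.eventually (gt_mem_nhds (by linarith))
  have hM0 : 0 < M := by
    obtain ⟨k, hk⟩ := hMev.exists
    exact (integral_nonneg fun x ↦ exhaust_nonneg D j x).trans_lt hk
  refine cauchySeq_tendsto_of_complete (Metric.cauchySeq_iff'.mpr fun ε hε ↦ ?_)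
  set η := ε / (4 * M) with hη
  have hη0 : 0 < η := by positivity
  obtain ⟨i, hi⟩ : ∃ i, ∀ x ∈ tsupport (exhaust D j),
      |f x - (TopologicalSpace.denseSeq C(ℂ, ℝ) i) x| < η := by
    set F : C(ℂ, ℝ) := ⟨f, hf⟩ with hF
    have h1 : {g : C(ℂ, ℝ) | ∀ x ∈ tsupport (exhaust D j), dist (F x) (g x) < η} ∈ 𝓝 F := by
      have h2 := ContinuousMap.tendsto_iff_forall_isCompact_tendstoUniformlyOn.mp
        (tendsto_id (x := 𝓝 F)) _ (hasCompactSupport_exhaust D j)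
      exact Metric.tendstoUniformlyOn_iff.mp h2 η hη0
    obtain ⟨i, hi⟩ := (TopologicalSpace.denseRange_denseSeq C(ℂ, ℝ)).exists_mem_open
      isOpen_interior ⟨F, mem_interior_iff_mem_nhds.mpr h1⟩
    refine ⟨i, fun x hx ↦ ?_⟩
    have h3 := interior_subset hi x hx
    rw [Real.dist_eq] at h3
    exact h3
  set g : ℂ → ℝ := fun x ↦ exhaust D j x * (TopologicalSpace.denseSeq C(ℂ, ℝ) i) x with hg
  have hgc : Continuous g := (continuous_exhaust D j).mul (ContinuousMap.continuous _)
  have hgs : HasCompactSupport g := (hasCompactSupport_exhaust D j).mul_right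
  have hgD : tsupport g ⊆ D := (tsupport_mul_subset_left).trans (tsupport_exhaust_subset D j)
  have hfg : ∀ x, |f x - g x| ≤ η * exhaust D j x := by
    intro x
    have h1 : f x = exhaust D j x * f x := by
      by_cases hx : x ∈ tsupport f
      · rw [hj x hx, one_mul]
      · rw [image_eq_zero_of_notMem_tsupport hx, mul_zero]
    rw [h1, hg, ← mul_sub, abs_mul, abs_of_nonneg (exhaust_nonneg D j x), mul_comm]
    by_cases hx : x ∈ tsupport (exhaust D j)
    · exact mul_le_mul_of_nonneg_right (hi x hx).le (exhaust_nonneg D j x)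
    · rw [image_eq_zero_of_notMem_tsupport hx, mul_zero, mul_zero]
  have hdiff : ∀ᶠ k in atTop, |(∫ x, f x ∂(m k)) - ∫ x, g x ∂(m k)| ≤ ε / 4 := by
    filter_upwards [hMev, hint j, eventually_integrable_of_exhaust hD hne hint hf hfc hfD,
      eventually_integrable_of_exhaust hD hne hint hgc hgs hgD] with k h1 h2 h3 h4
    rw [← integral_sub h3 h4]
    calc |∫ x, (f x - g x) ∂(m k)| ≤ ∫ x, |f x - g x| ∂(m k) := abs_integral_le_integral_abs
      _ ≤ ∫ x, η * exhaust D j x ∂(m k) := integral_mono (h3.sub h4).abs (h2.const_mul η) hfg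
      _ = η * ∫ x, exhaust D j x ∂(m k) := integral_const_mul _ _
      _ ≤ η * M := by gcongr
      _ = ε / 4 := by rw [hη]; field_simp
  obtain ⟨l, hl⟩ := hlim' i j
  obtain ⟨N₁, hN₁⟩ := Metric.cauchySeq_iff.mp hl.cauchySeq (ε / 4) (by positivity)
  obtain ⟨N₂, hN₂⟩ := eventually_atTop.mp hdiff
  refine ⟨max N₁ N₂, fun k hk ↦ ?_⟩
  have h1 := hN₁ k ((le_max_left _ _).trans hk) (max N₁ N₂) (le_max_left _ _)
  have h2 := hN₂ k ((le_max_right _ _).trans hk)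
  have h3 := hN₂ (max N₁ N₂) (le_max_right _ _)
  rw [Real.dist_eq, abs_lt] at h1
  rw [abs_le] at h2 h3
  rw [Real.dist_eq, abs_lt]
  constructor <;> linarith

-- The limits define a positive linear functional on the compactly supported functions on `D`. The
-- Riesz–Markov theorem on the locally compact space `D` gives a measure, which is pushed forward to
-- the plane; extension by zero passes between functions on `D` and on the plane.
open CompactlySupported in
theorem exists_isVagueLimit (hD : IsOpen D) (hne : D ≠ univ)
    (hint : ∀ j, ∀ᶠ k in atTop, Integrable (exhaust D j) (m k))
    (hlim : ∀ j, ∃ l, Tendsto (fun k ↦ ∫ x, exhaust D j x ∂(m k)) atTop (𝓝 l))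
    (hlim' : ∀ i j, ∃ l, Tendsto (fun k ↦ ∫ x, exhaust D j x *
      (TopologicalSpace.denseSeq C(ℂ, ℝ) i) x ∂(m k)) atTop (𝓝 l)) :
    ∃ μ, IsVagueLimit D m μ := by
  have hex := fun (f : ℂ → ℝ) (hf : Continuous f) (hfc : HasCompactSupport f)
    (hfD : tsupport f ⊆ D) ↦ exists_tendsto_integral hD hne hint hlim hlim' hf hfc hfD
  have : LocallyCompactSpace D := hD.locallyCompactSpace
  set E : C_c(D, ℝ) → ℂ → ℝ := fun g ↦ Function.extend Subtype.val g 0 with hE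
  have hEc : ∀ g, Continuous (E g) := fun g ↦
    HasCompactSupport.continuous_extend_zero hD g.continuous g.hasCompactSupport
  have hEs : ∀ g, HasCompactSupport (E g) := fun g ↦
    g.hasCompactSupport.extend_zero continuous_subtype_val
  have hED : ∀ g, tsupport (E g) ⊆ D := fun g ↦
    (g.hasCompactSupport.tsupport_extend_zero_subset continuous_subtype_val).trans
      (Subtype.coe_image_subset _ _)
  have hE1 : ∀ g x (hx : x ∈ D), E g x = g ⟨x, hx⟩ := fun g x hx ↦
    Subtype.val_injective.extend_apply g 0 (⟨x, hx⟩ : D)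
  have hE0 : ∀ g, ∀ x ∉ D, E g x = 0 := fun g x hx ↦
    Function.extend_apply' _ _ _ fun ⟨y, hy⟩ ↦ hx (hy ▸ y.2)
  choose Λ hΛ using fun g ↦ hex (E g) (hEc g) (hEs g) (hED g)
  have hEi : ∀ g, ∀ᶠ k in atTop, Integrable (E g) (m k) := fun g ↦
    eventually_integrable_of_exhaust hD hne hint (hEc g) (hEs g) (hED g)
  have hadd : ∀ g h, Λ (g + h) = Λ g + Λ h := by
    intro g h
    refine tendsto_nhds_unique (hΛ (g + h)) (((hΛ g).add (hΛ h)).congr' ?_)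
    filter_upwards [hEi g, hEi h] with k h1 h2
    rw [← integral_add h1 h2]
    refine integral_congr_ae (.of_forall fun x ↦ ?_)
    by_cases hx : x ∈ D
    · simp only [hE1 _ x hx]
      rfl
    · simp only [hE0 _ x hx, add_zero]
  have hsmul : ∀ (c : ℝ) g, Λ (c • g) = c • Λ g := by
    intro c g
    refine tendsto_nhds_unique (hΛ (c • g)) (((hΛ g).const_smul c).congr fun k ↦ ?_)
    rw [← integral_smul]
    refine integral_congr_ae (.of_forall fun x ↦ ?_)
    by_cases hx : x ∈ D
    · simp only [hE1 _ x hx]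
      rfl
    · simp only [hE0 _ x hx, smul_zero]
  set Λ' : C_c(D, ℝ) →ₚ[ℝ] ℝ := PositiveLinearMap.mk₀
    { toFun := Λ, map_add' := hadd, map_smul' := hsmul } (fun g hg ↦ by
      refine ge_of_tendsto' (hΛ g) fun k ↦ integral_nonneg fun x ↦ ?_
      by_cases hx : x ∈ D
      · rw [hE1 g x hx]
        exact hg ⟨x, hx⟩
      · rw [hE0 g x hx]
        rfl) with hΛ'
  set ν := RealRMK.rieszMeasure Λ' with hν
  have hemb : MeasurableEmbedding (Subtype.val : D → ℂ) :=
    MeasurableEmbedding.subtype_coe hD.measurableSet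
  refine ⟨ν.map Subtype.val, ?_, fun K hKD hK ↦ ?_, fun f hf hfc hfD ↦ ?_⟩
  · rw [hemb.map_apply]
    have : (Subtype.val : D → ℂ) ⁻¹' Dᶜ = ∅ := by
      ext x
      simp
    rw [this, measure_empty]
  · rw [hemb.map_apply]
    refine IsCompact.measure_lt_top ?_
    rw [Subtype.isCompact_iff, Subtype.image_preimage_coe, inter_eq_right.mpr hKD]
    exact hK
  · set g : C_c(D, ℝ) := ⟨⟨fun x ↦ f x, hf.comp continuous_subtype_val⟩,
      HasCompactSupport.intro (K := Subtype.val ⁻¹' (tsupport f)) (by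
        rw [Subtype.isCompact_iff, Subtype.image_preimage_coe, inter_eq_right.mpr hfD]
        exact hfc) fun x hx ↦ image_eq_zero_of_notMem_tsupport (f := f) hx⟩ with hg
    have hEg : E g = f := by
      ext x
      by_cases hx : x ∈ D
      · exact hE1 g x hx
      · rw [hE0 g x hx, image_eq_zero_of_notMem_tsupport fun h ↦ hx (hfD h)]
    have h1 : ∫ x, f x ∂(ν.map Subtype.val) = Λ g := by
      rw [hemb.integral_map]
      exact RealRMK.integral_rieszMeasure Λ' g
    rw [h1, ← hEg]
    exact hΛ g

theorem IsVagueLimit.integrable_exhaust {μ : Measure ℂ} (h : IsVagueLimit D m μ) {O : Set ℂ}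
    (hOD : O ⊆ D) (j : ℕ) : Integrable (exhaust O j) μ := by
  have hK := h.finite_on_compacts _ ((tsupport_exhaust_subset O j).trans hOD)
    (hasCompactSupport_exhaust O j)
  refine IntegrableOn.integrable_of_forall_notMem_eq_zero (s := tsupport (exhaust O j)) ?_
    fun x hx ↦ image_eq_zero_of_notMem_tsupport hx
  exact Measure.integrableOn_of_bounded (M := 1) hK.ne
    (continuous_exhaust O j).aestronglyMeasurable (.of_forall fun x ↦ by
      rw [Real.norm_of_nonneg (exhaust_nonneg O j x)]
      exact exhaust_le_one O j x)

theorem IsVagueLimit.tendsto_ofReal_integral_exhaust {μ : Measure ℂ} (h : IsVagueLimit D m μ)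
    {O : Set ℂ} (hO : IsOpen O) (hOD : O ⊆ D) (hne : O ≠ univ) :
    Tendsto (fun j ↦ ENNReal.ofReal (∫ x, exhaust O j x ∂μ)) atTop (𝓝 (μ O)) := by
  have h1 := tendsto_lintegral_exhaust hO hne μ (g := fun _ ↦ 1) aemeasurable_const
  simp only [mul_one, lintegral_const, Measure.restrict_apply_univ, one_mul] at h1
  refine h1.congr fun j ↦ ?_
  rw [ofReal_integral_eq_lintegral_ofReal (h.integrable_exhaust hOD j)
    (.of_forall fun x ↦ exhaust_nonneg O j x)]

end VagueLimit
end LiouvilleGFF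

namespace LiouvilleGFF

open Metric

/-! ### The rooted Liouville measure and its mean -/

section Mean

variable {Ω : Type*} {D : Set ℂ} (e : HilbertBasis ℕ ℝ (H1 D)) {a : ℕ → Ω → ℝ} {γ : ℝ} {z : ℂ}

theorem aemeasurable_meanDensity (hD : IsOpen D) (hsc : IsSimplyConnected D) (hne : D ≠ univ)
    (hz : z ∈ D) (γ : ℝ) : AEMeasurable (meanDensity D γ z) (volume.restrict D) := by
  obtain ⟨φ, hφ⟩ := exists_isConformalToDisc hD hsc hne hz
  have h1 := ((continuousOn_greenCorrection hD hz hφ).const_mul (γ ^ 2)).rexp.aemeasurable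
    (μ := volume) hD.measurableSet
  have h2 := (continuousOn_conformalRadius_rpow hD hsc hne (γ ^ 2 / 2)).aemeasurable
    (μ := volume) hD.measurableSet
  have h3 : Measurable fun x : ℂ ↦ ‖x - z‖ ^ (-γ ^ 2) := by fun_prop
  exact (h3.aemeasurable.mul h1).mul h2

theorem meanDensity_nonneg (hD : IsOpen D) (hsc : IsSimplyConnected D) (hne : D ≠ univ) {x : ℂ}
    (hx : x ∈ D) : 0 ≤ meanDensity D γ z x := by
  have := conformalRadius_pos hD hsc hne hx
  rw [meanDensity]
  positivity

theorem integrableOn_mul_meanDensity (hD : IsOpen D) (hsc : IsSimplyConnected D) (hne : D ≠ univ)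
    (hz : z ∈ D) (hγ : γ ^ 2 < 2) {f : ℂ → ℝ} (hf : Continuous f) (hfc : HasCompactSupport f)
    (hfD : tsupport f ⊆ D) : IntegrableOn (fun x ↦ f x * meanDensity D γ z x) D := by
  obtain ⟨B, hB0, hB⟩ := exists_weight_bound hD hsc hne hz γ hf hfc hfD
  have hm : AEStronglyMeasurable (fun x ↦ f x * meanDensity D γ z x)
      (volume.restrict (tsupport f)) :=
    ((hf.measurable.aemeasurable.mul (aemeasurable_meanDensity hD hsc hne hz γ)).mono_measure
      (Measure.restrict_mono_set volume hfD)).aestronglyMeasurable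
  have h1 : IntegrableOn (fun x ↦ f x * meanDensity D γ z x) (tsupport f) := by
    refine (integrableOn_rpow_of_isCompact (z := z) hγ hfc B).mono' hm ?_
    filter_upwards [ae_restrict_mem (isClosed_tsupport f).measurableSet,
      ae_restrict_of_ae (compl_mem_ae_iff.mpr (measure_singleton z))] with x hx hxz
    have hpos : 0 < ‖x - z‖ := norm_pos_iff.mpr (sub_ne_zero.mpr hxz)
    rw [norm_mul, Real.norm_eq_abs, Real.norm_of_nonneg (meanDensity_nonneg hD hsc hne (hfD hx)),
      meanDensity, ← rootWeight_of_le D γ z hpos le_rfl, ← mul_assoc]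
    exact (hB _ hpos x hx hxz).1
  refine h1.of_ae_sdiff_eq_zero hD.measurableSet.nullMeasurableSet (.of_forall fun x hx ↦ ?_)
  rw [image_eq_zero_of_notMem_tsupport hx.2, zero_mul]

variable [MeasurableSpace Ω] {P : Measure Ω} [IsProbabilityMeasure P]

theorem ae_integrable_rootedApprox (hD : IsOpen D) (hsc : IsSimplyConnected D) (hne : D ≠ univ)
    (ha : ∀ n, Measurable (a n)) (hlaw : ∀ n, HasLaw (a n) (gaussianReal 0 1) P)
    (hind : iIndepFun a P) (hz : z ∈ D) (hγ : γ ^ 2 < 2) {f : ℂ → ℝ} (hf : Continuous f)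
    (hfc : HasCompactSupport f) (hfD : tsupport f ⊆ D) {ε : ℝ} (hε : 0 < ε)
    (hεD : ∀ x ∈ tsupport f, closedBall x ε ⊆ D) :
    ∀ᵐ ω ∂P, Integrable f (rootedApprox D e a γ z ε ω) := by
  have hUm := (isOpen_setOf_closedBall_subset hD ε).measurableSet
  filter_upwards [(integral_rootedIntegral e hD hsc hne ha hlaw hind hz hγ hf hfc hfD hε
    hεD).1.prod_left_ae] with ω hω
  rw [rootedApprox, integrable_withDensity_iff_integrable_smul₀'
    (measurable_density_rootedApprox e hD hsc hne ha hz γ hε ω).ennreal_ofReal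
    (.of_forall fun _ ↦ ENNReal.ofReal_lt_top)]
  have h1 : ∀ x, (ENNReal.ofReal (ε ^ (γ ^ 2 / 2) *
      Real.exp (γ * rootedReg D e a γ z ε x ω))).toReal • f x = rootedIntegrand e a γ z f ε x ω := by
    intro x
    rw [ENNReal.toReal_ofReal (by positivity), ← rootWeight_mul_chaosDensity, rootedIntegrand,
      smul_eq_mul]
    ring
  simp_rw [h1]
  refine IntegrableOn.of_ae_sdiff_eq_zero (s := tsupport f \ {z}) hω hUm.nullMeasurableSet ?_
  filter_upwards [compl_mem_ae_iff.mpr (measure_singleton z)] with x hxz hx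
  have hxf : x ∉ tsupport f := fun h ↦ hx.2 ⟨h, hxz⟩
  rw [rootedIntegrand, image_eq_zero_of_notMem_tsupport hxf, zero_mul, zero_mul]

theorem ae_isVagueLimit_rootedLiouville (hD : IsOpen D) (hsc : IsSimplyConnected D)
    (hne : D ≠ univ) (ha : ∀ n, Measurable (a n))
    (hlaw : ∀ n, HasLaw (a n) (gaussianReal 0 1) P) (hind : iIndepFun a P) (hz : z ∈ D)
    (hγ : γ ^ 2 < 2) :
    ∀ᵐ ω ∂P, IsVagueLimit D (fun k : ℕ ↦ rootedApprox D e a γ z ((2 : ℝ)⁻¹ ^ k) ω)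
      (rootedLiouville D e a γ z ω) := by
  have hpow : Tendsto (fun k : ℕ ↦ (2 : ℝ)⁻¹ ^ k) atTop (𝓝 0) :=
    tendsto_pow_atTop_nhds_zero_of_lt_one (by norm_num) (by norm_num)
  have h1 : ∀ᵐ ω ∂P, ∀ j, ∀ᶠ k : ℕ in atTop,
      Integrable (exhaust D j) (rootedApprox D e a γ z ((2 : ℝ)⁻¹ ^ k) ω) := by
    refine ae_all_iff.mpr fun j ↦ ?_
    obtain ⟨r, hr, hrD⟩ := exists_radius hD (hasCompactSupport_exhaust D j)
      (tsupport_exhaust_subset D j)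
    obtain ⟨k₀, hk₀⟩ := eventually_atTop.mp (hpow.eventually (ge_mem_nhds hr))
    have h2 : ∀ᵐ ω ∂P, ∀ k ≥ k₀,
        Integrable (exhaust D j) (rootedApprox D e a γ z ((2 : ℝ)⁻¹ ^ k) ω) := by
      refine ae_all_iff.mpr fun k ↦ ?_
      by_cases hk : k ≥ k₀
      · filter_upwards [ae_integrable_rootedApprox e hD hsc hne ha hlaw hind hz hγ
          (continuous_exhaust D j) (hasCompactSupport_exhaust D j) (tsupport_exhaust_subset D j)
          (by positivity) fun x hx ↦ (closedBall_subset_closedBall (hk₀ k hk)).trans (hrD x hx)]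
          with ω hω _ using hω
      · exact .of_forall fun ω h ↦ absurd h hk
    filter_upwards [h2] with ω hω
    exact eventually_atTop.mpr ⟨k₀, hω⟩
  have h2 : ∀ᵐ ω ∂P, ∀ j, ∃ l, Tendsto (fun k : ℕ ↦
      ∫ x, exhaust D j x ∂(rootedApprox D e a γ z ((2 : ℝ)⁻¹ ^ k) ω)) atTop (𝓝 l) := by
    refine ae_all_iff.mpr fun j ↦ ?_
    obtain ⟨L, -, hL, -⟩ := exists_limit_integral_rootedApprox e hD hsc hne ha hlaw hind hz hγ
      (continuous_exhaust D j) (hasCompactSupport_exhaust D j) (tsupport_exhaust_subset D j)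
    filter_upwards [hL] with ω hω using ⟨_, hω⟩
  have h3 : ∀ᵐ ω ∂P, ∀ i j, ∃ l, Tendsto (fun k : ℕ ↦
      ∫ x, exhaust D j x * (TopologicalSpace.denseSeq C(ℂ, ℝ) i) x
        ∂(rootedApprox D e a γ z ((2 : ℝ)⁻¹ ^ k) ω)) atTop (𝓝 l) := by
    refine ae_all_iff.mpr fun i ↦ ae_all_iff.mpr fun j ↦ ?_
    obtain ⟨L, -, hL, -⟩ := exists_limit_integral_rootedApprox e hD hsc hne ha hlaw hind hz hγ
      ((continuous_exhaust D j).mul (ContinuousMap.continuous (TopologicalSpace.denseSeq C(ℂ, ℝ) i)))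
      (hasCompactSupport_exhaust D j).mul_right
      (tsupport_mul_subset_left.trans (tsupport_exhaust_subset D j))
    filter_upwards [hL] with ω hω using ⟨_, hω⟩
  filter_upwards [h1, h2, h3] with ω h1 h2 h3
  have h : ∃ μ, IsVagueLimit D (fun k : ℕ ↦ rootedApprox D e a γ z ((2 : ℝ)⁻¹ ^ k) ω) μ :=
    exists_isVagueLimit hD hne h1 h2 h3
  rw [rootedLiouville, dif_pos h]
  exact h.choose_spec

/-- Monotone convergence on both sides along `exhaust O j`: the integrals of these functions are
measurable limits with known mean, and they increase to the mass of `O`. -/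
theorem mean_rootedLiouville (hD : IsOpen D) (hsc : IsSimplyConnected D) (hne : D ≠ univ)
    (ha : ∀ n, Measurable (a n)) (hlaw : ∀ n, HasLaw (a n) (gaussianReal 0 1) P)
    (hind : iIndepFun a P) (hz : z ∈ D) (hγ : γ ^ 2 < 2) {O : Set ℂ} (hO : IsOpen O)
    (hOD : O ⊆ D) :
    AEMeasurable (fun ω ↦ rootedLiouville D e a γ z ω O) P ∧
      ∫⁻ ω, rootedLiouville D e a γ z ω O ∂P
        = ∫⁻ x in O, ENNReal.ofReal (meanDensity D γ z x) := by
  have hOne : O ≠ univ := fun h ↦ hne (eq_univ_of_univ_subset (h ▸ hOD))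
  choose L hLi hLt hLe using fun j ↦ exists_limit_integral_rootedApprox e hD hsc hne ha hlaw hind
    hz hγ (continuous_exhaust O j) (hasCompactSupport_exhaust O j)
    ((tsupport_exhaust_subset O j).trans hOD)
  have hvague := ae_isVagueLimit_rootedLiouville e hD hsc hne ha hlaw hind hz hγ (P := P)
  -- Although the measure is picked by choice for each `ω`, uniqueness of limits pins down these
  -- integrals.
  have hLeq : ∀ᵐ ω ∂P, ∀ j, ∫ x, exhaust O j x ∂(rootedLiouville D e a γ z ω) = L j ω := by
    filter_upwards [hvague, ae_all_iff.mpr hLt] with ω h1 h2 j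
    exact tendsto_nhds_unique (h1.tendsto _ (continuous_exhaust O j) (hasCompactSupport_exhaust O j)
      ((tsupport_exhaust_subset O j).trans hOD)) (h2 j)
  have htend : ∀ᵐ ω ∂P, Tendsto (fun j ↦ ENNReal.ofReal (L j ω)) atTop
      (𝓝 (rootedLiouville D e a γ z ω O)) := by
    filter_upwards [hvague, hLeq] with ω h1 h2
    simpa only [h2] using h1.tendsto_ofReal_integral_exhaust hO hOD hOne
  have hm : ∀ j, AEMeasurable (fun ω ↦ ENNReal.ofReal (L j ω)) P := fun j ↦
    (hLi j).aemeasurable.ennreal_ofReal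
  refine ⟨aemeasurable_of_tendsto_metrizable_ae atTop hm htend, ?_⟩
  have hmono : ∀ᵐ ω ∂P, Monotone fun j ↦ ENNReal.ofReal (L j ω) := by
    filter_upwards [hvague, hLeq] with ω h1 h2 i j hij
    simp only [← h2]
    exact ENNReal.ofReal_le_ofReal (integral_mono (h1.integrable_exhaust hOD i)
      (h1.integrable_exhaust hOD j) fun x ↦ monotone_exhaust O x hij)
  refine tendsto_nhds_unique (lintegral_tendsto_of_tendsto_of_monotone hm hmono htend) ?_
  have hlim := tendsto_lintegral_exhaust hO hOne (volume.restrict D)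
    (g := fun x ↦ ENNReal.ofReal (meanDensity D γ z x))
    (aemeasurable_meanDensity hD hsc hne hz γ).ennreal_ofReal
  rw [Measure.restrict_restrict hO.measurableSet, inter_eq_left.mpr hOD] at hlim
  refine hlim.congr fun j ↦ ?_
  have hL0 : 0 ≤ᵐ[P] L j := by
    filter_upwards [hLeq] with ω h
    rw [Pi.zero_apply, ← h j]
    exact integral_nonneg fun x ↦ exhaust_nonneg O j x
  rw [← ofReal_integral_eq_lintegral_ofReal (hLi j) hL0, hLe j,
    ofReal_integral_eq_lintegral_ofReal (integrableOn_mul_meanDensity hD hsc hne hz hγ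
      (continuous_exhaust O j) (hasCompactSupport_exhaust O j)
      ((tsupport_exhaust_subset O j).trans hOD))]
  · exact lintegral_congr fun x ↦ (ENNReal.ofReal_mul (exhaust_nonneg O j x)).symm
  · filter_upwards [ae_restrict_mem hD.measurableSet] with x hx
    exact mul_nonneg (exhaust_nonneg O j x) (meanDensity_nonneg hD hsc hne hx)

theorem mean_rootedLiouville_ball (hD : IsOpen D) (hsc : IsSimplyConnected D) (hne : D ≠ univ)
    (ha : ∀ n, Measurable (a n)) (hlaw : ∀ n, HasLaw (a n) (gaussianReal 0 1) P)
    (hind : iIndepFun a P) (hz : z ∈ D) (hγ : γ ^ 2 < 2) (r : ℝ) :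
    AEMeasurable (fun ω ↦ rootedLiouville D e a γ z ω (ball z r)) P ∧
      (ball z r ⊆ D → (∫⁻ ω, rootedLiouville D e a γ z ω (ball z r) ∂P).toReal
        = ∫ x in ball z r, meanDensity D γ z x) := by
  constructor
  -- A large ball may leave `D`; the measure is carried by `D`, so it suffices to treat the
  -- intersection.
  · refine (mean_rootedLiouville e hD hsc hne ha hlaw hind hz hγ (isOpen_ball.inter hD)
      (inter_subset_right (s := ball z r))).1.congr ?_
    filter_upwards [ae_isVagueLimit_rootedLiouville e hD hsc hne ha hlaw hind hz hγ (P := P)]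
      with ω hω
    exact measure_inter_conull hω.carried
  · intro hr
    rw [(mean_rootedLiouville e hD hsc hne ha hlaw hind hz hγ isOpen_ball hr).2,
      integral_eq_lintegral_of_nonneg_ae]
    · filter_upwards [ae_restrict_mem measurableSet_ball] with x hx
      exact meanDensity_nonneg hD hsc hne (hr hx)
    · exact ((aemeasurable_meanDensity hD hsc hne hz γ).mono_measure
        (Measure.restrict_mono_set volume hr)).aestronglyMeasurable

/-! ### Asymptotics at the root -/

/-- The origin of the exponent `3γ²/2`: the root contributes `γ²`, as G̃ᶻ(z) = log C(z, D), and the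
mean of the density contributes `γ²/2`. -/
theorem conformalRadius_rpow_mul_rpow (hD : IsOpen D) (hsc : IsSimplyConnected D) (hne : D ≠ univ)
    (hz : z ∈ D) (γ : ℝ) :
    Real.exp (γ ^ 2 * greenCorrection D z z) * conformalRadius D z ^ (γ ^ 2 / 2)
      = conformalRadius D z ^ (3 * γ ^ 2 / 2) := by
  obtain ⟨φ, hφ⟩ := exists_isConformalToDisc hD hsc hne hz
  have hC := conformalRadius_pos hD hsc hne hz
  rw [greenCorrection_self hD hz hφ, mul_comm (γ ^ 2), ← Real.rpow_def_of_pos hC,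
    ← Real.rpow_add hC]
  ring_nf

/-- The density is `‖x - z‖ ^ (-γ ^ 2)` times a function `g`, continuous and positive at `z`.
Freezing `g` at `z` costs a relative error at most `c` on small balls. -/
theorem isEquivalent_integral_meanDensity (hD : IsOpen D) (hsc : IsSimplyConnected D)
    (hne : D ≠ univ) (hz : z ∈ D) (hγ : γ ^ 2 < 2) :
    Asymptotics.IsEquivalent (𝓝[>] (0 : ℝ)) (fun r ↦ ∫ x in ball z r, meanDensity D γ z x)
      (fun r ↦ 2 * Real.pi / (2 - γ ^ 2) * conformalRadius D z ^ (3 * γ ^ 2 / 2)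
        * r ^ (2 - γ ^ 2)) := by
  obtain ⟨φ, hφ⟩ := exists_isConformalToDisc hD hsc hne hz
  set g : ℂ → ℝ := fun x ↦ Real.exp (γ ^ 2 * greenCorrection D z x) *
    conformalRadius D x ^ (γ ^ 2 / 2) with hg
  have hgc : ContinuousAt g z :=
    (((continuousOn_greenCorrection hD hz hφ).const_mul (γ ^ 2)).rexp.mul
      (continuousOn_conformalRadius_rpow hD hsc hne (γ ^ 2 / 2))).continuousAt (hD.mem_nhds hz)
  have hgz : g z = conformalRadius D z ^ (3 * γ ^ 2 / 2) :=
    conformalRadius_rpow_mul_rpow hD hsc hne hz γ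
  have hgz0 : 0 < g z := by
    rw [hgz]
    exact Real.rpow_pos_of_pos (conformalRadius_pos hD hsc hne hz) _
  have hg2 : 0 < 2 - γ ^ 2 := by linarith
  rw [← hgz]
  refine Asymptotics.IsLittleO.of_bound fun c hc ↦ ?_
  obtain ⟨δ, hδ, hball⟩ := Metric.mem_nhds_iff.mp
    (inter_mem (hD.mem_nhds hz) (hgc.eventually (Metric.ball_mem_nhds (g z) (mul_pos hc hgz0))))
  filter_upwards [Ioo_mem_nhdsGT hδ] with r hr
  have hsub : ball z r ⊆ ball z δ := ball_subset_ball hr.2.le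
  have hgd : ∀ x ∈ ball z r, |g x - g z| ≤ c * g z := fun x hx ↦ by
    have h := (hball (hsub hx)).2
    exact (mem_ball_iff_norm.mp h).le
  obtain ⟨hint, hval⟩ := integrableOn_ball_rpow_norm_sub z (d := r) hγ
  replace hval := hval hr.1.le
  have hmean : ∀ x, meanDensity D γ z x = ‖x - z‖ ^ (-γ ^ 2) * g x := fun x ↦ by
    rw [meanDensity, mul_assoc]
  have hbd : ∀ x ∈ ball z r, ‖meanDensity D γ z x - g z * ‖x - z‖ ^ (-γ ^ 2)‖
      ≤ c * g z * ‖x - z‖ ^ (-γ ^ 2) := by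
    intro x hx
    have h0 : 0 ≤ ‖x - z‖ ^ (-γ ^ 2) := by positivity
    rw [hmean, mul_comm _ (g x), ← sub_mul, norm_mul, Real.norm_of_nonneg h0]
    exact mul_le_mul_of_nonneg_right (hgd x hx) h0
  have hmm : AEStronglyMeasurable (meanDensity D γ z) (volume.restrict (ball z r)) :=
    ((aemeasurable_meanDensity hD hsc hne hz γ).mono_measure (Measure.restrict_mono_set volume
      fun x hx ↦ (hball (hsub hx)).1)).aestronglyMeasurable
  have hdi : IntegrableOn (fun x ↦ meanDensity D γ z x - g z * ‖x - z‖ ^ (-γ ^ 2)) (ball z r) := by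
    refine (hint.const_mul (c * g z)).mono' (hmm.sub (hint.const_mul _).1) ?_
    filter_upwards [ae_restrict_mem measurableSet_ball] with x hx using hbd x hx
  have hmi : IntegrableOn (meanDensity D γ z) (ball z r) := by
    refine (hdi.add (hint.const_mul (g z))).congr (.of_forall fun x ↦ ?_)
    simp
  have hJ : 2 * Real.pi / (2 - γ ^ 2) * g z * r ^ (2 - γ ^ 2)
      = ∫ x in ball z r, g z * ‖x - z‖ ^ (-γ ^ 2) := by
    rw [integral_const_mul, hval]
    ring
  have hJ0 : 0 ≤ 2 * Real.pi / (2 - γ ^ 2) * g z * r ^ (2 - γ ^ 2) := by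
    have := hr.1
    positivity
  rw [Pi.sub_apply, Real.norm_of_nonneg hJ0]
  calc ‖(∫ x in ball z r, meanDensity D γ z x) - 2 * Real.pi / (2 - γ ^ 2) * g z * r ^ (2 - γ ^ 2)‖
      = ‖∫ x in ball z r, (meanDensity D γ z x - g z * ‖x - z‖ ^ (-γ ^ 2))‖ := by
        rw [hJ, integral_sub hmi (hint.const_mul _)]
    _ ≤ ∫ x in ball z r, c * g z * ‖x - z‖ ^ (-γ ^ 2) :=
        norm_integral_le_of_norm_le (hint.const_mul _)
          ((ae_restrict_mem measurableSet_ball).mono hbd)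
    _ = c * (2 * Real.pi / (2 - γ ^ 2) * g z * r ^ (2 - γ ^ 2)) := by
        rw [integral_const_mul, hval]
        ring

/-- An exact identity, by the exponents of `r`: `γQ = 2 + γ²/2`, the Gaussian moment gives `-γ²/2`
and the truncated logarithm at the root gives `-γ²`. -/
theorem integral_exp_rootedReg_self (hD : IsOpen D) (hsc : IsSimplyConnected D) (hne : D ≠ univ)
    (ha : ∀ n, Measurable (a n)) (hlaw : ∀ n, HasLaw (a n) (gaussianReal 0 1) P)
    (hind : iIndepFun a P) (hγ : 0 < γ) {r : ℝ} (hr : 0 < r) (hrD : closedBall z r ⊆ D) :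
    r ^ (γ * liouvilleQ γ) * ∫ ω, Real.exp (γ * rootedReg D e a γ z r z ω) ∂P
      = conformalRadius D z ^ (3 * γ ^ 2 / 2) * r ^ (2 - γ ^ 2) := by
  have hz := hrD (mem_closedBall_self hr.le)
  have h1 : ∀ ω, Real.exp (γ * rootedReg D e a γ z r z ω)
      = Real.exp (γ * gffReg D e a r z ω) * rootWeight D γ z r z := fun ω ↦ by
    rw [rootedReg, rootWeight, ← Real.exp_add]
    ring_nf
  simp_rw [h1]
  rw [integral_mul_const, (integral_exp_gffReg e hD hsc hne ha hlaw hind hr hrD γ).2,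
    rootWeight_eq D γ z hr, sub_self, norm_zero, max_eq_left hr.le,
    ← conformalRadius_rpow_mul_rpow hD hsc hne hz γ]
  have h2 : γ * liouvilleQ γ = 2 + γ ^ 2 / 2 := by
    rw [liouvilleQ]
    field_simp
  have h3 : r ^ (2 - γ ^ 2) = r ^ (γ * liouvilleQ γ) * r ^ (-(γ ^ 2 / 2)) * r ^ (-γ ^ 2) := by
    rw [h2, ← Real.rpow_add hr, ← Real.rpow_add hr]
    ring_nf
  rw [h3]
  ring

end Mean

/-! ### Dependence on the values of the coefficients only -/

section Congruence

variable {Ω : Type*} {D : Set ℂ} (e : HilbertBasis ℕ ℝ (H1 D)) {a b : ℕ → Ω → ℝ} {ω : Ω}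

/-- These congruences allow the coefficients to be replaced by measurable versions, off one null set
for all `x`, `ε` and `z` simultaneously. -/
theorem rootedReg_congr (h : ∀ n, a n ω = b n ω) (γ : ℝ) (z : ℂ) (ε : ℝ) (x : ℂ) :
    rootedReg D e a γ z ε x ω = rootedReg D e b γ z ε x ω := by
  simp only [rootedReg, gffReg, gffPairing, h]

theorem rootedApprox_congr (h : ∀ n, a n ω = b n ω) (γ : ℝ) (z : ℂ) (ε : ℝ) :
    rootedApprox D e a γ z ε ω = rootedApprox D e b γ z ε ω := by
  simp only [rootedApprox, rootedReg_congr e h]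

theorem rootedLiouville_congr (h : ∀ n, a n ω = b n ω) (γ : ℝ) (z : ℂ) :
    rootedLiouville D e a γ z ω = rootedLiouville D e b γ z ω := by
  have h1 : (fun k : ℕ ↦ rootedApprox D e a γ z ((2 : ℝ)⁻¹ ^ k) ω)
      = fun k : ℕ ↦ rootedApprox D e b γ z ((2 : ℝ)⁻¹ ^ k) ω :=
    funext fun k ↦ rootedApprox_congr e h γ z _
  rw [rootedLiouville, rootedLiouville, h1]

end Congruence
end LiouvilleGFF

/-! ### The main theorem -/

theorem mainTheorem5 {Ω : Type*} [MeasurableSpace Ω] (P : Measure Ω) [IsProbabilityMeasure P]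
    (D : Set ℂ) (hD_open : IsOpen D) (hD_sc : IsSimplyConnected D) (hD_ne : D ≠ Set.univ)
    (e : HilbertBasis ℕ ℝ (LiouvilleGFF.H1 D))
    (a : ℕ → Ω → ℝ) (ha_law : ∀ n, HasLaw (a n) (gaussianReal 0 1) P) (ha_indep : iIndepFun a P)
    (γ : ℝ) (hγ_pos : 0 < γ) (hγ_lt : γ < Real.sqrt 2) (z : ℂ) (hz : z ∈ D) :
    (∀ᵐ ω ∂P, LiouvilleGFF.IsVagueLimit D
        (fun k : ℕ => LiouvilleGFF.rootedApprox D e a γ z ((2 : ℝ)⁻¹ ^ k) ω)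
        (LiouvilleGFF.rootedLiouville D e a γ z ω)) ∧
    (∀ r : ℝ, AEMeasurable
        (fun ω => LiouvilleGFF.rootedLiouville D e a γ z ω (Metric.ball z r)) P) ∧
    Asymptotics.IsEquivalent (𝓝[>] (0 : ℝ))
      (fun r : ℝ =>
        (∫⁻ ω, LiouvilleGFF.rootedLiouville D e a γ z ω (Metric.ball z r) ∂P).toReal)
      (fun r : ℝ => 2 * Real.pi / (2 - γ ^ 2) * r ^ (γ * LiouvilleGFF.liouvilleQ γ) *
        ∫ ω, Real.exp (γ * LiouvilleGFF.rootedReg D e a γ z r z ω) ∂P) ∧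
    Asymptotics.IsEquivalent (𝓝[>] (0 : ℝ))
      (fun r : ℝ =>
        (∫⁻ ω, LiouvilleGFF.rootedLiouville D e a γ z ω (Metric.ball z r) ∂P).toReal)
      (fun r : ℝ => 2 * Real.pi / (2 - γ ^ 2) *
        LiouvilleGFF.conformalRadius D z ^ (3 * γ ^ 2 / 2) * r ^ (2 - γ ^ 2)) ∧
    Asymptotics.IsEquivalent (𝓝[>] (0 : ℝ))
      (fun r : ℝ => 2 * Real.pi / (2 - γ ^ 2) * r ^ (γ * LiouvilleGFF.liouvilleQ γ) *
        ∫ ω, Real.exp (γ * LiouvilleGFF.rootedReg D e a γ z r z ω) ∂P)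
      (fun r : ℝ => 2 * Real.pi / (2 - γ ^ 2) *
        LiouvilleGFF.conformalRadius D z ^ (3 * γ ^ 2 / 2) * r ^ (2 - γ ^ 2)) := by
  classical
  -- `HasLaw` provides only almost everywhere measurability, while joint measurability in `(x, ω)`
  -- requires truly measurable coefficients.
  set b : ℕ → Ω → ℝ := fun n ↦ (ha_law n).aemeasurable.mk (a n) with hb
  have hab : ∀ n, a n =ᵐ[P] b n := fun n ↦ (ha_law n).aemeasurable.ae_eq_mk
  have hbm : ∀ n, Measurable (b n) := fun n ↦ (ha_law n).aemeasurable.measurable_mk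
  have hbl : ∀ n, HasLaw (b n) (gaussianReal 0 1) P := fun n ↦ (ha_law n).congr (hab n).symm
  have hbi : iIndepFun b P := (iIndepFun_congr hab).mp ha_indep
  have hae : ∀ᵐ ω ∂P, ∀ n, a n ω = b n ω := ae_all_iff.mpr hab
  have hγ2 : γ ^ 2 < 2 := (Real.lt_sqrt hγ_pos.le).mp hγ_lt
  have hLm : ∀ r : ℝ, (fun ω ↦ LiouvilleGFF.rootedLiouville D e a γ z ω (Metric.ball z r))
      =ᵐ[P] fun ω ↦ LiouvilleGFF.rootedLiouville D e b γ z ω (Metric.ball z r) := fun r ↦ by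
    filter_upwards [hae] with ω h
    rw [LiouvilleGFF.rootedLiouville_congr e h]
  have hmean := LiouvilleGFF.mean_rootedLiouville_ball e hD_open hD_sc hD_ne hbm hbl hbi hz hγ2
  obtain ⟨ρ, hρ, hρD⟩ := Metric.nhds_basis_closedBall.mem_iff.mp (hD_open.mem_nhds hz)
  have hsmall : ∀ᶠ r in 𝓝[>] (0 : ℝ), 0 < r ∧ Metric.closedBall z r ⊆ D := by
    filter_upwards [Ioo_mem_nhdsGT hρ] with r hr
    exact ⟨hr.1, (Metric.closedBall_subset_closedBall hr.2.le).trans hρD⟩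
  have hfirst : Asymptotics.IsEquivalent (𝓝[>] (0 : ℝ))
      (fun r : ℝ =>
        (∫⁻ ω, LiouvilleGFF.rootedLiouville D e a γ z ω (Metric.ball z r) ∂P).toReal)
      (fun r : ℝ => 2 * Real.pi / (2 - γ ^ 2) *
        LiouvilleGFF.conformalRadius D z ^ (3 * γ ^ 2 / 2) * r ^ (2 - γ ^ 2)) := by
    refine (LiouvilleGFF.isEquivalent_integral_meanDensity hD_open hD_sc hD_ne hz hγ2).congr_left ?_
    filter_upwards [hsmall] with r hr
    rw [lintegral_congr_ae (hLm r), (hmean r).2 (Metric.ball_subset_closedBall.trans hr.2)]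
  -- The two explicit sides are equal as soon as the closed ball of radius `r` lies in `D`.
  have hsecond : (fun r : ℝ => 2 * Real.pi / (2 - γ ^ 2) * r ^ (γ * LiouvilleGFF.liouvilleQ γ) *
        ∫ ω, Real.exp (γ * LiouvilleGFF.rootedReg D e a γ z r z ω) ∂P) =ᶠ[𝓝[>] (0 : ℝ)]
      (fun r : ℝ => 2 * Real.pi / (2 - γ ^ 2) *
        LiouvilleGFF.conformalRadius D z ^ (3 * γ ^ 2 / 2) * r ^ (2 - γ ^ 2)) := by
    filter_upwards [hsmall] with r hr
    have h1 : ∫ ω, Real.exp (γ * LiouvilleGFF.rootedReg D e a γ z r z ω) ∂P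
        = ∫ ω, Real.exp (γ * LiouvilleGFF.rootedReg D e b γ z r z ω) ∂P := by
      refine integral_congr_ae ?_
      filter_upwards [hae] with ω h
      rw [LiouvilleGFF.rootedReg_congr e h]
    rw [h1, mul_assoc, LiouvilleGFF.integral_exp_rootedReg_self e hD_open hD_sc hD_ne hbm hbl hbi
      hγ_pos hr.1 hr.2, mul_assoc]
  refine ⟨?_, fun r ↦ (hmean r).1.congr (hLm r).symm, hfirst.congr_right hsecond.symm, hfirst,
    hsecond.isEquivalent⟩
  filter_upwards [hae, LiouvilleGFF.ae_isVagueLimit_rootedLiouville e hD_open hD_sc hD_ne hbm hbl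
    hbi hz hγ2] with ω h hω
  simpa only [LiouvilleGFF.rootedApprox_congr e h, LiouvilleGFF.rootedLiouville_congr e h] using hω
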